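/- **Model.** A decision maker has a finite set $\mathcal A$ of $K$ actions, $d\ge 1$ resources, each with budget $B=bT$ ($b>0$), and a horizon of $T\ge 1$ rounds. In round $t$ the demand is $$q_t=\alpha+\beta t+\xi_t ,\qquad \alpha>M>0,\ \beta>0,$$ where $\xi_1,\dots,\xi_T$ are independent, zero-mean and supported in $[-M,M]$. Put $Q=\sum_{t=1}^T q_t$ and $\overline q=\alpha+\beta T+M$. An action $a$ taken in round $t$ produces, independently of the demands and of the other rounds, a reward $R_t$ and consumptions $C_{t,1},\dots,C_{t,d}$ per demand unit, with law $P_{a,t}$ on $[0,1]^{d+1}$ whose mean $(r(a);c(a,1),\dots,c(a,d))$ does not depend on $t$; a null action $a_0$ has zero reward and zero consumption. Let $\tau$ be the first $t\le T$ with $\sum_{s\le t}q_sC_{s,j}>B$ for some $j\in[d]$, and $\tau=T+1$ if there is none. The benchmark is $$\mathrm{OPT}_{\mathrm{LP}}=\max\Big\{Q\sum_a r(a)u_a:\ u\in\Delta_K,\ Q\sum_a c(a,i)u_a\le B\ (i\in[d])\Big\}.$$ **Oracle.** For $t\ge 3$ the prediction of $Q$ is $\hat Q_t=\sum_{s=1}^{t-1}q_s+\sum_{s=t}^{T}(\hat\alpha_t+\hat\beta_t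 s)$, where $$\hat\beta_t=\frac{(t-1)\sum_{s<t}sq_s-\big(\sum_{s<t}s\big)\big(\sum_{s<t}q_s\big)}{(t-1)\sum_{s<t}s^2-\big(\sum_{s<t}s\big)^2},\qquad \hat\alpha_t=\frac{\sum_{s<t}q_s-\hat\beta_t\sum_{s<t}s}{t-1}$$ (sums over $1\le s<t$); $\hat Q_1$ (a constant) and $\hat Q_2$ (a measurable function of $q_1$) are arbitrary in $[0,\overline qT]$. **Algorithm OA-UCB with parameter $\delta\in(0,1)$.** Let $\mathrm{rad}(v,N)=\sqrt{2v\log(1/\delta)/N}+4\log(1/\delta)/N$. Let $N^+_{t-1}(a)$ be the maximum of $1$ and the number of times $a$ was taken before round $t$, and let $\hat R_t(a)$, $\hat C_t(a,i)$ be $\frac{1}{N^+_{t-1}(a)}$ times the sums of the rewards and of the consumptions of resource $i$ over those times. Put $\mathrm{UCB}_t(a)=\min\{\hat R_t(a)+\mathrm{rad}(\hat R_t(a),N^+_{t-1}(a)),1\}$, $\mathrm{LCB}_t(a,i)=\max\{\hat C_t(a,i)-\mathrm{rad}(\hat C_t(a,i),N^+_{t-1}(a)),0\}$ for $i\le d$,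 and $\mathrm{LCB}_t(a,d+1)=0$. Start with $\mu_1=(\frac1{d+1},\dots,\frac1{d+1})$, $\theta_1=0\in\mathbb R^{d+1}$, $\eta_1=0$. In round $t\le\tau$ take an action $A_t$ maximizing $\mathrm{UCB}_t(a)-\frac{\hat Q_t}{B}\sum_{j=1}^{d+1}\mu_{t,j}\mathrm{LCB}_t(a,j)$ (ties broken using past observations only); after round $\tau$ take $a_0$. With $g_{t,j}=q_t\big(\mathbf 1_{\{j\le d\}}-\frac{\hat Q_t}{B}\mathrm{LCB}_t(A_t,j)\big)$, let $\rho_1=g_1^\top\mu_1-\min_jg_{1,j}$ and $\rho_t=\eta_t\ln\big(\sum_{j=1}^{d+1}\mu_{t,j}e^{-g_{t,j}/\eta_t}\big)+g_t^\top\mu_t$ for $t\ge2$, and update $\theta_{t+1}=\theta_t-g_t$, $\eta_{t+1}=\eta_t+\rho_t/\ln(d+1)$, $\mu_{t+1,j}=e^{\theta_{t+1,j}/\eta_{t+1}}\big/\sum_{i=1}^{d+1}e^{\theta_{t+1,i}/\eta_{t+1}}$. **Theorem.** There is an absolute constant $C_0>0$ such that, for all $\kappa,c_1,c_2>0$, there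 is a constant $C>0$ depending only on $\kappa,c_1,c_2$ with the following property. Suppose $\alpha\le\kappa\beta$ and $c_1\overline q\le b\le c_2\overline q$ (that is, $b=\Theta(\overline q)$), and let $\epsilon_t=C_0MT^2\sqrt{\log(1/\delta)}\,(\max\{t-1,1\})^{-3/2}$. 1. With probability at least $1-T\delta$: $|Q-\hat Q_t|\le\epsilon_t$ for all $3\le t\le T$, and $$\Big(\frac1Q+\frac1B\Big)\sum_{t=1}^{\tau-1}q_t\epsilon_t\le C\,M\Big(1+\frac{\overline q}{b}\Big)\sqrt{(\tau-1)\log(1/\delta)},\qquad \Big(\frac1Q+\frac1B\Big)\sum_{t=1}^{\tau-1}q_t\epsilon_t\le C\sqrt{\log(1/\delta)}\;M\sqrt{\tau-1}.$$ 2. With probability at least $1-3KTd\delta-T\delta$, $$\mathrm{OPT}_{\mathrm{LP}}-\sum_{t=1}^{\tau-1}q_tR_t\le C\,\log(1/\delta)\log(T+1)\log(d+1)\left(\mathrm{OPT}_{\mathrm{LP}}\sqrt{\frac{\overline qK}{B}}+\sqrt{\overline qK\,\mathrm{OPT}_{\mathrm{LP}}}+(M+\overline q)\sqrt{\tau-1}\right).$$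 -/

import Mathlib

open MeasureTheory ProbabilityTheory

noncomputable section

namespace OAUCB

/-! ### The least-squares prediction oracle for linearly increasing demand -/

/-- Least-squares slope computed from `q 1, …, q (t - 1)`. -/
def betaHat (q : ℕ → ℝ) (t : ℕ) : ℝ :=
  (((t : ℝ) - 1) * ∑ s ∈ Finset.Ico 1 t, (s : ℝ) * q s
      - (∑ s ∈ Finset.Ico 1 t, (s : ℝ)) * ∑ s ∈ Finset.Ico 1 t, q s) /
    (((t : ℝ) - 1) * ∑ s ∈ Finset.Ico 1 t, (s : ℝ) ^ 2
      - (∑ s ∈ Finset.Ico 1 t, (s : ℝ)) ^ 2)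

/-- Least-squares intercept computed from `q 1, …, q (t - 1)`. -/
def alphaHat (q : ℕ → ℝ) (t : ℕ) : ℝ :=
  (∑ s ∈ Finset.Ico 1 t, q s - betaHat q t * ∑ s ∈ Finset.Ico 1 t, (s : ℝ)) / ((t : ℝ) - 1)

/-- Total demand `Q` over the horizon. -/
def totalDemand (T : ℕ) (q : ℕ → ℝ) : ℝ := ∑ t ∈ Finset.Icc 1 T, q t

/-- The prediction of the total demand at time `t`. The least-squares formula needs at least two
observations, so it is used from round `3` on; the predictions `F₁` and `F₂ (q 1)` of the first two
rounds, where the formula reads `0 / 0`, are parameters. -/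
def lsPrediction (T : ℕ) (F₁ : ℝ) (F₂ : ℝ → ℝ) (q : ℕ → ℝ) (t : ℕ) : ℝ :=
  if t ≤ 1 then F₁
  else if t = 2 then F₂ (q 1)
  else ∑ s ∈ Finset.Ico 1 t, q s
    + ∑ s ∈ Finset.Icc t T, (alphaHat q t + betaHat q t * (s : ℝ))

/-- The accuracy level `ε_t = C₀ M T² √(log (1/δ)) (t - 1)^(-3/2)`, with `t - 1` replaced by `1`
at `t = 1`. -/
def accuracy (C₀ M δ : ℝ) (T t : ℕ) : ℝ :=
  C₀ * M * (T : ℝ) ^ 2 * Real.sqrt (Real.log (1 / δ)) *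
    (max ((t : ℝ) - 1) 1) ^ (-(3 / 2) : ℝ)

/-! ### The linear programming benchmark -/

/-- The value of the linear program: maximize `Q rᵀu` over the simplex subject to
`Q cᵀu ≤ B` for each resource. -/
def optLP {𝒜 : Type*} [Fintype 𝒜] {d : ℕ} (Q B : ℝ) (r : 𝒜 → ℝ) (c : 𝒜 → Fin d → ℝ) : ℝ :=
  sSup {v : ℝ | ∃ u ∈ stdSimplex ℝ 𝒜,
    (∀ i, Q * ∑ a, c a i * u a ≤ B) ∧ v = Q * ∑ a, r a * u a}

/-! ### One trajectory, and the quantities that the algorithm computes along it -/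

/-- Confidence radius. -/
def rad (v N δ : ℝ) : ℝ :=
  Real.sqrt (2 * v * Real.log (1 / δ) / N) + 4 * Real.log (1 / δ) / N

/-- A realized trajectory: demands, predictions, actions, rewards and consumptions per demand
unit, in rounds `1, 2, …`. -/
structure Trajectory (𝒜 : Type*) (d : ℕ) where
  q : ℕ → ℝ
  pred : ℕ → ℝ
  act : ℕ → 𝒜
  rew : ℕ → ℝ
  cons : ℕ → Fin d → ℝ

/-- State of the AdaHedge subroutine at the beginning of a round. -/
structure HedgeState (d : ℕ) where
  mu : Fin (d + 1) → ℝ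
  theta : Fin (d + 1) → ℝ
  eta : ℝ

/-- The vector `(1, …, 1, 0)`; the last coordinate is the null resource. -/
def betaVec (d : ℕ) : Fin (d + 1) → ℝ := Fin.snoc (α := fun _ => ℝ) (fun _ : Fin d => (1 : ℝ)) 0

/-- The AdaHedge increment `ρ` in round `t` with gradient `g`. -/
def hedgeRho {d : ℕ} (t : ℕ) (S : HedgeState d) (g : Fin (d + 1) → ℝ) : ℝ :=
  if t = 1 then ∑ j, g j * S.mu j - Finset.univ.inf' Finset.univ_nonempty g
  else S.eta * Real.log (∑ j, S.mu j * Real.exp (-g j / S.eta)) + ∑ j, g j * S.mu j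

/-- The AdaHedge update at the end of round `t` with gradient `g`. -/
def hedgeStep {d : ℕ} (t : ℕ) (S : HedgeState d) (g : Fin (d + 1) → ℝ) : HedgeState d :=
  let theta' : Fin (d + 1) → ℝ := fun j => S.theta j - g j
  let eta' : ℝ := S.eta + 1 / (Real.sqrt (Real.log ((d : ℝ) + 1))) ^ 2 * hedgeRho t S g
  { mu := fun j => Real.exp (theta' j / eta') / ∑ i, Real.exp (theta' i / eta')
    theta := theta'
    eta := eta' }

namespace Trajectory

variable {𝒜 : Type*} {d : ℕ}

open Classical in
/-- `max (number of pulls of `a` in rounds `1, …, t - 1`) 1`. -/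
def pullsPlus (x : Trajectory 𝒜 d) (t : ℕ) (a : 𝒜) : ℕ :=
  max ((Finset.Ico 1 t).filter fun s => x.act s = a).card 1

open Classical in
/-- Sample mean of the rewards of `a` in rounds `1, …, t - 1`. -/
def meanRew (x : Trajectory 𝒜 d) (t : ℕ) (a : 𝒜) : ℝ :=
  1 / (x.pullsPlus t a : ℝ) * ∑ s ∈ Finset.Ico 1 t, if x.act s = a then x.rew s else 0

open Classical in
/-- Sample mean of the consumption of resource `i` by `a` in rounds `1, …, t - 1`. -/
def meanCons (x : Trajectory 𝒜 d) (t : ℕ) (a : 𝒜) (i : Fin d) : ℝ :=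
  1 / (x.pullsPlus t a : ℝ) * ∑ s ∈ Finset.Ico 1 t, if x.act s = a then x.cons s i else 0

/-- Upper confidence bound of the reward. -/
def ucb (x : Trajectory 𝒜 d) (δ : ℝ) (t : ℕ) (a : 𝒜) : ℝ :=
  min (x.meanRew t a + rad (x.meanRew t a) (x.pullsPlus t a) δ) 1

/-- Lower confidence bounds of the consumptions; the last coordinate is the null resource. -/
def lcb (x : Trajectory 𝒜 d) (δ : ℝ) (t : ℕ) (a : 𝒜) : Fin (d + 1) → ℝ :=
  Fin.snoc (α := fun _ => ℝ)
    (fun i : Fin d => max (x.meanCons t a i - rad (x.meanCons t a i) (x.pullsPlus t a) δ) 0) 0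

/-- The gradient `(q_t Q̂_t / B) ((B / Q̂_t) β - LCB)`, multiplied out so that it makes sense also
when `Q̂_t = 0`. -/
def grad (x : Trajectory 𝒜 d) (B δ : ℝ) (t : ℕ) : Fin (d + 1) → ℝ :=
  fun j => x.q t * (betaVec d j - x.pred t / B * x.lcb δ t (x.act t) j)

/-- The AdaHedge state at the beginning of round `t ≥ 1` (the value at `t = 0` is not used). -/
def hedge (x : Trajectory 𝒜 d) (B δ : ℝ) : ℕ → HedgeState d
  | 0 => ⟨fun _ => 1 / ((d : ℝ) + 1), fun _ => 0, 0⟩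
  | t + 1 =>
    if t = 0 then ⟨fun _ => 1 / ((d : ℝ) + 1), fun _ => 0, 0⟩
    else hedgeStep t (hedge x B δ t) (x.grad B δ t)

/-- The quantity that the algorithm maximizes over the actions in round `t`. -/
def score (x : Trajectory 𝒜 d) (B δ : ℝ) (t : ℕ) (a : 𝒜) : ℝ :=
  x.ucb δ t a - x.pred t / B * ∑ j, (x.hedge B δ t).mu j * x.lcb δ t a j

/-- The stopping time `τ`: the first round after which some resource is overdrawn, and `T + 1`
if there is none. -/
def stopTime (x : Trajectory 𝒜 d) (T : ℕ) (B : ℝ) : ℕ :=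
  sInf ({t : ℕ | t ∈ Finset.Icc 1 T ∧
    ∃ j, B < ∑ s ∈ Finset.Icc 1 t, x.q s * x.cons s j} ∪ {T + 1})

/-- The actions are those of OA-UCB: a maximizer of the score as long as no resource is overdrawn,
the null action afterwards. -/
def FollowsOAUCB (x : Trajectory 𝒜 d) (T : ℕ) (B δ : ℝ) (a₀ : 𝒜) : Prop :=
  ∀ t ∈ Finset.Icc 1 T,
    (t ≤ x.stopTime T B → ∀ a, x.score B δ t a ≤ x.score B δ t (x.act t)) ∧
    (x.stopTime T B < t → x.act t = a₀)

/-- The collected reward `∑_{t < τ} q_t R_t`. -/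
def reward (x : Trajectory 𝒜 d) (T : ℕ) (B : ℝ) : ℝ :=
  ∑ t ∈ Finset.Ico 1 (x.stopTime T B), x.q t * x.rew t

end Trajectory

/-! ### The stochastic model -/

/-- The noise of the linear demand model: independent, centered, supported in `[-M, M]`. -/
structure IsDemandNoise {Ω : Type*} [MeasurableSpace Ω] (μ : Measure Ω) (T : ℕ) (M : ℝ)
    (ξ : ℕ → Ω → ℝ) : Prop where
  measurable : ∀ t ∈ Finset.Icc 1 T, Measurable (ξ t)
  indep : iIndepFun (fun t : Finset.Icc 1 T => ξ t) μ
  bounded : ∀ t ∈ Finset.Icc 1 T, ∀ᵐ ω ∂μ, ξ t ω ∈ Set.Icc (-M) M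
  centered : ∀ t ∈ Finset.Icc 1 T, ∫ ω, ξ t ω ∂μ = 0

/-- Outcome distributions `P a t` on `[0,1]^(d+1)` (reward, consumptions) with means that do not
depend on the round, and a null action. -/
structure IsOutcomeModel {𝒜 : Type*} {d : ℕ} (T : ℕ) (P : 𝒜 → ℕ → Measure (ℝ × (Fin d → ℝ)))
    (r : 𝒜 → ℝ) (c : 𝒜 → Fin d → ℝ) (a₀ : 𝒜) : Prop where
  isProb : ∀ a, ∀ t ∈ Finset.Icc 1 T, IsProbabilityMeasure (P a t)
  support : ∀ a, ∀ t ∈ Finset.Icc 1 T,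
    ∀ᵐ y ∂(P a t), y.1 ∈ Set.Icc (0 : ℝ) 1 ∧ ∀ i, y.2 i ∈ Set.Icc (0 : ℝ) 1
  mean_rew : ∀ a, ∀ t ∈ Finset.Icc 1 T, ∫ y, y.1 ∂(P a t) = r a
  mean_cons : ∀ a, ∀ t ∈ Finset.Icc 1 T, ∀ i, ∫ y, y.2 i ∂(P a t) = c a i
  null : ∀ t ∈ Finset.Icc 1 T, P a₀ t = Measure.dirac 0

/-- `W t ω a` is the outcome that action `a` would produce in round `t`: it has law `P a t`, and
the rounds are independent of each other and of the demand noise. -/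
structure IsOutcomeTable {Ω : Type*} [MeasurableSpace Ω] (μ : Measure Ω) {𝒜 : Type*} {d : ℕ}
    (T : ℕ) (ξ : ℕ → Ω → ℝ) (P : 𝒜 → ℕ → Measure (ℝ × (Fin d → ℝ)))
    (W : ℕ → Ω → 𝒜 → ℝ × (Fin d → ℝ)) : Prop where
  measurable : ∀ t ∈ Finset.Icc 1 T, Measurable (W t)
  law : ∀ a, ∀ t ∈ Finset.Icc 1 T, Measure.map (fun ω => W t ω a) μ = P a t
  indep : iIndepFun (fun t : Finset.Icc 1 T => W t) μ
  indep_noise : IndepFun (fun ω (t : Finset.Icc 1 T) => ξ t ω)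
    (fun ω (t : Finset.Icc 1 T) => W t ω) μ

/-- The trajectory produced in the sample point `ω` by the linear demand
`q_t = α + β t + ξ_t`, the least-squares oracle, the actions `A` and the outcomes `W`. -/
def trajectory {Ω : Type*} {𝒜 : Type*} {d : ℕ} (T : ℕ) (α β F₁ : ℝ) (F₂ : ℝ → ℝ)
    (ξ : ℕ → Ω → ℝ) (W : ℕ → Ω → 𝒜 → ℝ × (Fin d → ℝ)) (A : ℕ → Ω → 𝒜) (ω : Ω) :
    Trajectory 𝒜 d where
  q := fun t => α + β * (t : ℝ) + ξ t ω
  pred := lsPrediction T F₁ F₂ (fun t => α + β * (t : ℝ) + ξ t ω)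
  act := fun t => A t ω
  rew := fun t => (W t ω (A t ω)).1
  cons := fun t => (W t ω (A t ω)).2

/-- What the decision maker has observed in rounds `1, …, t - 1`: demands, actions, rewards and
consumptions. -/
abbrev history {Ω : Type*} {𝒜 : Type*} {d : ℕ} (X : Ω → Trajectory 𝒜 d) (t : ℕ) :
    MeasurableSpace Ω :=
  ⨆ s ∈ Finset.Ico 1 t,
    (MeasurableSpace.comap (fun ω => (X ω).act s) ⊤ ⊔
      MeasurableSpace.comap (fun ω => ((X ω).q s, (X ω).rew s, (X ω).cons s)) inferInstance)

/-- `X` is a run of OA-UCB: the actions are chosen by its rule, and ties are broken on the basis of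
past observations only. -/
structure IsOAUCBRun {Ω : Type*} {𝒜 : Type*} {d : ℕ} (T : ℕ) (B δ : ℝ) (a₀ : 𝒜)
    (X : Ω → Trajectory 𝒜 d) : Prop where
  follows : ∀ ω, (X ω).FollowsOAUCB T B δ a₀
  adapted : ∀ t ∈ Finset.Icc 1 T, ∀ a, MeasurableSet[history X t] {ω | (X ω).act t = a}

end OAUCB

end

/-! The argument separates a deterministic inequality, valid on each sample path where finitely many
concentration inequalities hold, from the estimate of the probability that they hold.

Deterministic part. The linear program is played as a Lagrangian game. At the prices `mu` of a
round, the chosen action maximizes an optimistic Lagrangian, so it does at least as well as any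
feasible mixture of actions; up to the relative prediction error, OPT/Q is at most its score plus
the price of the budget (`optLP_le_round`). AdaHedge sets the prices, and its regret against any
fixed resource grows like the root of the number of rounds (`hedge_regret_le`). If no resource is
overdrawn, the prices are compared with the null resource. If resource j is overdrawn at time τ,
they are compared with the mixture putting mass OPT/Q on j and the rest on the null resource: almost
all of B was spent on j before τ, which pays for the rounds not played (`regret_le`). What remains
is the gap between confidence bounds and realized outcomes, and the demand-weighted prediction
error. The gaps are summed by Cauchy-Schwarz, with harmonic sums over pulls (`sum_width_le`); the
resulting bounds involve the collected reward, at most OPT in the only nontrivial case, and the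
consumption, at most B before τ (`width_sum_le`). `regret_arith` absorbs all terms into the three of
the claim.

Oracle. Least squares reproduces linear trends exactly, so the prediction error is a linear form in
the noise (`lsPrediction_error`) whose squared weights sum to O(T⁴/(t-1)³), and the sub-Gaussian
tail bound applies (`oracle_tail`). Because α ≤ κβ, demand in round t is of order βt and Q of order
βT², so the weighted accuracy sum reduces to a sum of t^(-1/2) (`accuracy_sum_le`).

Concentration. Actions depend on the past, so Chernoff bounds come from an exponential
supermartingale with Poisson compensator (`lintegral_exp_le_one`). Weighting only the first n pulls
of an arm treats all times with n pulls at once, so the union bound runs over n ≤ T (`arm_tail`).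
Inequalities needed for optimism are required at level δ, those used only in the analysis at level
δ²; this makes the failure probabilities fit (`failure_budget`). -/

noncomputable section

namespace OAUCB

/-! ### The AdaHedge regret bound -/

/-- The normalized log-partition function. -/
def logPart {d : ℕ} (η : ℝ) (θ : Fin (d + 1) → ℝ) : ℝ :=
  η * Real.log ((∑ j, Real.exp (θ j / η)) / ((d : ℝ) + 1))

lemma logPart_le {d : ℕ} {η m : ℝ} (hη : 0 < η) {θ : Fin (d + 1) → ℝ} (h : ∀ j, θ j ≤ m) :
    logPart η θ ≤ m := by
  have hd : (0 : ℝ) < (d : ℝ) + 1 := by positivity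
  have h1 : (∑ j, Real.exp (θ j / η)) / ((d : ℝ) + 1) ≤ Real.exp (m / η) := by
    rw [div_le_iff₀ hd]
    calc ∑ j, Real.exp (θ j / η) ≤ ∑ _j : Fin (d + 1), Real.exp (m / η) :=
          Finset.sum_le_sum fun j _ => Real.exp_le_exp.2 (by gcongr; exact h j)
      _ = _ := by simp; ring
  have h0 : 0 < (∑ j, Real.exp (θ j / η)) / ((d : ℝ) + 1) := by positivity
  have h2 := Real.log_le_log h0 h1
  rw [Real.log_exp] at h2
  calc logPart η θ ≤ η * (m / η) := mul_le_mul_of_nonneg_left h2 hη.le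
    _ = m := by field_simp

lemma le_logPart {d : ℕ} {η : ℝ} (hη : 0 < η) (θ : Fin (d + 1) → ℝ) (j : Fin (d + 1)) :
    θ j - η * Real.log ((d : ℝ) + 1) ≤ logPart η θ := by
  have hd : (0 : ℝ) < (d : ℝ) + 1 := by positivity
  have h1 : Real.exp (θ j / η) ≤ ∑ j, Real.exp (θ j / η) :=
    Finset.single_le_sum (f := fun j => Real.exp (θ j / η)) (fun i _ => (Real.exp_pos _).le)
      (Finset.mem_univ j)
  have h2 := Real.log_le_log (Real.exp_pos _) h1
  rw [Real.log_exp] at h2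
  have h0 : 0 < ∑ j, Real.exp (θ j / η) := by positivity
  rw [logPart, Real.log_div h0.ne' hd.ne', mul_sub]
  have h3 := mul_le_mul_of_nonneg_left h2 hη.le
  rw [mul_div_cancel₀ _ hη.ne'] at h3
  linarith

/-- This is the power mean inequality with exponent η'/η ≥ 1. It is the reason for normalizing the
partition function by d + 1. -/
lemma logPart_antitone {d : ℕ} {η η' : ℝ} (hη : 0 < η) (h : η ≤ η') (θ : Fin (d + 1) → ℝ) :
    logPart η' θ ≤ logPart η θ := by
  have hd : (0 : ℝ) < (d : ℝ) + 1 := by positivity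
  have hη' : 0 < η' := hη.trans_le h
  have key := Real.rpow_arith_mean_le_arith_mean_rpow (Finset.univ : Finset (Fin (d + 1)))
    (fun _ => 1 / ((d : ℝ) + 1)) (fun j => Real.exp (θ j / η')) (fun _ _ => by positivity)
    (by simp; field_simp) (fun _ _ => by positivity) (p := η' / η) (by rwa [one_le_div hη])
  have e1 : ∀ j, Real.exp (θ j / η') ^ (η' / η) = Real.exp (θ j / η) := fun j => by
    rw [← Real.exp_mul]; congr 1; field_simp
  simp only [e1, ← Finset.mul_sum] at key
  have h0 : 0 < ∑ j, Real.exp (θ j / η') := by positivity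
  have h2 := Real.log_le_log (by positivity) key
  rw [Real.log_rpow (by positivity)] at h2
  have h3 := mul_le_mul_of_nonneg_left h2 hη.le
  rw [← mul_assoc, mul_div_cancel₀ _ hη.ne'] at h3
  simpa only [logPart, div_eq_inv_mul, mul_one] using h3

lemma sum_betaVec_castSucc {d : ℕ} (i : Fin d) : betaVec d i.castSucc = 1 := by
  simp [betaVec]

lemma betaVec_last {d : ℕ} : betaVec d (Fin.last d) = 0 := by simp [betaVec]

lemma sub_le_two_sum_abs {ι : Type*} [Fintype ι] (g : ι → ℝ) (i j : ι) :
    g i - g j ≤ 2 * ∑ i, |g i| := by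
  have a : |g i| ≤ ∑ i, |g i| := 
    Finset.single_le_sum (f := fun i => |g i|) (fun i _ => abs_nonneg _) (Finset.mem_univ i)
  have b : |g j| ≤ ∑ i, |g i| := 
    Finset.single_le_sum (f := fun i => |g i|) (fun i _ => abs_nonneg _) (Finset.mem_univ j)
  linarith [le_abs_self (g i), neg_abs_le (g j)]

/-- `S` is an AdaHedge run on the losses `g`. -/
structure IsHedgeRun {d : ℕ} (S : ℕ → HedgeState d) (g : ℕ → Fin (d + 1) → ℝ) : Prop where
  one : S 1 = ⟨fun _ => 1 / ((d : ℝ) + 1), fun _ => 0, 0⟩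
  succ : ∀ t, 1 ≤ t → S (t + 1) = hedgeStep t (S t) (g t)

namespace IsHedgeRun

variable {d : ℕ} {S : ℕ → HedgeState d} {g : ℕ → Fin (d + 1) → ℝ}

lemma theta_succ (h : IsHedgeRun S g) {t : ℕ} (ht : 1 ≤ t) (j : Fin (d + 1)) :
    (S (t + 1)).theta j = (S t).theta j - g t j := by
  rw [h.succ t ht]; rfl

lemma eta_succ (h : IsHedgeRun S g) {t : ℕ} (ht : 1 ≤ t) :
    (S (t + 1)).eta = (S t).eta + hedgeRho t (S t) (g t) / Real.log ((d : ℝ) + 1) := by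
  rw [h.succ t ht, hedgeStep, Real.sq_sqrt (Real.log_nonneg (by simp))]
  simp only
  ring

lemma mu_succ (h : IsHedgeRun S g) {t : ℕ} (ht : 1 ≤ t) (j : Fin (d + 1)) :
    (S (t + 1)).mu j = Real.exp ((S (t + 1)).theta j / (S (t + 1)).eta) /
      ∑ i, Real.exp ((S (t + 1)).theta i / (S (t + 1)).eta) := by
  rw [h.succ t ht]; rfl

lemma mu_mem (h : IsHedgeRun S g) {t : ℕ} (ht : 1 ≤ t) : (S t).mu ∈ stdSimplex ℝ (Fin (d + 1)) := by
  obtain ⟨k, rfl⟩ : ∃ k, t = k + 1 := ⟨t - 1, by omega⟩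
  rcases Nat.eq_zero_or_pos k with rfl | hk
  · have : (0 : ℝ) < (d : ℝ) + 1 := by positivity
    rw [zero_add, h.one]
    refine ⟨fun j => by positivity, ?_⟩
    simp
    field_simp
  · refine ⟨fun j => by rw [h.mu_succ hk]; positivity, ?_⟩
    simp_rw [h.mu_succ hk, ← Finset.sum_div]
    exact div_self (by positivity)

lemma theta_eq (h : IsHedgeRun S g) (n : ℕ) (j : Fin (d + 1)) :
    (S (n + 1)).theta j = -∑ t ∈ Finset.Ico 1 (n + 1), g t j := by
  induction n with
  | zero => simp [h.one]
  | succ k ih => rw [h.theta_succ (by omega), ih, Finset.sum_Ico_succ_top (show 1 ≤ k + 1 by omega)]; ring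

/-- The AdaHedge balance: η is updated precisely so that the accumulated mixability gap equals the
entropy cost η log(d + 1). Each supplies one of the two halves of the regret. -/
lemma sum_rho (h : IsHedgeRun S g) (hd : 1 ≤ d) (n : ℕ) :
    ∑ t ∈ Finset.Ico 1 (n + 1), hedgeRho t (S t) (g t) =
      Real.log ((d : ℝ) + 1) * (S (n + 1)).eta := by
  have hD : 0 < Real.log ((d : ℝ) + 1) := Real.log_pos (by simp; omega)
  induction n with
  | zero => simp [h.one]
  | succ k ih =>
    rw [Finset.sum_Ico_succ_top (by omega), ih, h.eta_succ (t := k + 1) (by omega)]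
    field_simp

/-- From round 2 on, `mu` is the softmax of `theta / eta`, so the mix loss is a ratio of two
partition functions at the same η. -/
lemma rho_sub_eq (h : IsHedgeRun S g) {t : ℕ} (ht : 2 ≤ t) (hη : 0 < (S t).eta) :
    hedgeRho t (S t) (g t) - ∑ j, g t j * (S t).mu j =
      logPart (S t).eta (S (t + 1)).theta - logPart (S t).eta (S t).theta := by
  obtain ⟨k, rfl⟩ : ∃ k, t = k + 1 := ⟨t - 1, by omega⟩
  have hk : 1 ≤ k := by omega
  have hd : (0 : ℝ) < (d : ℝ) + 1 := by positivity
  set η := (S (k + 1)).eta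
  set θ := (S (k + 1)).theta
  have e : ∑ j, (S (k + 1)).mu j * Real.exp (-g (k + 1) j / η) =
      (∑ j, Real.exp ((S (k + 1 + 1)).theta j / η)) / ∑ j, Real.exp (θ j / η) := by
    rw [Finset.sum_div]
    refine Finset.sum_congr rfl fun j _ => ?_
    rw [h.mu_succ hk, h.theta_succ (t := k + 1) (by omega), div_mul_eq_mul_div, ← Real.exp_add]
    congr 2
    simp only [η]
    ring
  have p1 : 0 < ∑ j, Real.exp (θ j / η) := by positivity
  have p2 : 0 < ∑ j, Real.exp ((S (k + 1 + 1)).theta j / η) := by positivity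
  rw [hedgeRho, if_neg (by omega), e, logPart, logPart, Real.log_div p2.ne' p1.ne',
    Real.log_div p2.ne' hd.ne', Real.log_div p1.ne' hd.ne']
  ring

/-- The increments are nonnegative, and controlled by the range of the losses. -/
lemma rho_bounds (h : IsHedgeRun S g) {t : ℕ} (ht : 1 ≤ t) (hη : 2 ≤ t → 0 < (S t).eta) {s : ℝ}
    (hs : ∀ i j, g t i - g t j ≤ s) :
    0 ≤ hedgeRho t (S t) (g t) ∧ hedgeRho t (S t) (g t) ≤ s ∧
      (S t).eta * hedgeRho t (S t) (g t) ≤ s ^ 2 := by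
  obtain ⟨hμ0, hμ1⟩ := h.mu_mem ht
  set m := ∑ j, g t j * (S t).mu j with hm
  have hs0 : 0 ≤ s := by simpa using hs 0 0
  have lo : ∀ i, g t i - m ≤ s := fun i => by
    calc g t i - m = ∑ j, (g t i - g t j) * (S t).mu j := by
          simp only [sub_mul, Finset.sum_sub_distrib, ← Finset.mul_sum, hμ1, hm, mul_one]
      _ ≤ ∑ j, s * (S t).mu j :=
          Finset.sum_le_sum fun j _ => mul_le_mul_of_nonneg_right (hs i j) (hμ0 j)
      _ = s := by rw [← Finset.mul_sum, hμ1, mul_one]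
  have hi : ∀ i, m - g t i ≤ s := fun i => by
    calc m - g t i = ∑ j, (g t j - g t i) * (S t).mu j := by
          simp only [sub_mul, Finset.sum_sub_distrib, ← Finset.mul_sum, hμ1, hm, mul_one]
      _ ≤ ∑ j, s * (S t).mu j :=
          Finset.sum_le_sum fun j _ => mul_le_mul_of_nonneg_right (hs j i) (hμ0 j)
      _ = s := by rw [← Finset.mul_sum, hμ1, mul_one]
  rcases (show t = 1 ∨ 2 ≤ t by omega) with rfl | ht2
  · obtain ⟨i, -, hi'⟩ := Finset.exists_mem_eq_inf' (Finset.univ_nonempty (α := Fin (d + 1))) (g 1)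
    have h0 : (S 1).eta = 0 := by rw [h.one]
    rw [hedgeRho, if_pos rfl, ← hm, h0, hi', zero_mul]
    refine ⟨?_, hi i, sq_nonneg s⟩
    have : g 1 i = ∑ j, g 1 i * (S 1).mu j := by rw [← Finset.mul_sum, hμ1, mul_one]
    rw [sub_nonneg, this]
    refine Finset.sum_le_sum fun j _ => mul_le_mul_of_nonneg_right ?_ (hμ0 j)
    rw [← hi']
    exact Finset.inf'_le _ (Finset.mem_univ j)
  · have hη := hη ht2
    set η := (S t).eta
    -- Centring the losses at their mean m turns the increment into η times a log moment generating
    -- function whose first-order term vanishes.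
    have e : hedgeRho t (S t) (g t) =
        η * Real.log (∑ j, (S t).mu j * Real.exp ((m - g t j) / η)) := by
      have : ∀ j, (S t).mu j * Real.exp ((m - g t j) / η) =
          Real.exp (m / η) * ((S t).mu j * Real.exp (-g t j / η)) := fun j => by
        rw [mul_left_comm, ← Real.exp_add]; congr 2; ring
      have hpos : 0 < ∑ j, (S t).mu j * Real.exp (-g t j / η) := by
        obtain ⟨i, hi⟩ : ∃ i, 0 < (S t).mu i := by
          by_contra! hc
          have : ∑ j, (S t).mu j ≤ 0 := Finset.sum_nonpos fun j _ => hc j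
          linarith
        exact Finset.sum_pos' (fun j _ => mul_nonneg (hμ0 j) (Real.exp_pos _).le)
          ⟨i, Finset.mem_univ _, by positivity⟩
      simp_rw [this]
      rw [← Finset.mul_sum, Real.log_mul (Real.exp_pos _).ne' hpos.ne', Real.log_exp, mul_add,
        mul_div_cancel₀ _ hη.ne', hedgeRho, if_neg (by omega), add_comm]
    have z : ∑ j, (S t).mu j * ((m - g t j) / η) = 0 := by
      have : ∀ j, (S t).mu j * ((m - g t j) / η) = (m * (S t).mu j - g t j * (S t).mu j) / η :=
        fun j => by ring
      simp_rw [this]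
      rw [← Finset.sum_div, Finset.sum_sub_distrib, ← Finset.mul_sum, hμ1, ← hm]
      simp
    have one_le : 1 ≤ ∑ j, (S t).mu j * Real.exp ((m - g t j) / η) := by
      calc (1 : ℝ) = ∑ j, (S t).mu j * ((m - g t j) / η + 1) := by
            simp only [mul_add, Finset.sum_add_distrib, z, mul_one, hμ1, zero_add]
        _ ≤ _ := Finset.sum_le_sum fun j _ =>
            mul_le_mul_of_nonneg_left (Real.add_one_le_exp _) (hμ0 j)
    have ub : hedgeRho t (S t) (g t) ≤ s := by
      have : ∑ j, (S t).mu j * Real.exp ((m - g t j) / η) ≤ Real.exp (s / η) := by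
        calc _ ≤ ∑ j, (S t).mu j * Real.exp (s / η) := Finset.sum_le_sum fun j _ =>
              mul_le_mul_of_nonneg_left (Real.exp_le_exp.2 (by gcongr; exact hi j)) (hμ0 j)
          _ = _ := by rw [← Finset.sum_mul, hμ1, one_mul]
      have h2 := Real.log_le_log (by linarith) this
      rw [Real.log_exp] at h2
      rw [e]
      calc _ ≤ η * (s / η) := mul_le_mul_of_nonneg_left h2 hη.le
        _ = s := by field_simp
    refine ⟨by rw [e]; exact mul_nonneg hη.le (Real.log_nonneg one_le), ub, ?_⟩
    -- When s ≤ η, exp x ≤ 1 + x + x² applies and gives a second-order bound. When η ≤ s, the bound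
    -- ρ ≤ s already suffices.
    rcases le_total s η with hsη | hsη
    · have : ∑ j, (S t).mu j * Real.exp ((m - g t j) / η) ≤ 1 + (s / η) ^ 2 := by
        calc _ ≤ ∑ j, (S t).mu j * (1 + (m - g t j) / η + (s / η) ^ 2) := by
              refine Finset.sum_le_sum fun j _ => mul_le_mul_of_nonneg_left ?_ (hμ0 j)
              have a1 : |(m - g t j) / η| ≤ s / η := by
                rw [abs_div, abs_of_pos hη]
                gcongr
                exact abs_le.2 ⟨by linarith [lo j], hi j⟩
              have a2 : s / η ≤ 1 := by rwa [div_le_one hη]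
              have a3 := (abs_le.1 (Real.abs_exp_sub_one_sub_id_le (a1.trans a2))).2
              have a4 : ((m - g t j) / η) ^ 2 ≤ (s / η) ^ 2 := by
                rw [← sq_abs]; gcongr
              linarith
          _ = _ := by
              simp only [mul_add, Finset.sum_add_distrib, z, mul_one, hμ1, ← Finset.sum_mul]
              ring
      have h2 := (Real.log_le_sub_one_of_pos (by linarith)).trans (sub_le_sub_right this 1)
      rw [e]
      calc _ ≤ η * (η * (1 + (s / η) ^ 2 - 1)) := by gcongr
        _ = s ^ 2 := by field_simp; ring
    · calc η * hedgeRho t (S t) (g t) ≤ s * s :=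
            mul_le_mul hsη ub (by rw [e]; exact mul_nonneg hη.le (Real.log_nonneg one_le)) hs0
        _ = s ^ 2 := by ring

/-- The run starts with η = 0; a strictly positive first increment, followed by nonnegative ones,
keeps every later division by η meaningful. -/
lemma eta_pos (h : IsHedgeRun S g) (hd : 1 ≤ d) (h1 : 0 < hedgeRho 1 (S 1) (g 1)) {t : ℕ}
    (ht : 2 ≤ t) : 0 < (S t).eta := by
  have hD : 0 < Real.log ((d : ℝ) + 1) := Real.log_pos (by simp; omega)
  induction t, ht using Nat.le_induction with
  | base =>
    rw [h.eta_succ (t := 1) le_rfl, h.one]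
    rw [h.one] at h1
    simp only [zero_add]
    positivity
  | succ k hk ih =>
    rw [h.eta_succ (t := k) (by omega)]
    have := (h.rho_bounds (t := k) (by omega) (fun _ => ih) (sub_le_two_sum_abs (g k))).1
    positivity

/-- The sum telescopes except for the change of η between rounds. Since η grows and `logPart`
decreases in η, this change has the favourable sign. -/
lemma sum_rho_sub_ge (h : IsHedgeRun S g) (hd : 1 ≤ d) (h1 : 0 < hedgeRho 1 (S 1) (g 1)) {n : ℕ}
    (hn : 1 ≤ n) : logPart (S (n + 1)).eta (S (n + 1)).theta ≤
      ∑ t ∈ Finset.Ico 1 (n + 1), (hedgeRho t (S t) (g t) - ∑ j, g t j * (S t).mu j) := by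
  have hD : 0 < Real.log ((d : ℝ) + 1) := Real.log_pos (by simp; omega)
  induction n, hn using Nat.le_induction with
  | base =>
    -- Round 1 is the limit η → 0, where the mix loss is the minimal loss; the soft maximum at any η
    -- lies below the maximum of `theta`.
    have : hedgeRho 1 (S 1) (g 1) - ∑ j, g 1 j * (S 1).mu j =
        - Finset.univ.inf' Finset.univ_nonempty (g 1) := by rw [hedgeRho, if_pos rfl]; ring
    simp only [Nat.reduceAdd, Nat.Ico_succ_singleton, Finset.sum_singleton, this]
    refine logPart_le (h.eta_pos hd h1 le_rfl) fun j => ?_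
    rw [h.theta_succ (t := 1) le_rfl, h.one]
    have := Finset.inf'_le (g 1) (Finset.mem_univ j)
    simp only
    linarith
  | succ k hk ih =>
    rw [Finset.sum_Ico_succ_top (by omega)]
    have hη := h.eta_pos hd h1 (t := k + 1) (by omega)
    rw [h.rho_sub_eq (t := k + 1) (by omega) hη]
    have hmono : (S (k + 1)).eta ≤ (S (k + 1 + 1)).eta := by
      rw [h.eta_succ (t := k + 1) (by omega)]
      have := (h.rho_bounds (t := k + 1) (by omega) (fun _ => hη)
        (sub_le_two_sum_abs (g (k + 1)))).1
      have := div_nonneg this hD.le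
      linarith
    have := logPart_antitone hη hmono (S (k + 1 + 1)).theta
    linarith

lemma regret_le_eta (h : IsHedgeRun S g) (hd : 1 ≤ d) (h1 : 0 < hedgeRho 1 (S 1) (g 1)) (n : ℕ)
    (j : Fin (d + 1)) :
    ∑ t ∈ Finset.Ico 1 (n + 1), ∑ i, g t i * (S t).mu i ≤
      ∑ t ∈ Finset.Ico 1 (n + 1), g t j + 2 * Real.log ((d : ℝ) + 1) * (S (n + 1)).eta := by
  rcases Nat.eq_zero_or_pos n with rfl | hn
  · simp [h.one]
  have a := h.sum_rho_sub_ge hd h1 hn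
  have b := le_logPart (h.eta_pos hd h1 (t := n + 1) (by omega)) (S (n + 1)).theta j
  rw [Finset.sum_sub_distrib, h.sum_rho hd] at a
  rw [h.theta_eq] at b
  linarith

lemma eta_sq_le (h : IsHedgeRun S g) (hd : 1 ≤ d) (h1 : 0 < hedgeRho 1 (S 1) (g 1)) {s : ℕ → ℝ}
    (n : ℕ) (hs : ∀ t ∈ Finset.Ico 1 (n + 1), ∀ i j, g t i - g t j ≤ s t) :
    (S (n + 1)).eta ^ 2 ≤ 8 * ∑ t ∈ Finset.Ico 1 (n + 1), s t ^ 2 := by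
  have hD : 1 / 2 < Real.log ((d : ℝ) + 1) := by
    have h2 : (2 : ℝ) ≤ (d : ℝ) + 1 := by
      have : (1 : ℝ) ≤ d := by exact_mod_cast hd
      linarith
    have := Real.log_le_log (by norm_num) h2
    linarith [Real.log_two_gt_d9]
  induction n with
  | zero => simp [h.one]
  | succ k ih =>
    have ih := ih fun t ht => hs t (Finset.Ico_subset_Ico_right (by omega) ht)
    rw [Finset.sum_Ico_succ_top (by omega), h.eta_succ (t := k + 1) (by omega)]
    obtain ⟨a, b, c⟩ := h.rho_bounds (t := k + 1) (by omega)
      (fun h2 => h.eta_pos hd h1 h2) (hs (k + 1) (by simp))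
    set ρ := hedgeRho (k + 1) (S (k + 1)) (g (k + 1))
    set η := (S (k + 1)).eta
    set D := Real.log ((d : ℝ) + 1)
    -- The cross term and the square each contribute at most 4 s², whence the factor 8.
    have i1 : 1 / D ≤ 2 := by rw [div_le_iff₀ (by linarith)]; linarith
    have i0 : 0 ≤ 1 / D := by positivity
    have e : (η + ρ / D) ^ 2 = η ^ 2 + (1 / D) * (2 * (η * ρ)) + (1 / D) ^ 2 * ρ ^ 2 := by ring
    have r2 : ρ ^ 2 ≤ s (k + 1) ^ 2 := by gcongr
    have t1 : (1 / D) * (2 * (η * ρ)) ≤ (1 / D) * (2 * s (k + 1) ^ 2) := by gcongr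
    have t2 : (1 / D) * (2 * s (k + 1) ^ 2) ≤ 2 * (2 * s (k + 1) ^ 2) := by gcongr
    have t3 : (1 / D) ^ 2 * ρ ^ 2 ≤ 2 ^ 2 * s (k + 1) ^ 2 := by gcongr
    rw [e]
    nlinarith
end IsHedgeRun

/-! ### A Poisson-type supermartingale for adaptively chosen actions -/

/-- Intersections of a set of m₁ with a set of m₂ form a π-system generating the join; on it the
product rule follows by using the two hypotheses in turn. -/
lemma indep_sup_left {Ω : Type*} {mΩ : MeasurableSpace Ω} {μ : Measure Ω} [IsProbabilityMeasure μ]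
    {m₁ m₂ m₃ : MeasurableSpace Ω} (h₁ : m₁ ≤ mΩ) (h₂ : m₂ ≤ mΩ) (h₃ : m₃ ≤ mΩ)
    (h : Indep m₁ (m₂ ⊔ m₃) μ) (h' : Indep m₂ m₃ μ) : Indep (m₁ ⊔ m₂) m₃ μ := by
  set p : Set (Set Ω) := {s | ∃ a b, MeasurableSet[m₁] a ∧ MeasurableSet[m₂] b ∧ a ∩ b = s}
  have hgen : m₁ ⊔ m₂ = MeasurableSpace.generateFrom p := by
    apply le_antisymm
    · refine sup_le (fun s hs => ?_) (fun s hs => ?_)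
      · exact MeasurableSpace.measurableSet_generateFrom
          ⟨s, Set.univ, hs, MeasurableSet.univ, Set.inter_univ s⟩
      · exact MeasurableSpace.measurableSet_generateFrom
          ⟨Set.univ, s, MeasurableSet.univ, hs, Set.univ_inter s⟩
    · refine MeasurableSpace.generateFrom_le ?_
      rintro s ⟨a, b, ha, hb, rfl⟩
      exact MeasurableSet.inter ((le_sup_left : m₁ ≤ m₁ ⊔ m₂) a ha)
        ((le_sup_right : m₂ ≤ m₁ ⊔ m₂) b hb)
  have hpi : IsPiSystem p := by
    rintro _ ⟨a, b, ha, hb, rfl⟩ _ ⟨a', b', ha', hb', rfl⟩ -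
    exact ⟨a ∩ a', b ∩ b', ha.inter ha', hb.inter hb', by rw [Set.inter_inter_inter_comm]⟩
  refine IndepSets.indep (sup_le h₁ h₂) h₃ hpi (@MeasurableSpace.isPiSystem_measurableSet Ω m₃)
    hgen (@MeasurableSpace.generateFrom_measurableSet Ω m₃).symm ?_
  rw [IndepSets_iff]
  rintro _ c ⟨a, b, ha, hb, rfl⟩ hc
  rw [Indep_iff] at h h'
  have hb' : MeasurableSet[m₂ ⊔ m₃] b := (le_sup_left : m₂ ≤ m₂ ⊔ m₃) b hb
  have hc' : MeasurableSet[m₂ ⊔ m₃] c := (le_sup_right : m₃ ≤ m₂ ⊔ m₃) c hc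
  rw [Set.inter_assoc, h a (b ∩ c) ha (hb'.inter hc'), h' b c hb hc, h a b ha hb', mul_assoc]

lemma measurable_apply_choice {Ω 𝒜 : Type*} [Fintype 𝒜] {m : MeasurableSpace Ω} {A : Ω → 𝒜}
    (hA : ∀ a, MeasurableSet {ω | A ω = a}) {E : Type*} [MeasurableSpace E] {f : 𝒜 → Ω → E}
    (hf : ∀ a, Measurable (f a)) : Measurable fun ω => f (A ω) ω := by
  intro s hs
  have : (fun ω => f (A ω) ω) ⁻¹' s = ⋃ a, {ω | A ω = a} ∩ f a ⁻¹' s := by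
    ext ω; simp
  rw [this]
  exact MeasurableSet.iUnion fun a => (hA a).inter (hf a hs)

/-- A filtration `G`, outcomes `W t` independent of `G t`, and actions `A t` chosen on the basis of
`G t`. -/
structure IsAdaptedPlay {Ω : Type*} [mΩ : MeasurableSpace Ω] (μ : Measure Ω) {𝒜 E : Type*}
    [MeasurableSpace E] (T : ℕ) (G : ℕ → MeasurableSpace Ω) (W : ℕ → Ω → 𝒜 → E)
    (A : ℕ → Ω → 𝒜) : Prop where
  le : ∀ t, G t ≤ mΩ
  mono : Monotone G
  meas : ∀ t ∈ Finset.Icc 1 T, Measurable[G (t + 1)] (W t)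
  indep : ∀ t ∈ Finset.Icc 1 T, Indep (G t) (MeasurableSpace.comap (W t) inferInstance) μ
  act : ∀ t ∈ Finset.Icc 1 T, ∀ a, MeasurableSet[G t] {ω | A t ω = a}

/-- The chord of a convex function. The bound is affine in z, so after integration only the mean of
z matters. -/
lemma exp_mul_le_convex {z : ℝ} (hz : z ∈ Set.Icc (0 : ℝ) 1) (w : ℝ) :
    Real.exp (w * z) ≤ (1 - z) + z * Real.exp w := by
  have := convexOn_exp.2 (Set.mem_univ 0) (Set.mem_univ w) (sub_nonneg.2 hz.2) hz.1 (by ring)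
  simp only [smul_eq_mul, mul_zero, zero_add, Real.exp_zero, mul_one] at this
  rwa [mul_comm w z]

namespace IsAdaptedPlay

variable {Ω : Type*} [mΩ : MeasurableSpace Ω] {μ : Measure Ω}
  {𝒜 E : Type*} [Fintype 𝒜] [MeasurableSpace E] {T : ℕ} {G : ℕ → MeasurableSpace Ω}
  {W : ℕ → Ω → 𝒜 → E} {A : ℕ → Ω → 𝒜}

lemma measurable_outcome (h : IsAdaptedPlay μ T G W A) {z : E → ℝ} (hz : Measurable z) {s : ℕ}
    (hs : s ∈ Finset.Icc 1 T) : Measurable[G (s + 1)] fun ω => z (W s ω (A s ω)) := by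
  refine @measurable_apply_choice Ω 𝒜 _ (G (s + 1)) (A s)
    (fun a => h.mono (Nat.le_succ s) _ (h.act s hs a)) ℝ _ (fun a ω => z (W s ω a)) fun a => ?_
  exact hz.comp ((measurable_pi_apply a).comp (h.meas s hs))

lemma measurable_term (h : IsAdaptedPlay μ T G W A) {z : E → ℝ} (hz : Measurable z) (ν : 𝒜 → ℝ)
    {w : ℕ → Ω → ℝ} (hw : ∀ t ∈ Finset.Icc 1 T, Measurable[G t] (w t)) {s : ℕ}
    (hs : s ∈ Finset.Icc 1 T) : Measurable[G (s + 1)] fun ω =>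
      w s ω * z (W s ω (A s ω)) - ν (A s ω) * (Real.exp (w s ω) - 1) := by
  have h1 : Measurable[G (s + 1)] (w s) := (hw s hs).mono (h.mono (Nat.le_succ s)) le_rfl
  have h2 := h.measurable_outcome hz hs
  have h3 : Measurable[G (s + 1)] fun ω => ν (A s ω) :=
    @measurable_apply_choice Ω 𝒜 _ (G (s + 1)) (A s)
      (fun a => h.mono (Nat.le_succ s) _ (h.act s hs a)) ℝ _ (fun a _ => ν a)
      fun a => measurable_const
  exact (h1.mul h2).sub (h3.mul ((Real.measurable_exp.comp h1).sub_const 1))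

/-- For z in [0,1] with mean ν, the moment generating function at w is at most 1 - ν + ν exp w ≤ exp
(ν (exp w - 1)), so each factor has conditional mean at most 1. Working with nonnegative integrals
allows arbitrary unbounded predictable w. -/
theorem lintegral_exp_le_one [IsProbabilityMeasure μ] (h : IsAdaptedPlay μ T G W A) {z : E → ℝ} (hz : Measurable z)
    {ν : 𝒜 → ℝ} (hz01 : ∀ a, ∀ t ∈ Finset.Icc 1 T, ∀ᵐ ω ∂μ, z (W t ω a) ∈ Set.Icc (0 : ℝ) 1)
    (hν : ∀ a, ∀ t ∈ Finset.Icc 1 T, ∫ ω, z (W t ω a) ∂μ = ν a)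
    {w : ℕ → Ω → ℝ} (hw : ∀ t ∈ Finset.Icc 1 T, Measurable[G t] (w t)) {n : ℕ} (hn : n ≤ T) :
    ∫⁻ ω, ENNReal.ofReal (Real.exp (∑ s ∈ Finset.Ico 1 (n + 1),
      (w s ω * z (W s ω (A s ω)) - ν (A s ω) * (Real.exp (w s ω) - 1)))) ∂μ ≤ 1 := by
  classical
  induction n with
  | zero => simp
  | succ n ih =>
    have ih := ih (by omega)
    have ht : n + 1 ∈ Finset.Icc 1 T := Finset.mem_Icc.2 ⟨by omega, hn⟩
    set t := n + 1
    set F : Ω → ENNReal := fun ω => ENNReal.ofReal (Real.exp (∑ s ∈ Finset.Ico 1 t,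
      (w s ω * z (W s ω (A s ω)) - ν (A s ω) * (Real.exp (w s ω) - 1))))
    have hF : Measurable[G t] F := by
      refine ENNReal.measurable_ofReal.comp (Real.measurable_exp.comp ?_)
      refine Finset.measurable_fun_sum _ fun s hs => ?_
      rw [Finset.mem_Ico] at hs
      exact (h.measurable_term hz ν hw (Finset.mem_Icc.2 ⟨hs.1, by omega⟩)).mono
        (h.mono (by omega)) le_rfl
    have hWt : Measurable (W t) := (h.meas t ht).mono (h.le _) le_rfl
    have hZm : ∀ a, Measurable[MeasurableSpace.comap (W t) inferInstance] fun ω => z (W t ω a) :=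
      fun a => (show Measurable fun y : 𝒜 → E => z (y a) from
        hz.comp (measurable_pi_apply a)).comp (comap_measurable (W t))
    have hZm' : ∀ a, Measurable fun ω => z (W t ω a) := fun a =>
      (hZm a).mono hWt.comap_le le_rfl
    have hZi : ∀ a, Integrable (fun ω => z (W t ω a)) μ := fun a =>
      Integrable.of_mem_Icc 0 1 (hZm' a).aemeasurable (hz01 a t ht)
    have hν01 : ∀ a, 0 ≤ ν a ∧ ν a ≤ 1 := fun a => by
      rw [← hν a t ht]
      refine ⟨integral_nonneg_of_ae ((hz01 a t ht).mono fun ω hω => hω.1), ?_⟩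
      calc _ ≤ ∫ _ω, (1 : ℝ) ∂μ :=
            integral_mono_ae (hZi a) (integrable_const 1) ((hz01 a t ht).mono fun ω hω => hω.2)
        _ = 1 := by simp
    -- The part of the integrand known before round t, restricted to the event that a is chosen.
    set k : 𝒜 → Ω → ENNReal := fun a ω => {ω | A t ω = a}.indicator
      (fun ω => F ω * ENNReal.ofReal (Real.exp (-(ν a * (Real.exp (w t ω) - 1))))) ω
    have hk : ∀ a, Measurable[G t] (k a) := fun a => by
      refine Measurable.indicator (hF.mul (ENNReal.measurable_ofReal.comp
        (Real.measurable_exp.comp ?_))) (h.act t ht a)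
      exact (((Real.measurable_exp.comp (hw t ht)).sub_const 1).const_mul _).neg
    have hew : Measurable[G t] fun ω => ENNReal.ofReal (Real.exp (w t ω)) :=
      ENNReal.measurable_ofReal.comp (Real.measurable_exp.comp (hw t ht))
    have hZ1 : ∀ a, Measurable[MeasurableSpace.comap (W t) inferInstance]
        fun ω => ENNReal.ofReal (1 - z (W t ω a)) := fun a =>
      ENNReal.measurable_ofReal.comp ((hZm a).const_sub 1)
    have hZ2 : ∀ a, Measurable[MeasurableSpace.comap (W t) inferInstance]
        fun ω => ENNReal.ofReal (z (W t ω a)) := fun a => ENNReal.measurable_ofReal.comp (hZm a)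
    -- Splitting over the chosen action and applying the chord bound leaves products of a
    -- past-measurable factor and an affine function of one fresh outcome, whose integrals factor by
    -- independence.
    have bound : ∀ᵐ ω ∂μ, ENNReal.ofReal (Real.exp (∑ s ∈ Finset.Ico 1 (t + 1),
        (w s ω * z (W s ω (A s ω)) - ν (A s ω) * (Real.exp (w s ω) - 1)))) ≤
        ∑ a, (k a ω * ENNReal.ofReal (1 - z (W t ω a)) +
          (k a ω * ENNReal.ofReal (Real.exp (w t ω))) * ENNReal.ofReal (z (W t ω a))) := by
      have hall : ∀ᵐ ω ∂μ, ∀ a, z (W t ω a) ∈ Set.Icc (0 : ℝ) 1 :=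
        ae_all_iff.2 fun a => hz01 a t ht
      filter_upwards [hall] with ω hω
      have hZ := hω (A t ω)
      refine le_trans ?_ (Finset.single_le_sum (f := fun a =>
        (k a ω * ENNReal.ofReal (1 - z (W t ω a)) +
          (k a ω * ENNReal.ofReal (Real.exp (w t ω))) * ENNReal.ofReal (z (W t ω a))))
        (fun a _ => zero_le) (Finset.mem_univ (A t ω)))
      have hkA : k (A t ω) ω = F ω *
          ENNReal.ofReal (Real.exp (-(ν (A t ω) * (Real.exp (w t ω) - 1)))) := by
        simp only [k]; exact Set.indicator_of_mem (by simp) _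
      simp only [hkA]
      have e1 : ENNReal.ofReal (1 - z (W t ω (A t ω))) +
          ENNReal.ofReal (Real.exp (w t ω)) * ENNReal.ofReal (z (W t ω (A t ω))) =
          ENNReal.ofReal ((1 - z (W t ω (A t ω))) + Real.exp (w t ω) * z (W t ω (A t ω))) := by
        rw [ENNReal.ofReal_add (by linarith [hZ.2]) (mul_nonneg (Real.exp_pos _).le hZ.1),
          ENNReal.ofReal_mul (Real.exp_pos _).le]
      rw [mul_assoc, mul_assoc, mul_assoc, ← mul_add, ← mul_add, e1,
        Finset.sum_Ico_succ_top (show 1 ≤ t by omega), Real.exp_add,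
        ← ENNReal.ofReal_mul (Real.exp_pos _).le, ENNReal.ofReal_mul (Real.exp_pos _).le]
      refine mul_le_mul_right (ENNReal.ofReal_le_ofReal ?_) (F ω)
      rw [sub_eq_add_neg, Real.exp_add, mul_comm]
      refine mul_le_mul_of_nonneg_left ?_ (Real.exp_pos _).le
      have := exp_mul_le_convex hZ (w t ω)
      linarith
    calc _ ≤ ∫⁻ ω, ∑ a, (k a ω * ENNReal.ofReal (1 - z (W t ω a)) +
          (k a ω * ENNReal.ofReal (Real.exp (w t ω))) * ENNReal.ofReal (z (W t ω a))) ∂μ :=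
          lintegral_mono_ae bound
      _ = ∑ a, ∫⁻ ω, (k a ω * ENNReal.ofReal (1 - ν a) +
          (k a ω * ENNReal.ofReal (Real.exp (w t ω))) * ENNReal.ofReal (ν a)) ∂μ := by
          have hWle := hWt.comap_le
          have mk : ∀ a, Measurable (k a) := fun a => (hk a).mono (h.le t) le_rfl
          have mk2 : ∀ a, Measurable[G t] fun ω => k a ω * ENNReal.ofReal (Real.exp (w t ω)) :=
            fun a => (hk a).mul hew
          have mk2' : ∀ a, Measurable fun ω => k a ω * ENNReal.ofReal (Real.exp (w t ω)) :=
            fun a => (mk2 a).mono (h.le t) le_rfl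
          have m1 : ∀ a, Measurable fun ω => ENNReal.ofReal (1 - z (W t ω a)) := fun a =>
            (hZ1 a).mono hWle le_rfl
          have m2 : ∀ a, Measurable fun ω => ENNReal.ofReal (z (W t ω a)) := fun a =>
            (hZ2 a).mono hWle le_rfl
          rw [lintegral_finsetSum _ fun a _ => ((mk a).fun_mul (m1 a)).fun_add
            ((mk2' a).fun_mul (m2 a))]
          refine Finset.sum_congr rfl fun a _ => ?_
          have i2 : ∫⁻ ω, ENNReal.ofReal (z (W t ω a)) ∂μ = ENNReal.ofReal (ν a) := by
            rw [← ofReal_integral_eq_lintegral_ofReal (hZi a)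
              ((hz01 a t ht).mono fun ω hω => hω.1), hν a t ht]
          have i1 : ∫⁻ ω, ENNReal.ofReal (1 - z (W t ω a)) ∂μ = ENNReal.ofReal (1 - ν a) := by
            rw [← ofReal_integral_eq_lintegral_ofReal (f := fun ω => 1 - z (W t ω a))
              ((integrable_const 1).sub (hZi a))
              ((hz01 a t ht).mono fun ω hω => sub_nonneg.2 hω.2),
              integral_sub (integrable_const 1) (hZi a), hν a t ht]
            simp
          rw [lintegral_add_left ((mk a).fun_mul (m1 a)), lintegral_add_left ((mk a).mul_const _),
            lintegral_mul_eq_lintegral_mul_lintegral_of_independent_measurableSpace (h.le t) hWle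
              (h.indep t ht) (hk a) (hZ1 a),
            lintegral_mul_eq_lintegral_mul_lintegral_of_independent_measurableSpace (h.le t) hWle
              (h.indep t ht) (mk2 a) (hZ2 a), i1, i2, lintegral_mul_const _ (mk a),
            lintegral_mul_const _ (mk2' a)]
      _ ≤ ∑ a, ∫⁻ ω, {ω | A t ω = a}.indicator F ω ∂μ := by
          refine Finset.sum_le_sum fun a _ => lintegral_mono fun ω => ?_
          by_cases hω : A t ω = a
          · have hω' : ω ∈ {ω | A t ω = a} := hω
            have e1 : k a ω = F ω *
                ENNReal.ofReal (Real.exp (-(ν a * (Real.exp (w t ω) - 1)))) := by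
              simp only [k]; exact Set.indicator_of_mem hω' _
            have e2 : {ω | A t ω = a}.indicator F ω = F ω := Set.indicator_of_mem hω' _
            simp only [e1, e2]
            rw [mul_assoc, mul_assoc, mul_assoc, ← mul_add,
              ← mul_add, ← ENNReal.ofReal_mul (Real.exp_pos _).le,
              ← ENNReal.ofReal_add (by linarith [(hν01 a).2])
                (mul_nonneg (Real.exp_pos _).le (hν01 a).1),
              ← ENNReal.ofReal_mul (Real.exp_pos _).le]
            conv_rhs => rw [← mul_one (F ω)]
            refine mul_le_mul_right ?_ (F ω)
            rw [← ENNReal.ofReal_one]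
            refine ENNReal.ofReal_le_ofReal ?_
            have := Real.add_one_le_exp (ν a * (Real.exp (w t ω) - 1))
            rw [Real.exp_neg, inv_mul_le_one₀ (Real.exp_pos _)]
            linarith
          · have hω' : ω ∉ {ω | A t ω = a} := hω
            have e1 : k a ω = 0 := by simp only [k]; exact Set.indicator_of_notMem hω' _
            simp [e1]
      _ = ∫⁻ ω, F ω ∂μ := by
          have hA : ∀ a, MeasurableSet {ω | A t ω = a} := fun a => h.le t _ (h.act t ht a)
          rw [← lintegral_finsetSum _ fun a _ =>
            (hF.mono (h.le t) le_rfl).indicator (hA a)]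
          refine lintegral_congr fun ω => ?_
          rw [Finset.sum_eq_single (A t ω)]
          · exact Set.indicator_of_mem (by simp) _
          · intro b _ hb
            exact Set.indicator_of_notMem (fun hh => hb hh.symm) _
          · simp
      _ ≤ 1 := ih

/-- Markov's inequality for the exponential supermartingale. -/
theorem measure_ge_le [IsProbabilityMeasure μ] (h : IsAdaptedPlay μ T G W A) {z : E → ℝ} (hz : Measurable z)
    {ν : 𝒜 → ℝ} (hz01 : ∀ a, ∀ t ∈ Finset.Icc 1 T, ∀ᵐ ω ∂μ, z (W t ω a) ∈ Set.Icc (0 : ℝ) 1)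
    (hν : ∀ a, ∀ t ∈ Finset.Icc 1 T, ∫ ω, z (W t ω a) ∂μ = ν a)
    {w : ℕ → Ω → ℝ} (hw : ∀ t ∈ Finset.Icc 1 T, Measurable[G t] (w t)) {n : ℕ} (hn : n ≤ T)
    (ℓ : ℝ) :
    μ.real {ω | ℓ ≤ ∑ s ∈ Finset.Ico 1 (n + 1),
      (w s ω * z (W s ω (A s ω)) - ν (A s ω) * (Real.exp (w s ω) - 1))} ≤ Real.exp (-ℓ) := by
  have h1 := h.lintegral_exp_le_one hz hz01 hν hw hn
  set Y : Ω → ℝ := fun ω => ∑ s ∈ Finset.Ico 1 (n + 1),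
      (w s ω * z (W s ω (A s ω)) - ν (A s ω) * (Real.exp (w s ω) - 1))
  have hY : Measurable Y := Finset.measurable_fun_sum _ fun s hs => by
    rw [Finset.mem_Ico] at hs
    exact (h.measurable_term hz ν hw (Finset.mem_Icc.2 ⟨hs.1, by omega⟩)).mono (h.le _) le_rfl
  have h2 := mul_meas_ge_le_lintegral (μ := μ)
    (ENNReal.measurable_ofReal.comp (Real.measurable_exp.comp hY)) (ENNReal.ofReal (Real.exp ℓ))
  have e : {ω | ENNReal.ofReal (Real.exp ℓ) ≤
      (ENNReal.ofReal ∘ Real.exp ∘ Y) ω} = {ω | ℓ ≤ Y ω} := by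
    ext ω
    simp [ENNReal.ofReal_le_ofReal_iff (Real.exp_pos _).le]
  rw [e] at h2
  have h3 := h2.trans h1
  have h4 := ENNReal.toReal_mono ENNReal.one_ne_top h3
  rw [ENNReal.toReal_mul, ENNReal.toReal_ofReal (Real.exp_pos _).le, ENNReal.toReal_one] at h4
  rw [Real.exp_neg, ← one_div, le_div_iff₀ (Real.exp_pos _), mul_comm]
  exact h4

end IsAdaptedPlay

/-! ### Tail bounds -/

/-- Multiply by exp x ≥ 1 + x + x²/2 and use (1 - x + x²/2)(1 + x + x²/2) = 1 + x⁴/4. -/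
lemma exp_neg_le_quadratic {x : ℝ} (hx : 0 ≤ x) : Real.exp (-x) ≤ 1 - x + x ^ 2 / 2 := by
  have h := Real.quadratic_le_exp_of_nonneg hx
  have h0 : 0 ≤ 1 - x + x ^ 2 / 2 := by nlinarith [sq_nonneg (x - 1)]
  rw [Real.exp_neg, inv_le_iff_one_le_mul₀ (Real.exp_pos x)]
  nlinarith [mul_le_mul_of_nonneg_left h h0, sq_nonneg (x ^ 2)]

lemma exp_le_subgamma {x : ℝ} (h0 : 0 ≤ x) (h1 : x < 1) :
    Real.exp x ≤ 1 + x + x ^ 2 / (2 * (1 - x)) := by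
  have h := Real.exp_bound' h0 h1.le (n := 3) (by norm_num)
  simp only [Finset.sum_range_succ, Finset.sum_range_zero, Nat.factorial] at h
  norm_num at h
  have h2 : x ^ 2 / 2 + x ^ 3 * 4 / 18 ≤ x ^ 2 / (2 * (1 - x)) := by
    rw [le_div_iff₀ (by linarith)]
    nlinarith [mul_nonneg (sq_nonneg x) h0, mul_nonneg (sq_nonneg x) (sq_nonneg x)]
  linarith

lemma measureReal_le_exp_of_forall_notMem {Ω : Type*} [MeasurableSpace Ω] {μ : Measure Ω}
    {s : Set Ω} (h : ∀ ω, ω ∉ s) (x : ℝ) : μ.real s ≤ Real.exp x := by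
  rw [Set.eq_empty_of_forall_notMem h, measureReal_empty]
  exact (Real.exp_pos x).le

namespace IsAdaptedPlay

variable {Ω : Type*} [mΩ : MeasurableSpace Ω] {μ : Measure Ω}
  {𝒜 E : Type*} [MeasurableSpace E] {T : ℕ} {G : ℕ → MeasurableSpace Ω}
  {W : ℕ → Ω → 𝒜 → E} {A : ℕ → Ω → 𝒜}

open Classical in
lemma measurable_card (h : IsAdaptedPlay μ T G W A) (a : 𝒜) {t : ℕ} (ht : t ∈ Finset.Icc 1 T) :
    Measurable[G t] fun ω => ((Finset.Ico 1 t).filter fun s => A s ω = a).card := by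
  simp_rw [Finset.card_filter]
  refine Finset.measurable_fun_sum _ fun s hs => ?_
  rw [Finset.mem_Ico] at hs
  rw [Finset.mem_Icc] at ht
  exact Measurable.ite (h.mono hs.2.le _ (h.act s (Finset.mem_Icc.2 ⟨hs.1, by omega⟩) a))
    measurable_const measurable_const

open Classical in
-- The supermartingale run to the horizon is frozen after the n-th pull of a, so its final value
-- equals its value at every t preceded by exactly n pulls. One Markov bound therefore covers all
-- these t.
theorem arm_tail [Fintype 𝒜] [IsProbabilityMeasure μ] (h : IsAdaptedPlay μ T G W A) {z : E → ℝ}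
    (hz : Measurable z)
    {ν : 𝒜 → ℝ} (hz01 : ∀ a, ∀ t ∈ Finset.Icc 1 T, ∀ᵐ ω ∂μ, z (W t ω a) ∈ Set.Icc (0 : ℝ) 1)
    (hν : ∀ a, ∀ t ∈ Finset.Icc 1 T, ∫ ω, z (W t ω a) ∂μ = ν a) (a : 𝒜) (n : ℕ) (lam ℓ : ℝ) :
    μ.real {ω | ∃ t ∈ Finset.Icc 1 T,
      ((Finset.Ico 1 t).filter fun s => A s ω = a).card = n ∧
      ℓ ≤ lam * (∑ s ∈ Finset.Ico 1 t, if A s ω = a then z (W s ω (A s ω)) else 0)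
        - n * (ν a * (Real.exp lam - 1))} ≤ Real.exp (-ℓ) := by
  -- The weight is switched on for the first n pulls of a only; this condition is known before the
  -- outcome of round s.
  set p : ℕ → Ω → Prop := fun s ω =>
    A s ω = a ∧ ((Finset.Ico 1 s).filter fun s => A s ω = a).card < n
  set w : ℕ → Ω → ℝ := fun s ω => if p s ω then lam else 0
  have hw : ∀ t ∈ Finset.Icc 1 T, Measurable[G t] (w t) := fun t ht =>
    Measurable.ite ((h.act t ht a).inter (h.measurable_card a ht measurableSet_Iio))
      measurable_const measurable_const
  refine le_trans (measureReal_mono ?_) (h.measure_ge_le hz hz01 hν hw le_rfl ℓ)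
  rintro ω ⟨t, ht, hcard, hℓ⟩
  rw [Finset.mem_Icc] at ht
  refine hℓ.trans (le_of_eq ?_)
  have hlt : ∀ s ∈ Finset.Ico 1 t, (p s ω ↔ A s ω = a) := fun s hs => by
    refine ⟨fun hp => hp.1, fun hp => ⟨hp, ?_⟩⟩
    rw [← hcard]
    refine Finset.card_lt_card (Finset.ssubset_iff_subset_ne.2 ⟨?_, fun he => ?_⟩)
    · exact Finset.filter_subset_filter _ (Finset.Ico_subset_Ico_right (Finset.mem_Ico.1 hs).2.le)
    · have : s ∈ (Finset.Ico 1 t).filter fun s => A s ω = a := Finset.mem_filter.2 ⟨hs, hp⟩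
      rw [← he] at this
      simp at this
  have hge : ∀ s, t ≤ s → ¬ p s ω := fun s hs hp => by
    have h1 := hp.2
    have h2 := Finset.card_le_card (Finset.filter_subset_filter (fun s => A s ω = a)
      (Finset.Ico_subset_Ico_right hs : Finset.Ico 1 t ⊆ Finset.Ico 1 s))
    omega
  have hsplit : ∑ s ∈ Finset.Ico 1 (T + 1),
      (w s ω * z (W s ω (A s ω)) - ν (A s ω) * (Real.exp (w s ω) - 1)) =
      ∑ s ∈ Finset.Ico 1 t, (if A s ω = a then
        lam * z (W s ω (A s ω)) - ν a * (Real.exp lam - 1) else 0) := by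
    rw [← Finset.sum_Ico_consecutive _ ht.1 (by omega : t ≤ T + 1)]
    have z0 : ∑ s ∈ Finset.Ico t (T + 1),
        (w s ω * z (W s ω (A s ω)) - ν (A s ω) * (Real.exp (w s ω) - 1)) = 0 :=
      Finset.sum_eq_zero fun s hs => by
        have : w s ω = 0 := if_neg (hge s (Finset.mem_Ico.1 hs).1)
        simp [this]
    rw [z0, add_zero]
    refine Finset.sum_congr rfl fun s hs => ?_
    by_cases hA : A s ω = a
    · have : w s ω = lam := if_pos ((hlt s hs).2 hA)
      rw [this, if_pos hA, hA]
    · have : w s ω = 0 := if_neg fun hp => hA ((hlt s hs).1 hp)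
      rw [this, if_neg hA]
      simp
  rw [hsplit, ← Finset.sum_filter, ← Finset.sum_filter, Finset.sum_sub_distrib, Finset.sum_const,
    hcard, Finset.mul_sum, nsmul_eq_mul]

open Classical in
-- With m = nν, the tilt -√(2mℓ)/m is optimal for the quadratic bound on exp. Nonnegativity of the
-- sum is part of the event because outcomes lie in [0,1] only almost surely; it settles m = 0.
theorem arm_lower_tail [Fintype 𝒜] [IsProbabilityMeasure μ] (h : IsAdaptedPlay μ T G W A) {z : E → ℝ}
    (hz : Measurable z)
    {ν : 𝒜 → ℝ} (hz01 : ∀ a, ∀ t ∈ Finset.Icc 1 T, ∀ᵐ ω ∂μ, z (W t ω a) ∈ Set.Icc (0 : ℝ) 1)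
    (hν : ∀ a, ∀ t ∈ Finset.Icc 1 T, ∫ ω, z (W t ω a) ∂μ = ν a) (a : 𝒜) (hνa : 0 ≤ ν a) (n : ℕ)
    {ℓ : ℝ} (hℓ : 0 < ℓ) :
    μ.real {ω | ∃ t ∈ Finset.Icc 1 T,
      ((Finset.Ico 1 t).filter fun s => A s ω = a).card = n ∧
      0 ≤ (∑ s ∈ Finset.Ico 1 t, if A s ω = a then z (W s ω (A s ω)) else 0) ∧
      (∑ s ∈ Finset.Ico 1 t, if A s ω = a then z (W s ω (A s ω)) else 0)
        + Real.sqrt (2 * (n * ν a) * ℓ) < n * ν a} ≤ Real.exp (-ℓ) := by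
  rcases (mul_nonneg (Nat.cast_nonneg n) hνa : (0 : ℝ) ≤ n * ν a).eq_or_lt with h0 | h0
  · rw [← h0]
    refine measureReal_le_exp_of_forall_notMem ?_ _
    rintro ω ⟨t, -, -, h1, h2⟩
    simp at h2
    linarith
  · set m := (n : ℝ) * ν a
    set v := Real.sqrt (2 * m * ℓ)
    have hv : v ^ 2 = 2 * m * ℓ := Real.sq_sqrt (by positivity)
    have hv0 : 0 < v := Real.sqrt_pos.2 (by positivity)
    refine le_trans (measureReal_mono ?_) (h.arm_tail hz hz01 hν a n (-(v / m)) ℓ)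
    rintro ω ⟨t, ht, hcard, -, hlt⟩
    refine ⟨t, ht, hcard, ?_⟩
    set S := ∑ s ∈ Finset.Ico 1 t, if A s ω = a then z (W s ω (A s ω)) else 0
    have hu : 0 < v / m := by positivity
    have hexp := exp_neg_le_quadratic hu.le
    have e1 : (n : ℝ) * (ν a * (Real.exp (-(v / m)) - 1)) = m * (Real.exp (-(v / m)) - 1) := by
      simp only [m]; ring
    have e2 : m * (v / m) = v := by field_simp
    have e3 : v * (v / m) = 2 * ℓ := by
      rw [← mul_div_assoc, ← sq, hv]; field_simp
    have e4 : m * (Real.exp (-(v / m)) - 1) ≤ -v + ℓ := by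
      calc _ ≤ m * (-(v / m) + (v / m) ^ 2 / 2) := by gcongr; linarith
        _ = -(m * (v / m)) + (m * (v / m)) * (v / m) / 2 := by ring
        _ = _ := by rw [e2, e3]; ring
    have e5 : (v / m) * (S + v) ≤ (v / m) * m := by gcongr
    rw [e1]
    nlinarith

open Classical in
theorem arm_upper_tail [Fintype 𝒜] [IsProbabilityMeasure μ] (h : IsAdaptedPlay μ T G W A) {z : E → ℝ}
    (hz : Measurable z)
    {ν : 𝒜 → ℝ} (hz01 : ∀ a, ∀ t ∈ Finset.Icc 1 T, ∀ᵐ ω ∂μ, z (W t ω a) ∈ Set.Icc (0 : ℝ) 1)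
    (hν : ∀ a, ∀ t ∈ Finset.Icc 1 T, ∫ ω, z (W t ω a) ∂μ = ν a) (a : 𝒜) (hνa : 0 ≤ ν a) (n : ℕ)
    {ℓ : ℝ} (hℓ : 0 < ℓ) :
    μ.real {ω | ∃ t ∈ Finset.Icc 1 T,
      ((Finset.Ico 1 t).filter fun s => A s ω = a).card = n ∧
      n * ν a + Real.sqrt (2 * (n * ν a) * ℓ) + 2 * ℓ <
        (∑ s ∈ Finset.Ico 1 t, if A s ω = a then z (W s ω (A s ω)) else 0)} ≤ Real.exp (-ℓ) := by
  rcases (mul_nonneg (Nat.cast_nonneg n) hνa : (0 : ℝ) ≤ n * ν a).eq_or_lt with h0 | h0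
  -- With mean zero the compensator vanishes, and the tilt 1/2 matches the threshold 2ℓ.
  · refine le_trans (measureReal_mono ?_) (h.arm_tail hz hz01 hν a n (1 / 2) ℓ)
    rintro ω ⟨t, ht, hcard, hlt⟩
    refine ⟨t, ht, hcard, ?_⟩
    rw [← mul_assoc, ← h0]
    rw [← h0] at hlt
    simp at hlt
    linarith
  · set m := (n : ℝ) * ν a
    set v := Real.sqrt (2 * m * ℓ)
    have hv : v ^ 2 = 2 * m * ℓ := Real.sq_sqrt (by positivity)
    have hv0 : 0 < v := Real.sqrt_pos.2 (by positivity)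
    set u := v / m
    have hu : 0 < u := by positivity
    have e2 : m * u = v := by simp only [u]; field_simp
    have e3 : v * u = 2 * ℓ := by
      simp only [u]; rw [← mul_div_assoc, ← sq, hv]; field_simp
    -- Chosen so that lam / (1 - lam) = u, which makes the sub-gamma correction lam² / (2 (1 - lam))
    -- equal to lam u / 2.
    set lam := u / (1 + u)
    have hl0 : 0 < lam := by positivity
    have hl1 : lam < 1 := by simp only [lam]; rw [div_lt_one (by positivity)]; linarith
    have hl : lam = u * (1 - lam) := by simp only [lam]; field_simp; ring
    refine le_trans (measureReal_mono ?_) (h.arm_tail hz hz01 hν a n lam ℓ)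
    rintro ω ⟨t, ht, hcard, hlt⟩
    refine ⟨t, ht, hcard, ?_⟩
    set S := ∑ s ∈ Finset.Ico 1 t, if A s ω = a then z (W s ω (A s ω)) else 0
    have hexp := exp_le_subgamma hl0.le hl1
    have e0 : lam ^ 2 / (2 * (1 - lam)) = lam * u / 2 := by
      rw [div_eq_div_iff (by linarith) two_ne_zero, sq]
      nth_rw 2 [hl]
      ring
    have e1 : (n : ℝ) * (ν a * (Real.exp lam - 1)) = m * (Real.exp lam - 1) := by
      simp only [m]; ring
    have e4 : m * (Real.exp lam - 1) ≤ m * lam + lam * v / 2 := by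
      calc _ ≤ m * (lam + lam * u / 2) := by rw [← e0]; gcongr; linarith
        _ = m * lam + lam * (m * u) / 2 := by ring
        _ = _ := by rw [e2]
    have e5 : lam * (m + v + 2 * ℓ) ≤ lam * S := by gcongr
    have e6 : lam * (v / 2 + 2 * ℓ) = (1 - lam) * (ℓ + u * (2 * ℓ)) := by
      nth_rw 1 [hl]
      have : u * (1 - lam) * (v / 2 + 2 * ℓ) = (1 - lam) * ((v * u) / 2 + u * (2 * ℓ)) := by ring
      rw [this, e3]
      ring
    have e7 : (1 - lam) * (ℓ + u * (2 * ℓ)) = (1 - lam) * ℓ + lam * (2 * ℓ) := by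
      have : (1 - lam) * (ℓ + u * (2 * ℓ)) = (1 - lam) * ℓ + (u * (1 - lam)) * (2 * ℓ) := by ring
      rw [this, ← hl]
    rw [e1]
    nlinarith [mul_pos hl0 hℓ]

/-- A Hoeffding-type bound for predictable weights in [0,1]: the tilt √(ℓ/n) gains 2ℓ and pays n ·
ℓ/n = ℓ. For n < ℓ, where this tilt exceeds 1, the event is empty because the sum is at most n. -/
theorem weighted_sum_tail [Fintype 𝒜] [IsProbabilityMeasure μ] (h : IsAdaptedPlay μ T G W A) {z : E → ℝ}
    (hz : Measurable z)
    {ν : 𝒜 → ℝ} (hz01 : ∀ a, ∀ t ∈ Finset.Icc 1 T, ∀ᵐ ω ∂μ, z (W t ω a) ∈ Set.Icc (0 : ℝ) 1)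
    (hν : ∀ a, ∀ t ∈ Finset.Icc 1 T, ∫ ω, z (W t ω a) ∂μ = ν a)
    (hν01 : ∀ a, ν a ∈ Set.Icc (0 : ℝ) 1)
    {y : ℕ → Ω → ℝ} (hy : ∀ t ∈ Finset.Icc 1 T, Measurable[G t] (y t)) {n : ℕ} (hn1 : 1 ≤ n)
    (hn : n ≤ T) {ℓ : ℝ} (hℓ : 0 < ℓ) {σ : ℝ} (hσ : σ = 1 ∨ σ = -1) :
    μ.real {ω | (∀ s ∈ Finset.Icc 1 T, y s ω ∈ Set.Icc (0 : ℝ) 1 ∧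
        z (W s ω (A s ω)) ∈ Set.Icc (0 : ℝ) 1) ∧
      2 * Real.sqrt (n * ℓ) < σ * ∑ s ∈ Finset.Ico 1 (n + 1),
        y s ω * (z (W s ω (A s ω)) - ν (A s ω))} ≤ Real.exp (-ℓ) := by
  have hn0 : (0 : ℝ) < n := by exact_mod_cast hn1
  have hσ1 : |σ| = 1 := by rcases hσ with rfl | rfl <;> simp
  have hσ2 : σ ^ 2 = 1 := by rw [← sq_abs, hσ1, one_pow]
  have hmem : ∀ s ∈ Finset.Ico 1 (n + 1), s ∈ Finset.Icc 1 T := fun s hs => by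
    rw [Finset.mem_Ico] at hs; exact Finset.mem_Icc.2 ⟨hs.1, by omega⟩
  rcases lt_or_ge (n : ℝ) ℓ with hnℓ | hnℓ
  · refine measureReal_le_exp_of_forall_notMem ?_ _
    rintro ω ⟨h1, h2⟩
    have h3 : σ * ∑ s ∈ Finset.Ico 1 (n + 1), y s ω * (z (W s ω (A s ω)) - ν (A s ω)) ≤ n := by
      rw [Finset.mul_sum]
      calc _ ≤ ∑ s ∈ Finset.Ico 1 (n + 1), (1 : ℝ) := by
            refine Finset.sum_le_sum fun s hs => ?_
            obtain ⟨hy1, hz1⟩ := h1 s (hmem s hs)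
            have hv1 := hν01 (A s ω)
            refine (le_abs_self _).trans ?_
            rw [abs_mul, abs_mul, hσ1, one_mul]
            have : |z (W s ω (A s ω)) - ν (A s ω)| ≤ 1 := abs_le.2
              ⟨by linarith [hz1.1, hv1.2], by linarith [hz1.2, hv1.1]⟩
            rw [abs_of_nonneg hy1.1]
            exact mul_le_one₀ hy1.2 (abs_nonneg _) this
        _ = n := by simp
    have h4 : (n : ℝ) ≤ Real.sqrt (n * ℓ) := Real.le_sqrt_of_sq_le (by nlinarith)
    have h5 := Real.sqrt_nonneg ((n : ℝ) * ℓ)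
    linarith
  · set lam := Real.sqrt (ℓ / n)
    have hl0 : 0 < lam := Real.sqrt_pos.2 (by positivity)
    have hl1 : lam ≤ 1 := by
      simp only [lam]
      rw [Real.sqrt_le_one, div_le_one hn0]
      exact hnℓ
    have hl2 : lam ^ 2 = ℓ / n := Real.sq_sqrt (by positivity)
    have hl3 : lam * Real.sqrt (n * ℓ) = ℓ := by
      simp only [lam]
      rw [← Real.sqrt_mul (by positivity), show ℓ / n * (n * ℓ) = ℓ ^ 2 by field_simp,
        Real.sqrt_sq hℓ.le]
    refine le_trans (measureReal_mono ?_) (h.measure_ge_le hz hz01 hν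
      (w := fun s ω => σ * lam * y s ω) (fun t ht => (hy t ht).const_mul _) hn ℓ)
    rintro ω ⟨h1, h2⟩
    have key : σ * lam * (∑ s ∈ Finset.Ico 1 (n + 1), y s ω * (z (W s ω (A s ω)) - ν (A s ω)))
        - n * lam ^ 2 ≤ ∑ s ∈ Finset.Ico 1 (n + 1), (σ * lam * y s ω * z (W s ω (A s ω)) -
          ν (A s ω) * (Real.exp (σ * lam * y s ω) - 1)) := by
      have : (n : ℝ) * lam ^ 2 = ∑ s ∈ Finset.Ico 1 (n + 1), lam ^ 2 := by simp
      rw [this, Finset.mul_sum, ← Finset.sum_sub_distrib]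
      refine Finset.sum_le_sum fun s hs => ?_
      obtain ⟨hy1, hz1⟩ := h1 s (hmem s hs)
      have hv1 := hν01 (A s ω)
      have ha : |σ * lam * y s ω| ≤ 1 := by
        rw [abs_mul, abs_mul, hσ1, one_mul, abs_of_pos hl0, abs_of_nonneg hy1.1]
        exact mul_le_one₀ hl1 hy1.1 hy1.2
      have hb := (abs_le.1 (Real.abs_exp_sub_one_sub_id_le ha)).2
      have hc : (σ * lam * y s ω) ^ 2 ≤ lam ^ 2 := by
        rw [mul_pow, mul_pow, hσ2, one_mul]
        exact mul_le_of_le_one_right (sq_nonneg _) (pow_le_one₀ hy1.1 hy1.2)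
      have hd : ν (A s ω) * (Real.exp (σ * lam * y s ω) - 1) ≤
          ν (A s ω) * (σ * lam * y s ω) + lam ^ 2 := by
        calc _ ≤ ν (A s ω) * (σ * lam * y s ω + lam ^ 2) := by
              refine mul_le_mul_of_nonneg_left ?_ hv1.1
              linarith
          _ ≤ _ := by nlinarith [hv1.2, sq_nonneg lam]
      linarith
    refine le_trans ?_ key
    rw [hl2, mul_div_cancel₀ _ hn0.ne']
    nlinarith [mul_lt_mul_of_pos_left h2 hl0]

end IsAdaptedPlay

/-! ### The prediction error of the least-squares oracle -/

lemma sum_Ico_cast (t : ℕ) : ∑ s ∈ Finset.Ico 1 t, (s : ℝ) = t * (t - 1) / 2 := by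
  induction t with
  | zero => simp
  | succ t ih =>
    rcases Nat.eq_zero_or_pos t with rfl | ht
    · simp
    · rw [Finset.sum_Ico_succ_top ht, ih]; push_cast; ring

lemma sum_Ico_cast_sq (t : ℕ) :
    ∑ s ∈ Finset.Ico 1 t, (s : ℝ) ^ 2 = (t - 1) * t * (2 * t - 1) / 6 := by
  induction t with
  | zero => simp
  | succ t ih =>
    rcases Nat.eq_zero_or_pos t with rfl | ht
    · simp
    · rw [Finset.sum_Ico_succ_top ht, ih]; push_cast; ring

/-- The weight of the demand of round `s` in the least-squares slope at time `t`. -/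
def slopeWeight (t s : ℕ) : ℝ :=
  ((t : ℝ) - 1) * (s - t / 2) / (((t : ℝ) - 1) ^ 2 * t * (t - 2) / 12)

lemma betaHat_eq (q : ℕ → ℝ) (t : ℕ) :
    betaHat q t = ∑ s ∈ Finset.Ico 1 t, slopeWeight t s * q s := by
  have e : ((t : ℝ) - 1) * ((t - 1) * t * (2 * t - 1) / 6) - (t * (t - 1) / 2) ^ 2 =
      ((t : ℝ) - 1) ^ 2 * t * (t - 2) / 12 := by ring
  have e' : ∀ s : ℕ, slopeWeight t s * q s = (((t : ℝ) - 1) * (s * q s) -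
      t * (t - 1) / 2 * q s) / (((t : ℝ) - 1) ^ 2 * t * (t - 2) / 12) := fun s => by
    rw [slopeWeight]; ring
  rw [betaHat, sum_Ico_cast, sum_Ico_cast_sq, e, Finset.sum_congr rfl fun s _ => e' s,
    ← Finset.sum_div, Finset.sum_sub_distrib, Finset.mul_sum, Finset.mul_sum]

/-- The weight of the demand of round `s` in the prediction error at time `t`. -/
def errorWeight (T t s : ℕ) : ℝ :=
  if s < t then -((T - t + 1 : ℝ) / (t - 1) + slopeWeight t s * ((T - t + 1) * T / 2)) else 1

lemma sum_Icc_eq_Ico {f : ℕ → ℝ} (a T : ℕ) :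
    ∑ s ∈ Finset.Icc a T, f s = ∑ s ∈ Finset.Ico a (T + 1), f s := rfl

lemma sum_errorWeight (T t : ℕ) (ht : t ∈ Finset.Icc 3 T) (f : ℕ → ℝ) :
    ∑ s ∈ Finset.Icc 1 T, errorWeight T t s * f s =
      ∑ s ∈ Finset.Icc t T, f s - (T - t + 1 : ℝ) / (t - 1) * ∑ s ∈ Finset.Ico 1 t, f s
        - ((T - t + 1) * T / 2) * ∑ s ∈ Finset.Ico 1 t, slopeWeight t s * f s := by
  rw [Finset.mem_Icc] at ht
  rw [sum_Icc_eq_Ico, sum_Icc_eq_Ico, ← Finset.sum_Ico_consecutive _ (by omega : 1 ≤ t)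
    (by omega : t ≤ T + 1)]
  have e1 : ∑ s ∈ Finset.Ico t (T + 1), errorWeight T t s * f s =
      ∑ s ∈ Finset.Ico t (T + 1), f s := Finset.sum_congr rfl fun s hs => by
    rw [errorWeight, if_neg (by have := (Finset.mem_Ico.1 hs).1; omega), one_mul]
  have e2 : ∑ s ∈ Finset.Ico 1 t, errorWeight T t s * f s =
      ∑ s ∈ Finset.Ico 1 t, (-((T - t + 1 : ℝ) / (t - 1) * f s) -
        ((T - t + 1) * T / 2) * (slopeWeight t s * f s)) := Finset.sum_congr rfl fun s hs => by
    rw [errorWeight, if_pos (Finset.mem_Ico.1 hs).2]; ring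
  rw [e1, e2, Finset.sum_sub_distrib, Finset.sum_neg_distrib, ← Finset.mul_sum, ← Finset.mul_sum]
  ring

lemma sum_Icc_cast {t T : ℕ} (h : t ≤ T + 1) :
    ∑ s ∈ Finset.Icc t T, (s : ℝ) = (T - t + 1) * (T + t) / 2 := by
  rcases Nat.eq_zero_or_pos t with rfl | ht
  · have := Finset.sum_range_eq_add_Ico (fun s : ℕ => (s : ℝ)) (Nat.succ_pos T)
    rw [sum_Icc_eq_Ico, ← Finset.range_eq_Ico, this, sum_Ico_cast]
    push_cast; ring
  · have := Finset.sum_Ico_consecutive (fun s : ℕ => (s : ℝ)) ht h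
    rw [sum_Ico_cast, sum_Ico_cast] at this
    rw [sum_Icc_eq_Ico, ← sub_eq_iff_eq_add'.2 this.symm]
    push_cast; ring

/-- Together with `sum_slopeWeight_mul`: the estimated slope ignores constants and is exact on
linear trends. -/
lemma sum_slopeWeight {t : ℕ} : ∑ s ∈ Finset.Ico 1 t, slopeWeight t s = 0 := by
  rcases Nat.eq_zero_or_pos t with rfl | ht
  · simp
  simp only [slopeWeight]
  rw [← Finset.sum_div, ← Finset.mul_sum, Finset.sum_sub_distrib, sum_Ico_cast]
  rw [Finset.sum_const, Nat.card_Ico, nsmul_eq_mul, Nat.cast_sub ht, Nat.cast_one]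
  ring

lemma sum_slopeWeight_mul {t : ℕ} (ht : 3 ≤ t) :
    ∑ s ∈ Finset.Ico 1 t, slopeWeight t s * s = 1 := by
  have ht' : (3 : ℝ) ≤ t := by exact_mod_cast ht
  have h : ∀ s : ℕ, slopeWeight t s * s =
      ((t : ℝ) - 1) * ((s : ℝ) ^ 2 - t / 2 * s) / (((t : ℝ) - 1) ^ 2 * t * (t - 2) / 12) :=
    fun s => by rw [slopeWeight]; ring
  simp only [h]
  rw [← Finset.sum_div, ← Finset.mul_sum, Finset.sum_sub_distrib, ← Finset.mul_sum, sum_Ico_cast,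
    sum_Ico_cast_sq]
  have h1 : (t : ℝ) - 1 ≠ 0 := by linarith
  have h2 : (t : ℝ) - 2 ≠ 0 := by linarith
  have h3 : (t : ℝ) ≠ 0 := by linarith
  field_simp
  ring

/-- The prediction error is a linear form in the demands whose weights are orthogonal to both 1 and
s, so the trend drops out and only noise remains. -/
lemma lsPrediction_error {T t : ℕ} (ht : t ∈ Finset.Icc 3 T) (F₁ : ℝ) (F₂ : ℝ → ℝ)
    (α β : ℝ) (ξ : ℕ → ℝ) :
    totalDemand T (fun s => α + β * (s : ℝ) + ξ s) -
        lsPrediction T F₁ F₂ (fun s => α + β * (s : ℝ) + ξ s) t =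
      ∑ s ∈ Finset.Icc 1 T, errorWeight T t s * ξ s := by
  have hT := Finset.mem_Icc.1 ht
  have ht' : (3 : ℝ) ≤ t := by exact_mod_cast hT.1
  have h1 : (t : ℝ) - 1 ≠ 0 := by linarith
  have hcard : ((Finset.Icc t T).card : ℝ) = T - t + 1 := by
    rw [Nat.card_Icc, Nat.cast_sub (by omega)]; push_cast; ring
  have hcard' : ((Finset.Ico 1 t).card : ℝ) = t - 1 := by
    rw [Nat.card_Ico, Nat.cast_sub (by omega)]; push_cast; ring
  have step : ∀ q : ℕ → ℝ, totalDemand T q - lsPrediction T F₁ F₂ q t =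
      ∑ s ∈ Finset.Icc 1 T, errorWeight T t s * q s := by
    intro q
    rw [sum_errorWeight T t ht, ← betaHat_eq, totalDemand, lsPrediction, if_neg (by omega),
      if_neg (by omega), Finset.sum_add_distrib, ← Finset.mul_sum, sum_Icc_cast (by omega),
      Finset.sum_const, nsmul_eq_mul, hcard, alphaHat, sum_Ico_cast, sum_Icc_eq_Ico,
      sum_Icc_eq_Ico, ← Finset.sum_Ico_consecutive _ (by omega : 1 ≤ t) (by omega : t ≤ T + 1)]
    field_simp
    ring
  rw [step]
  set q : ℕ → ℝ := fun s => α + β * (s : ℝ) + ξ s with hq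
  change ∑ s ∈ Finset.Icc 1 T, errorWeight T t s * q s = _
  have e : ∀ s, errorWeight T t s * q s = α * (errorWeight T t s * 1) +
      β * (errorWeight T t s * s) + errorWeight T t s * ξ s := fun s => by simp only [hq]; ring
  rw [Finset.sum_congr rfl fun s _ => e s]
  rw [Finset.sum_add_distrib, Finset.sum_add_distrib, ← Finset.mul_sum, ← Finset.mul_sum,
    sum_errorWeight T t ht (fun _ => 1), sum_errorWeight T t ht (fun s => (s : ℝ)),
    sum_slopeWeight_mul hT.1, sum_Icc_cast (by omega), sum_Ico_cast]
  simp only [mul_one, sum_slopeWeight, Finset.sum_const, nsmul_eq_mul, hcard, hcard']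
  field_simp
  ring

lemma sum_errorWeight_sq_le {T t : ℕ} (ht : t ∈ Finset.Icc 3 T) :
    ∑ s ∈ Finset.Icc 1 T, errorWeight T t s ^ 2 ≤ 17 * (T : ℝ) ^ 4 / ((t : ℝ) - 1) ^ 3 := by
  have hT := Finset.mem_Icc.1 ht
  have ht' : (3 : ℝ) ≤ t := by exact_mod_cast hT.1
  have htT : (t : ℝ) ≤ T := by exact_mod_cast hT.2
  set n : ℝ := (t : ℝ) - 1 with hn
  have hn0 : 0 < n := by linarith
  have hnT : n ≤ T := by linarith
  have htn : (t : ℝ) = n + 1 := by linarith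
  -- The intercept part contributes T/n ≤ T²/n² and the slope part 6/n² · T²/2. Squaring and summing
  -- n terms gives 16 T⁴/n³; the future rounds add at most T ≤ T⁴/n³.
  have bound : ∀ s ∈ Finset.Ico 1 t, errorWeight T t s ^ 2 ≤ (4 * (T : ℝ) ^ 2 / n ^ 2) ^ 2 := by
    intro s hs
    rw [Finset.mem_Ico] at hs
    have hs1 : (1 : ℝ) ≤ s := by exact_mod_cast hs.1
    have hs2 : (s : ℝ) ≤ t - 1 := by
      have : (s : ℝ) + 1 ≤ t := by exact_mod_cast hs.2
      linarith
    have hb : |slopeWeight t s| ≤ 6 / n ^ 2 := by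
      have hD : 0 < n ^ 2 * t * (t - 2) / 12 := by
        have : (0 : ℝ) < t - 2 := by linarith
        positivity
      rw [slopeWeight, ← hn, abs_div, abs_of_pos hD, abs_mul, abs_of_pos hn0, div_le_div_iff₀ hD
        (by positivity)]
      have h1 : |(s : ℝ) - t / 2| ≤ (t - 2) / 2 := abs_le.2 ⟨by linarith, by linarith⟩
      have h2 : n * |(s : ℝ) - t / 2| * n ^ 2 ≤ n * ((t - 2) / 2) * n ^ 2 := by gcongr
      refine h2.trans ?_
      have h3 : n * (n ^ 2 * ((t : ℝ) - 2)) ≤ t * (n ^ 2 * ((t : ℝ) - 2)) := by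
        refine mul_le_mul_of_nonneg_right (by linarith) (mul_nonneg (by positivity) (by linarith))
      linarith
    rw [errorWeight, if_pos hs.2, neg_sq, ← sq_abs]
    have hN : (0 : ℝ) ≤ T - t + 1 := by linarith
    have hN' : (T - t + 1 : ℝ) ≤ T := by linarith
    gcongr
    calc |(T - t + 1 : ℝ) / n + slopeWeight t s * ((T - t + 1) * T / 2)|
        ≤ (T - t + 1 : ℝ) / n + 6 / n ^ 2 * ((T - t + 1) * T / 2) := by
          refine (abs_add_le _ _).trans ?_
          rw [abs_of_nonneg (by positivity), abs_mul,
            abs_of_nonneg (by positivity : (0 : ℝ) ≤ (T - t + 1) * T / 2)]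
          gcongr
      _ ≤ (T : ℝ) / n + 6 / n ^ 2 * (T * T / 2) := by gcongr
      _ ≤ (T : ℝ) ^ 2 / n ^ 2 + 6 / n ^ 2 * (T * T / 2) := by
          gcongr ?_ + _
          rw [div_le_div_iff₀ hn0 (by positivity)]
          have : (T : ℝ) * n * n ≤ T * n * T := by gcongr
          linarith
      _ = _ := by ring
  have hT0 : (0 : ℝ) < T := by linarith
  rw [sum_Icc_eq_Ico, ← Finset.sum_Ico_consecutive _ (by omega : 1 ≤ t) (by omega : t ≤ T + 1)]
  have p1 : ∑ s ∈ Finset.Ico 1 t, errorWeight T t s ^ 2 ≤ n * (4 * (T : ℝ) ^ 2 / n ^ 2) ^ 2 := by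
    refine (Finset.sum_le_card_nsmul _ _ _ bound).trans (le_of_eq ?_)
    rw [nsmul_eq_mul, Nat.card_Ico, Nat.cast_sub (by omega)]
    simp [hn]
  have p2 : ∑ s ∈ Finset.Ico t (T + 1), errorWeight T t s ^ 2 ≤ T := by
    have : ∀ s ∈ Finset.Ico t (T + 1), errorWeight T t s ^ 2 = 1 := fun s hs => by
      rw [errorWeight, if_neg (by have := (Finset.mem_Ico.1 hs).1; omega), one_pow]
    rw [Finset.sum_congr rfl this]
    simp only [Finset.sum_const, Nat.card_Ico, nsmul_eq_mul, mul_one]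
    exact_mod_cast (by omega : T + 1 - t ≤ T)
  have p3 : (T : ℝ) ≤ T ^ 4 / n ^ 3 := by
    rw [le_div_iff₀ (by positivity)]
    have : (T : ℝ) * n ^ 3 ≤ T * T ^ 3 := by gcongr
    nlinarith
  have p4 : n * (4 * (T : ℝ) ^ 2 / n ^ 2) ^ 2 = 16 * (T ^ 4 / n ^ 3) := by field_simp; ring
  rw [mul_div_assoc]
  linarith

lemma accuracy_sq {M δ : ℝ} {T t : ℕ} (hL : 0 ≤ Real.log (1 / δ)) (ht : 2 ≤ t) :
    accuracy 10 M δ T t ^ 2 =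
      100 * M ^ 2 * T ^ 4 * Real.log (1 / δ) / ((t : ℝ) - 1) ^ 3 := by
  have ht' : (2 : ℝ) ≤ t := by exact_mod_cast ht
  have h0 : (0 : ℝ) ≤ t - 1 := by linarith
  rw [accuracy, max_eq_left (by linarith)]
  have e : (((t : ℝ) - 1) ^ (-(3 / 2) : ℝ)) ^ 2 = (((t : ℝ) - 1) ^ 3)⁻¹ := by
    rw [← Real.rpow_natCast, ← Real.rpow_mul h0, ← Real.rpow_natCast ((t : ℝ) - 1) 3,
      ← Real.rpow_neg h0]
    norm_num
  rw [mul_pow, e, mul_pow, Real.sq_sqrt hL]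
  ring

/-- The sub-Gaussian bound on each side has failure probability δ². The spare factor δ leaves room,
after the union over t, for the failures of the other concentration inequalities. -/
theorem oracle_tail {Ω : Type*} [MeasurableSpace Ω] {μ : Measure Ω} [IsProbabilityMeasure μ]
    {T : ℕ} {M δ : ℝ} {ξ : ℕ → Ω → ℝ} (hξ : IsDemandNoise μ T M ξ) (hM : 0 < M) (hδ0 : 0 < δ)
    (hδ1 : δ < 1) (F₁ : ℝ) (F₂ : ℝ → ℝ) (α β : ℝ) {t : ℕ} (ht : t ∈ Finset.Icc 3 T) :
    μ.real {ω | accuracy 10 M δ T t < |totalDemand T (fun s => α + β * (s : ℝ) + ξ s ω) -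
      lsPrediction T F₁ F₂ (fun s => α + β * (s : ℝ) + ξ s ω) t|} ≤ 2 * δ ^ 2 := by
  have hL : 0 < Real.log (1 / δ) := Real.log_pos (by rw [lt_div_iff₀ hδ0]; linarith)
  have hT := Finset.mem_Icc.1 ht
  have ht' : (3 : ℝ) ≤ t := by exact_mod_cast hT.1
  have hT0 : (0 : ℝ) < T := by
    have : (t : ℝ) ≤ T := by exact_mod_cast hT.2
    linarith
  have hn0 : (0 : ℝ) < (t : ℝ) - 1 := by linarith
  set ε := accuracy 10 M δ T t with hε
  have hε0 : 0 ≤ ε := by rw [hε, accuracy]; positivity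
  have hε2 := accuracy_sq (M := M) (T := T) hL.le (by omega : 2 ≤ t)
  rw [← hε] at hε2
  set w : ℕ → ℝ := errorWeight T t
  have tail : ∀ σ : ℝ, |σ| = 1 → μ.real {ω | ε ≤ ∑ s : Finset.Icc 1 T, σ * w s * ξ s ω} ≤
      δ ^ 2 := by
    intro σ hσ
    have hind : iIndepFun (fun (s : Finset.Icc 1 T) ω => σ * w s * ξ s ω) μ :=
      hξ.indep.comp (fun s x => σ * w s * x) fun s => measurable_const_mul _
    have hsub : ∀ s ∈ (Finset.univ : Finset (Finset.Icc 1 T)),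
        HasSubgaussianMGF (fun ω => σ * w s * ξ s ω)
          ((‖|w s| * M - -(|w s| * M)‖₊ / 2) ^ 2) μ := by
      intro s _
      refine hasSubgaussianMGF_of_mem_Icc_of_integral_eq_zero
        ((hξ.measurable s s.2).const_mul _).aemeasurable ?_ ?_
      · filter_upwards [hξ.bounded s s.2] with ω hω
        have : |σ * w s * ξ s ω| ≤ |w s| * M := by
          rw [abs_mul, abs_mul, hσ, one_mul]
          gcongr
          exact abs_le.2 hω
        exact abs_le.1 this
      · rw [integral_const_mul, hξ.centered s s.2, mul_zero]
    refine (HasSubgaussianMGF.measure_sum_ge_le_of_iIndepFun hind hsub hε0).trans ?_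
    have hsum : ((∑ s : Finset.Icc 1 T, ((‖|w s| * M - -(|w s| * M)‖₊ / 2) ^ 2 : NNReal) : NNReal)
        : ℝ) = M ^ 2 * ∑ s ∈ Finset.Icc 1 T, w s ^ 2 := by
      rw [NNReal.coe_sum, Finset.mul_sum, ← Finset.sum_coe_sort (Finset.Icc 1 T)]
      refine Finset.sum_congr rfl fun s _ => ?_
      push_cast
      rw [Real.norm_eq_abs, show |w s| * M - -(|w s| * M) = 2 * (|w s| * M) by ring, abs_mul,
        abs_of_pos (two_pos), mul_div_cancel_left₀ _ two_ne_zero, sq_abs, mul_pow, sq_abs]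
      ring
    have hδ2 : δ ^ 2 = Real.exp (-(2 * Real.log (1 / δ))) := by
      rw [one_div, Real.log_inv, mul_neg, neg_neg, ← Real.log_rpow hδ0, Real.exp_log (by positivity)]
      norm_num
    rw [hδ2, hsum]
    refine Real.exp_le_exp.2 ?_
    have hw := sum_errorWeight_sq_le ht
    have hwpos : 0 < ∑ s ∈ Finset.Icc 1 T, w s ^ 2 := by
      refine Finset.sum_pos' (fun s _ => sq_nonneg _) ⟨t, Finset.mem_Icc.2 ⟨by omega, hT.2⟩, ?_⟩
      simp [w, errorWeight]
    rw [neg_div, neg_le_neg_iff, le_div_iff₀ (by positivity), hε2]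
    calc 2 * Real.log (1 / δ) * (2 * (M ^ 2 * ∑ s ∈ Finset.Icc 1 T, w s ^ 2))
        ≤ 2 * Real.log (1 / δ) * (2 * (M ^ 2 * (17 * (T : ℝ) ^ 4 / ((t : ℝ) - 1) ^ 3))) := by
          gcongr
      _ = 68 * M ^ 2 * T ^ 4 * Real.log (1 / δ) / ((t : ℝ) - 1) ^ 3 := by ring
      -- The constant C₀ = 10 is admissible because 2 · 2 · 17 = 68 ≤ 10².
      _ ≤ _ := by gcongr; norm_num
  have hsub : {ω | ε < |totalDemand T (fun s => α + β * (s : ℝ) + ξ s ω) -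
      lsPrediction T F₁ F₂ (fun s => α + β * (s : ℝ) + ξ s ω) t|} ⊆
      {ω | ε ≤ ∑ s : Finset.Icc 1 T, 1 * w s * ξ s ω} ∪
        {ω | ε ≤ ∑ s : Finset.Icc 1 T, -1 * w s * ξ s ω} := by
    intro ω hω
    rw [Set.mem_ofPred_eq, lsPrediction_error ht,
      ← Finset.sum_coe_sort (Finset.Icc 1 T)] at hω
    rcases lt_abs.1 hω with h | h
    · left
      rw [Set.mem_ofPred_eq]
      simp only [one_mul]
      exact h.le
    · right
      rw [Set.mem_ofPred_eq]
      simp only [neg_mul, one_mul, Finset.sum_neg_distrib]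
      exact h.le
  calc _ ≤ _ := measureReal_mono hsub
    _ ≤ _ := measureReal_union_le _ _
    _ ≤ δ ^ 2 + δ ^ 2 := add_le_add (tail 1 (by simp)) (tail (-1) (by simp))
    _ = _ := by ring

/-! ### The regret decomposition along one trajectory -/

section OptLP

variable {𝒜 : Type*} [Fintype 𝒜] {d : ℕ} {Q B : ℝ} {r : 𝒜 → ℝ} {c : 𝒜 → Fin d → ℝ} {a₀ : 𝒜}

/-- Nonnegativity of m covers an empty feasible set, whose real supremum is 0 by convention. -/
lemma optLP_le {m : ℝ} (hm : 0 ≤ m) (h : ∀ u ∈ stdSimplex ℝ 𝒜,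
    (∀ i, Q * ∑ a, c a i * u a ≤ B) → Q * ∑ a, r a * u a ≤ m) : optLP Q B r c ≤ m := by
  refine Real.sSup_le ?_ hm
  rintro v ⟨u, hu, hc, rfl⟩
  exact h u hu hc

lemma optLP_le_demand (hQ : 0 ≤ Q) (hr : ∀ a, r a ≤ 1) : optLP Q B r c ≤ Q := by
  refine optLP_le hQ fun u hu _ => ?_
  calc Q * ∑ a, r a * u a ≤ Q * ∑ a, 1 * u a := by
        gcongr with a
        · exact hu.1 a
        · exact hr a
    _ = Q := by simp [hu.2]

lemma optLP_nonneg (hQ : 0 ≤ Q) (hr : ∀ a, 0 ≤ r a) : 0 ≤ optLP Q B r c := by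
  refine Real.sSup_nonneg ?_
  rintro v ⟨u, hu, -, rfl⟩
  exact mul_nonneg hQ (Finset.sum_nonneg fun a _ => mul_nonneg (hr a) (hu.1 a))

end OptLP

/-! ### The stopping time, and the comparison of play with the linear program -/

namespace Trajectory

variable {𝒜 : Type*} {d : ℕ} (x : Trajectory 𝒜 d)

lemma stopTime_mem (T : ℕ) (B : ℝ) : x.stopTime T B ∈ ({t : ℕ | t ∈ Finset.Icc 1 T ∧
    ∃ j, B < ∑ s ∈ Finset.Icc 1 t, x.q s * x.cons s j} ∪ {T + 1} : Set ℕ) :=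
  Nat.sInf_mem ⟨T + 1, Or.inr rfl⟩

lemma one_le_stopTime (T : ℕ) (B : ℝ) : 1 ≤ x.stopTime T B := by
  rcases x.stopTime_mem T B with h | h
  · exact (Finset.mem_Icc.1 h.1).1
  · rw [Set.mem_singleton_iff.1 h]; omega

lemma stopTime_le (T : ℕ) (B : ℝ) : x.stopTime T B ≤ T + 1 := Nat.sInf_le (Or.inr rfl)

lemma mem_Icc_of_lt_stopTime {T : ℕ} {B : ℝ} {t : ℕ} (ht : t ∈ Finset.Ico 1 (x.stopTime T B)) :
    t ∈ Finset.Icc 1 T := by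
  have := x.stopTime_le T B
  rw [Finset.mem_Ico] at ht
  exact Finset.mem_Icc.2 ⟨ht.1, by omega⟩

/-- By minimality of τ, nothing is overdrawn at τ - 1. -/
lemma sum_cons_le {T : ℕ} {B : ℝ} (hB : 0 ≤ B) (j : Fin d) :
    ∑ s ∈ Finset.Ico 1 (x.stopTime T B), x.q s * x.cons s j ≤ B := by
  have h1 := x.one_le_stopTime T B
  rcases h1.eq_or_lt with h | h
  · rw [← h]; simpa
  · by_contra! hc
    have h2 := x.stopTime_le T B
    have hn : x.stopTime T B - 1 < x.stopTime T B := by omega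
    refine Nat.notMem_of_lt_sInf hn (Or.inl ⟨Finset.mem_Icc.2 ⟨by omega, by omega⟩, j, ?_⟩)
    rw [sum_Icc_eq_Ico]
    rwa [Nat.sub_add_cancel h1]

lemma grad_dot (B δ : ℝ) (t : ℕ) (m : Fin (d + 1) → ℝ) :
    ∑ j, x.grad B δ t j * m j = x.q t * (∑ j, betaVec d j * m j -
      x.pred t / B * ∑ j, m j * x.lcb δ t (x.act t) j) := by
  rw [mul_sub, Finset.mul_sum, Finset.mul_sum, Finset.mul_sum, ← Finset.sum_sub_distrib]
  exact Finset.sum_congr rfl fun j _ => by rw [grad]; ring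

lemma lcb_castSucc (δ : ℝ) (t : ℕ) (a : 𝒜) (i : Fin d) : x.lcb δ t a i.castSucc =
    max (x.meanCons t a i - rad (x.meanCons t a i) (x.pullsPlus t a) δ) 0 := by
  simp [lcb]

lemma lcb_last (δ : ℝ) (t : ℕ) (a : 𝒜) : x.lcb δ t a (Fin.last d) = 0 := by simp [lcb]

lemma lcb_nonneg (δ : ℝ) (t : ℕ) (a : 𝒜) (j : Fin (d + 1)) : 0 ≤ x.lcb δ t a j := by
  refine Fin.lastCases ?_ (fun i => ?_) j
  · rw [lcb_last]
  · rw [lcb_castSucc]; exact le_max_right _ _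

variable {x}

/-- The round-wise optimality of the chosen action against the linear program. -/
lemma optLP_le_round [Fintype 𝒜] {B δ Q e : ℝ} {t : ℕ} {r : 𝒜 → ℝ} {c : 𝒜 → Fin d → ℝ}
    (hB : 0 < B) (hQ : 0 < Q)
    (hmax : ∀ a, x.score B δ t a ≤ x.score B δ t (x.act t))
    (hr : ∀ a, 0 ≤ r a) {a₀ : 𝒜} (hc₀ : ∀ i, c a₀ i = 0)
    (hucb : ∀ a, r a ≤ x.ucb δ t a)
    (hlcb : ∀ a i, x.lcb δ t a (Fin.castSucc i) ≤ c a i)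
    (hpred : |Q - x.pred t| ≤ e) (hmu : (x.hedge B δ t).mu ∈ stdSimplex ℝ (Fin (d + 1))) :
    optLP Q B r c ≤ Q * (x.score B δ t (x.act t) + ∑ j, betaVec d j * (x.hedge B δ t).mu j + e / Q)
      := by
  classical
  set m := (x.hedge B δ t).mu
  have he : 0 ≤ e := (abs_nonneg _).trans hpred
  set b := ∑ j, betaVec d j * m j
  have hb1 : b ≤ 1 := by
    rw [← hmu.2]
    refine Finset.sum_le_sum fun j _ => ?_
    refine mul_le_of_le_one_left (hmu.1 j) ?_
    refine Fin.lastCases ?_ (fun i => ?_) j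
    · rw [betaVec_last]; exact zero_le_one
    · rw [sum_betaVec_castSucc]
  have main : ∀ u ∈ stdSimplex ℝ 𝒜, (∀ i, Q * ∑ a, c a i * u a ≤ B) →
      Q * ∑ a, r a * u a ≤ Q * (x.score B δ t (x.act t) + b + e / Q) := by
    intro u hu hc
    refine mul_le_mul_of_nonneg_left ?_ hQ.le
    have h1 : ∑ a, u a * x.score B δ t a ≤ x.score B δ t (x.act t) := by
      calc _ ≤ ∑ a, u a * x.score B δ t (x.act t) :=
            Finset.sum_le_sum fun a _ => mul_le_mul_of_nonneg_left (hmax a) (hu.1 a)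
        _ = _ := by rw [← Finset.sum_mul, hu.2, one_mul]
    set X := ∑ j, m j * ∑ a, u a * x.lcb δ t a j
    have h2 : ∑ a, u a * x.score B δ t a = ∑ a, u a * x.ucb δ t a - x.pred t / B * X := by
      have : X = ∑ a, u a * ∑ j, m j * x.lcb δ t a j := by
        simp only [X, Finset.mul_sum]
        rw [Finset.sum_comm]
        exact Finset.sum_congr rfl fun a _ => Finset.sum_congr rfl fun j _ => by ring
      rw [this, Finset.mul_sum, ← Finset.sum_sub_distrib]
      exact Finset.sum_congr rfl fun a _ => by rw [score]; ring
    have hX0 : 0 ≤ X := Finset.sum_nonneg fun j _ => mul_nonneg (hmu.1 j)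
      (Finset.sum_nonneg fun a _ => mul_nonneg (hu.1 a) (x.lcb_nonneg δ t a j))
    -- Feasibility of u and optimism of the lower bounds limit each priced resource to B/Q; the null
    -- resource contributes zero on both sides.
    have hX1 : X ≤ B / Q * b := by
      simp only [X, b]
      rw [Finset.mul_sum]
      refine Finset.sum_le_sum fun j _ => ?_
      rw [mul_comm (betaVec d j), mul_left_comm]
      refine mul_le_mul_of_nonneg_left ?_ (hmu.1 j)
      refine Fin.lastCases ?_ (fun i => ?_) j
      · simp [lcb_last, betaVec_last]
      · rw [sum_betaVec_castSucc, mul_one, le_div_iff₀ hQ]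
        refine le_trans ?_ (hc i)
        rw [mul_comm]
        refine mul_le_mul_of_nonneg_left (Finset.sum_le_sum fun a _ => ?_) hQ.le
        rw [mul_comm]
        exact mul_le_mul_of_nonneg_right (hlcb a i) (hu.1 a)
    have h3 : x.pred t / B * X ≤ b + e / Q := by
      have hp : x.pred t ≤ Q + e := by linarith [(abs_le.1 hpred).1]
      calc x.pred t / B * X ≤ (Q + e) / B * X := by gcongr
        _ ≤ (Q + e) / B * (B / Q * b) := by gcongr
        _ = b + e / Q * b := by field_simp
        _ ≤ b + e / Q := by
          have : e / Q * b ≤ e / Q * 1 := by gcongr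
          linarith
    have h4 : ∑ a, r a * u a ≤ ∑ a, u a * x.ucb δ t a := Finset.sum_le_sum fun a _ => by
      rw [mul_comm]; exact mul_le_mul_of_nonneg_left (hucb a) (hu.1 a)
    linarith
  refine optLP_le ?_ main
  -- The null action is feasible, which shows that the bound is nonnegative.
  refine le_trans ?_ (main (Pi.single a₀ 1) (single_mem_stdSimplex ℝ a₀) fun i => ?_)
  · exact mul_nonneg hQ.le (Finset.sum_nonneg fun a _ =>
      mul_nonneg (hr a) ((single_mem_stdSimplex ℝ a₀).1 a))
  · simp [Pi.single_apply, hc₀, hB.le]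

/-- Summing the round-wise comparison with weights q_t bounds (OPT/Q) · Σ q_t by the reward plus the
total price payment. The prices are then compared with a fixed mixture of resources that depends on
how the run ended. -/
theorem regret_le [Fintype 𝒜] {T : ℕ} {B δ qbar H U V : ℝ} {e : ℕ → ℝ} {a₀ : 𝒜} {r : 𝒜 → ℝ}
    {c : 𝒜 → Fin d → ℝ} (hfol : x.FollowsOAUCB T B δ a₀) (hB : 0 < B)
    (hQ : 0 < totalDemand T x.q) (hq : ∀ t ∈ Finset.Icc 1 T, x.q t ∈ Set.Icc 0 qbar)
    (hcons : ∀ t ∈ Finset.Icc 1 T, ∀ i, x.cons t i ≤ 1)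
    (hr : ∀ a, r a ∈ Set.Icc (0 : ℝ) 1) (hc₀ : ∀ i, c a₀ i = 0)
    (hucb : ∀ t ∈ Finset.Icc 1 T, ∀ a, r a ≤ x.ucb δ t a)
    (hlcb : ∀ t ∈ Finset.Icc 1 T, ∀ a i, x.lcb δ t a (Fin.castSucc i) ≤ c a i)
    (hpred : ∀ t ∈ Finset.Icc 1 T, |totalDemand T x.q - x.pred t| ≤ e t)
    (hlcb1 : ∀ t ∈ Finset.Icc 1 T, ∀ a j, x.lcb δ t a j ≤ 1)
    (hmu : ∀ t, 1 ≤ t → (x.hedge B δ t).mu ∈ stdSimplex ℝ (Fin (d + 1)))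
    (hH : ∀ j, ∑ t ∈ Finset.Ico 1 (x.stopTime T B), ∑ i, x.grad B δ t i * (x.hedge B δ t).mu i ≤
      ∑ t ∈ Finset.Ico 1 (x.stopTime T B), x.grad B δ t j + H)
    (hU : ∑ t ∈ Finset.Ico 1 (x.stopTime T B), x.q t * (x.ucb δ t (x.act t) - x.rew t) ≤ U)
    (hV : ∀ i, ∑ t ∈ Finset.Ico 1 (x.stopTime T B),
      x.q t * (x.cons t i - x.lcb δ t (x.act t) (Fin.castSucc i)) ≤ V) (hqV : 0 ≤ V + qbar) :
    optLP (totalDemand T x.q) B r c - x.reward T B ≤ U + H +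
      (1 / totalDemand T x.q + 1 / B) * ∑ t ∈ Finset.Ico 1 (x.stopTime T B), x.q t * e t +
      optLP (totalDemand T x.q) B r c / B * (V + qbar) := by
  set Q := totalDemand T x.q with hQdef
  set τ := x.stopTime T B with hτ
  set OPT := optLP Q B r c
  set I := Finset.Ico 1 τ with hI
  have hmem : ∀ t ∈ I, t ∈ Finset.Icc 1 T := fun t ht => x.mem_Icc_of_lt_stopTime ht
  have hO0 : 0 ≤ OPT := optLP_nonneg hQ.le fun a => (hr a).1
  have hO1 : OPT ≤ Q := optLP_le_demand hQ.le fun a => (hr a).2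
  set p := OPT / Q with hp
  have hp0 : 0 ≤ p := by positivity
  have hp1 : p ≤ 1 := by rw [hp, div_le_one hQ]; exact hO1
  have hpQ : p * Q = OPT := by rw [hp]; field_simp
  set E := ∑ t ∈ I, x.q t * e t with hE
  have he : ∀ t ∈ I, 0 ≤ e t := fun t ht => (abs_nonneg _).trans (hpred t (hmem t ht))
  have hE0 : 0 ≤ E := Finset.sum_nonneg fun t ht => mul_nonneg (hq t (hmem t ht)).1 (he t ht)
  have round : ∀ t ∈ I, x.q t * p - x.q t * e t / Q ≤ x.q t * x.ucb δ t (x.act t) +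
      ∑ j, x.grad B δ t j * (x.hedge B δ t).mu j := by
    intro t ht
    have ht' := hmem t ht
    have h := optLP_le_round (a₀ := a₀) hB hQ
      ((hfol t ht').1 (Finset.mem_Ico.1 ht).2.le)
      (fun a => (hr a).1) hc₀ (hucb t ht') (hlcb t ht') (hpred t ht')
      (hmu t (Finset.mem_Ico.1 ht).1)
    have h2 : p ≤ x.score B δ t (x.act t) + ∑ j, betaVec d j * (x.hedge B δ t).mu j + e t / Q := by
      rw [hp, div_le_iff₀ hQ, mul_comm]; exact h
    rw [grad_dot]
    rw [score] at h2
    have h3 := mul_le_mul_of_nonneg_left h2 (hq t ht').1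
    have h4 : x.q t * e t / Q = x.q t * (e t / Q) := by ring
    rw [h4]
    linarith
  have tot : p * ∑ t ∈ I, x.q t - E / Q ≤ ∑ t ∈ I, x.q t * x.ucb δ t (x.act t) +
      ∑ t ∈ I, ∑ j, x.grad B δ t j * (x.hedge B δ t).mu j := by
    rw [← Finset.sum_add_distrib, hE, Finset.sum_div, Finset.mul_sum, ← Finset.sum_sub_distrib]
    refine Finset.sum_le_sum fun t ht => ?_
    have := round t ht
    rw [mul_comm p]
    exact this
  have hrew : ∑ t ∈ I, x.q t * x.ucb δ t (x.act t) ≤ x.reward T B + U := by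
    have : ∑ t ∈ I, x.q t * (x.ucb δ t (x.act t) - x.rew t) =
        ∑ t ∈ I, x.q t * x.ucb δ t (x.act t) - x.reward T B := by
      rw [reward, ← Finset.sum_sub_distrib]
      exact Finset.sum_congr rfl fun t _ => by ring
    linarith
  have hlast : ∑ t ∈ I, ∑ j, x.grad B δ t j * (x.hedge B δ t).mu j ≤ H := by
    refine (hH (Fin.last d)).trans (le_of_eq ?_)
    have : ∀ t, x.grad B δ t (Fin.last d) = 0 := fun t => by
      rw [grad, betaVec_last, lcb_last]; ring
    simp [this]
  have hEB : 0 ≤ E / B := by positivity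
  have hOB : 0 ≤ OPT / B * (V + qbar) := by positivity
  have split : (1 / Q + 1 / B) * E = E / Q + E / B := by ring
  rw [split]
  rcases x.stopTime_mem T B with ⟨hτT, j, hj⟩ | hτT
  · rw [← hτ] at hj hτT
    have hτ1 := (Finset.mem_Icc.1 hτT).1
    -- Round τ itself consumes at most q̄, so all but q̄ of the budget was spent before it.
    have hj' : B - qbar ≤ ∑ t ∈ I, x.q t * x.cons t j := by
      rw [sum_Icc_eq_Ico, Finset.sum_Ico_succ_top hτ1] at hj
      have : x.q τ * x.cons τ j ≤ x.q τ := mul_le_of_le_one_right (hq τ hτT).1 (hcons τ hτT j)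
      linarith [(hq τ hτT).2]
    have hl : B - qbar - V ≤ ∑ t ∈ I, x.q t * x.lcb δ t (x.act t) (Fin.castSucc j) := by
      have h := hV j
      have : ∑ t ∈ I, x.q t * (x.cons t j - x.lcb δ t (x.act t) (Fin.castSucc j)) =
          ∑ t ∈ I, x.q t * x.cons t j -
            ∑ t ∈ I, x.q t * x.lcb δ t (x.act t) (Fin.castSucc j) := by
        rw [← Finset.sum_sub_distrib]
        exact Finset.sum_congr rfl fun t _ => by ring
      linarith
    have hg : ∑ t ∈ I, x.grad B δ t (Fin.castSucc j) ≤
        ∑ t ∈ I, x.q t - Q / B * (B - qbar - V) + E / B := by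
      have h1 : ∑ t ∈ I, x.grad B δ t (Fin.castSucc j) ≤ ∑ t ∈ I, (x.q t -
          Q / B * (x.q t * x.lcb δ t (x.act t) (Fin.castSucc j)) + x.q t * e t / B) := by
        refine Finset.sum_le_sum fun t ht => ?_
        have ht' := hmem t ht
        have h2 : Q - x.pred t ≤ e t := (abs_le.1 (hpred t ht')).2
        have h3 := x.lcb_nonneg δ t (x.act t) (Fin.castSucc j)
        have h4 := hlcb1 t ht' (x.act t) (Fin.castSucc j)
        rw [grad, sum_betaVec_castSucc]
        set l := x.lcb δ t (x.act t) (Fin.castSucc j)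
        have h5 : (Q - x.pred t) * l ≤ e t := by
          calc _ ≤ e t * l := by gcongr
            _ ≤ e t * 1 := mul_le_mul_of_nonneg_left h4 (he t ht)
            _ = e t := mul_one _
        have h6 : x.q t / B * ((Q - x.pred t) * l) ≤ x.q t / B * e t := by
          refine mul_le_mul_of_nonneg_left h5 (div_nonneg (hq t ht').1 hB.le)
        have e1 : x.q t * (1 - x.pred t / B * l) =
            x.q t - Q / B * (x.q t * l) + x.q t / B * ((Q - x.pred t) * l) := by ring
        have e2 : x.q t * e t / B = x.q t / B * e t := by ring
        rw [e1, e2]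
        linarith
      refine h1.trans ?_
      rw [Finset.sum_add_distrib, Finset.sum_sub_distrib, ← Finset.mul_sum, ← Finset.sum_div]
      have : Q / B * (B - qbar - V) ≤
          Q / B * ∑ t ∈ I, x.q t * x.lcb δ t (x.act t) (Fin.castSucc j) := by gcongr
      linarith
    have hjj := (hH (Fin.castSucc j)).trans (add_le_add_left hg H)
    -- The comparator puts mass p = OPT/Q on the overdrawn resource and 1 - p on the null one, so
    -- that p · Σ q_t cancels in `tot` and p · Q leaves OPT.
    have comb : ∑ t ∈ I, ∑ j, x.grad B δ t j * (x.hedge B δ t).mu j ≤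
        p * (∑ t ∈ I, x.q t - Q / B * (B - qbar - V) + E / B) + H := by
      have a1 := mul_le_mul_of_nonneg_left hjj hp0
      have a2 := mul_le_mul_of_nonneg_left hlast (sub_nonneg.2 hp1)
      linarith
    have e3 : p * (Q / B * (B - qbar - V)) = OPT - OPT / B * (V + qbar) := by
      rw [← hpQ]; field_simp; ring
    have e4 : p * (E / B) ≤ E / B := mul_le_of_le_one_left hEB hp1
    linarith
  · have hτT' : τ = T + 1 := hτT
    have hsum : ∑ t ∈ I, x.q t = Q := by rw [hI, hτT', hQdef, totalDemand, sum_Icc_eq_Ico]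
    rw [hsum, hpQ] at tot
    linarith

end Trajectory

/-! ### Confidence radii -/

/-- Completing the square in a = √(2vy) moves the unknown mean v out of the radius, which the
algorithm must compute from the sample mean w. -/
lemma le_add_sqrt_of_le {v w y : ℝ} (hy : 0 ≤ y) (hv : 0 ≤ v)
    (h : v ≤ w + Real.sqrt (2 * v * y)) : v ≤ w + (Real.sqrt (2 * w * y) + 4 * y) := by
  set a := Real.sqrt (2 * v * y)
  have ha : a ^ 2 = 2 * v * y := Real.sq_sqrt (by positivity)
  have h1 : (a - y) ^ 2 ≤ 2 * w * y + y ^ 2 := by nlinarith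
  have h2 : a - y ≤ Real.sqrt (2 * w * y) + y := by
    refine (Real.le_sqrt_of_sq_le h1).trans ?_
    refine Real.sqrt_le_iff.2 ⟨by positivity, ?_⟩
    have h3 := Real.sqrt_nonneg (2 * w * y)
    have h4 : 2 * w * y ≤ Real.sqrt (2 * w * y) ^ 2 := by
      rcases le_total 0 (2 * w * y) with h | h
      · rw [Real.sq_sqrt h]
      · exact h.trans (sq_nonneg _)
    nlinarith
  linarith

lemma sub_le_of_le_add_sqrt {v w y : ℝ} (hy : 0 ≤ y)
    (h : w ≤ v + Real.sqrt (2 * v * y) + 2 * y) : w - (Real.sqrt (2 * w * y) + 4 * y) ≤ v := by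
  rcases le_total w v with hwv | hwv
  · have := Real.sqrt_nonneg (2 * w * y)
    linarith
  · have : Real.sqrt (2 * v * y) ≤ Real.sqrt (2 * w * y) := Real.sqrt_le_sqrt (by gcongr)
    linarith

/-- The converse exchange: the empirical radius is controlled by the true mean, as needed to sum the
widths. -/
lemma sqrt_le_of_le {v w y : ℝ} (hy : 0 ≤ y) (hv : 0 ≤ v)
    (h : w ≤ v + 2 * Real.sqrt (v * y) + 4 * y) :
    Real.sqrt (2 * w * y) ≤ 2 * Real.sqrt (v * y) + 4 * y := by
  set p := Real.sqrt (v * y)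
  have hp : p ^ 2 = v * y := Real.sq_sqrt (by positivity)
  have hp0 : 0 ≤ p := Real.sqrt_nonneg _
  refine Real.sqrt_le_iff.2 ⟨by positivity, ?_⟩
  nlinarith [mul_le_mul_of_nonneg_right h hy, mul_nonneg hp0 hy, sq_nonneg y]

lemma sqrt_two_mul_le {v y : ℝ} (hy : 0 ≤ y) (hv : 0 ≤ v) :
    Real.sqrt (2 * v * y) ≤ 2 * Real.sqrt (v * y) := by
  refine Real.sqrt_le_iff.2 ⟨by positivity, ?_⟩
  rw [mul_pow, Real.sq_sqrt (by positivity)]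
  nlinarith [mul_nonneg hv hy]

lemma sqrt_div_self {n v ℓ : ℝ} (hn : 0 < n) :
    Real.sqrt (2 * (n * v) * ℓ) / n = Real.sqrt (2 * v * (ℓ / n)) := by
  rw [show 2 * v * (ℓ / n) = 2 * (n * v) * ℓ / n ^ 2 by field_simp, Real.sqrt_div' _ (by positivity),
    Real.sqrt_sq hn.le]

lemma sqrt_double {v y : ℝ} : Real.sqrt (2 * v * (2 * y)) = 2 * Real.sqrt (v * y) := by
  rw [show 2 * v * (2 * y) = 2 ^ 2 * (v * y) by ring, Real.sqrt_mul (by positivity),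
    Real.sqrt_sq (by positivity)]

/-! ### The concentration event and its consequences for the confidence bounds -/

namespace Trajectory

variable {𝒜 : Type*} {d : ℕ} (x : Trajectory 𝒜 d)

/-- The outcomes of a round: the reward and the consumptions. -/
def out : Option (Fin d) → ℕ → ℝ
  | none, t => x.rew t
  | some i, t => x.cons t i

open Classical in
/-- Number of pulls of `a` in rounds `1, …, t - 1`. -/
def pulls (t : ℕ) (a : 𝒜) : ℕ := ((Finset.Ico 1 t).filter fun s => x.act s = a).card

open Classical in
/-- Sum of the outcomes of `a` in rounds `1, …, t - 1`. -/
def outSum (k : Option (Fin d)) (t : ℕ) (a : 𝒜) : ℝ :=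
  ∑ s ∈ Finset.Ico 1 t, if x.act s = a then x.out k s else 0

lemma pullsPlus_eq (t : ℕ) (a : 𝒜) : x.pullsPlus t a = max (x.pulls t a) 1 := rfl

lemma meanRew_eq (t : ℕ) (a : 𝒜) :
    x.meanRew t a = x.outSum none t a / (x.pullsPlus t a : ℝ) := by
  rw [meanRew, outSum, one_div, div_eq_inv_mul]; rfl

lemma meanCons_eq (t : ℕ) (a : 𝒜) (i : Fin d) :
    x.meanCons t a i = x.outSum (some i) t a / (x.pullsPlus t a : ℝ) := by
  rw [meanCons, outSum, one_div, div_eq_inv_mul]; rfl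

lemma outSum_eq_zero {t : ℕ} {a : 𝒜} (h : x.pulls t a = 0) (k : Option (Fin d)) :
    x.outSum k t a = 0 := by
  classical
  refine Finset.sum_eq_zero fun s hs => if_neg fun hsa => ?_
  have : s ∈ (Finset.Ico 1 t).filter fun s => x.act s = a := Finset.mem_filter.2 ⟨hs, hsa⟩
  exact absurd h (Finset.card_pos.2 ⟨s, by convert this⟩).ne'

/-- The concentration inequalities used in the analysis: `m k a` is the mean outcome of `a` in
coordinate `k`. -/
structure IsConcentrated (T : ℕ) (qbar L : ℝ) (m : Option (Fin d) → 𝒜 → ℝ) : Prop where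
  demand : ∀ t ∈ Finset.Icc 1 T, x.q t ∈ Set.Ioc 0 qbar
  out_mem : ∀ k, ∀ t ∈ Finset.Icc 1 T, x.out k t ∈ Set.Icc (0 : ℝ) 1
  rew_lower : ∀ t ∈ Finset.Icc 1 T, ∀ a, (x.pulls t a : ℝ) * m none a ≤
    x.outSum none t a + Real.sqrt (2 * (x.pulls t a * m none a) * L)
  rew_upper : ∀ t ∈ Finset.Icc 1 T, ∀ a, x.outSum none t a ≤ x.pulls t a * m none a +
    Real.sqrt (2 * (x.pulls t a * m none a) * (2 * L)) + 2 * (2 * L)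
  cons_lower : ∀ t ∈ Finset.Icc 1 T, ∀ a i, (x.pulls t a : ℝ) * m (some i) a ≤
    x.outSum (some i) t a + Real.sqrt (2 * (x.pulls t a * m (some i) a) * (2 * L))
  cons_upper : ∀ t ∈ Finset.Icc 1 T, ∀ a i, x.outSum (some i) t a ≤ x.pulls t a * m (some i) a +
    Real.sqrt (2 * (x.pulls t a * m (some i) a) * L) + 2 * L
  weighted : ∀ k, ∀ n ≤ T, |∑ s ∈ Finset.Ico 1 (n + 1), x.q s * (x.out k s - m k (x.act s))| ≤
    qbar * (2 * Real.sqrt (n * (2 * L)))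

namespace IsConcentrated

variable {x} {T : ℕ} {qbar δ L : ℝ} {m : Option (Fin d) → 𝒜 → ℝ}

lemma reward_bounds (h : x.IsConcentrated T qbar L m) (hLδ : L = Real.log (1 / δ)) (hL : 1 ≤ L)
    (hm : ∀ k a, m k a ∈ Set.Icc (0 : ℝ) 1) {t : ℕ} (ht : t ∈ Finset.Icc 1 T) (a : 𝒜) :
    m none a ≤ x.ucb δ t a ∧ x.ucb δ t a ≤ m none a +
      (4 * Real.sqrt (m none a * (L / x.pullsPlus t a)) + 12 * (L / x.pullsPlus t a)) := by
  obtain ⟨h0, h1⟩ := hm none a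
  have hN : (0 : ℝ) < x.pullsPlus t a := by rw [pullsPlus_eq]; positivity
  set y := L / (x.pullsPlus t a : ℝ) with hy
  have hy0 : 0 ≤ y := by positivity
  have hrad : rad (x.meanRew t a) (x.pullsPlus t a) δ =
      Real.sqrt (2 * x.meanRew t a * y) + 4 * y := by
    rw [rad, ← hLδ, hy]; ring_nf
  -- An arm never pulled has sample mean 0 and radius 4L ≥ 1, so its upper bound is clipped to 1.
  rcases Nat.eq_zero_or_pos (x.pulls t a) with hn | hn
  · have hN1 : (x.pullsPlus t a : ℝ) = 1 := by rw [pullsPlus_eq, hn]; simp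
    have hyL : y = L := by rw [hy, hN1, div_one]
    have hmean : x.meanRew t a = 0 := by rw [meanRew_eq, x.outSum_eq_zero hn]; simp
    have e : x.ucb δ t a = 1 := by
      rw [ucb, hrad, hmean]
      refine min_eq_right ?_
      have := Real.sqrt_nonneg (2 * 0 * y)
      linarith
    rw [e]
    have := Real.sqrt_nonneg (m none a * y)
    exact ⟨h1, by linarith⟩
  · have hNn : (x.pullsPlus t a : ℝ) = x.pulls t a := by
      rw [pullsPlus_eq, max_eq_left hn]
    have hn0 : (0 : ℝ) < x.pulls t a := by exact_mod_cast hn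
    have lo : m none a ≤ x.meanRew t a + Real.sqrt (2 * m none a * y) := by
      rw [meanRew_eq, hy, hNn, ← sqrt_div_self hn0, ← add_div, le_div_iff₀ hn0, mul_comm]
      exact h.rew_lower t ht a
    have up : x.meanRew t a ≤ m none a + 2 * Real.sqrt (m none a * y) + 4 * y := by
      have e1 : 2 * Real.sqrt (m none a * y) = Real.sqrt (2 * m none a * (2 * L / x.pulls t a)) := by
        rw [← sqrt_double, hy, hNn]; congr 2; ring
      rw [e1, ← sqrt_div_self hn0, meanRew_eq, hy, hNn, div_le_iff₀ hn0]
      refine (h.rew_upper t ht a).trans (le_of_eq ?_)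
      field_simp
      ring
    have sq := sqrt_le_of_le hy0 h0 up
    rw [ucb, hrad]
    refine ⟨le_min (le_add_sqrt_of_le hy0 h0 lo) h1, (min_le_left _ _).trans ?_⟩
    linarith

lemma cons_bounds (h : x.IsConcentrated T qbar L m) (hLδ : L = Real.log (1 / δ)) (hL : 1 ≤ L)
    (hm : ∀ k a, m k a ∈ Set.Icc (0 : ℝ) 1) {t : ℕ} (ht : t ∈ Finset.Icc 1 T) (a : 𝒜) (i : Fin d) :
    x.lcb δ t a i.castSucc ≤ m (some i) a ∧ m (some i) a ≤ x.lcb δ t a i.castSucc +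
      (4 * Real.sqrt (m (some i) a * (L / x.pullsPlus t a)) + 12 * (L / x.pullsPlus t a)) := by
  obtain ⟨h0, h1⟩ := hm (some i) a
  have hN : (0 : ℝ) < x.pullsPlus t a := by rw [pullsPlus_eq]; positivity
  set y := L / (x.pullsPlus t a : ℝ) with hy
  have hy0 : 0 ≤ y := by positivity
  set v := m (some i) a
  have hrad : rad (x.meanCons t a i) (x.pullsPlus t a) δ =
      Real.sqrt (2 * x.meanCons t a i * y) + 4 * y := by
    rw [rad, ← hLδ, hy]; ring_nf
  have hs := Real.sqrt_nonneg (v * y)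
  rcases Nat.eq_zero_or_pos (x.pulls t a) with hn | hn
  · have hN1 : (x.pullsPlus t a : ℝ) = 1 := by rw [pullsPlus_eq, hn]; simp
    have hyL : y = L := by rw [hy, hN1, div_one]
    have hmean : x.meanCons t a i = 0 := by rw [meanCons_eq, x.outSum_eq_zero hn]; simp
    have e : x.lcb δ t a i.castSucc = 0 := by
      rw [lcb_castSucc, hrad, hmean]
      refine max_eq_right ?_
      have := Real.sqrt_nonneg (2 * 0 * y)
      linarith
    rw [e]
    exact ⟨h0, by linarith⟩
  · have hNn : (x.pullsPlus t a : ℝ) = x.pulls t a := by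
      rw [pullsPlus_eq, max_eq_left hn]
    have hn0 : (0 : ℝ) < x.pulls t a := by exact_mod_cast hn
    have up : x.meanCons t a i ≤ v + Real.sqrt (2 * v * y) + 2 * y := by
      rw [meanCons_eq, hy, hNn, ← sqrt_div_self hn0, div_le_iff₀ hn0]
      refine (h.cons_upper t ht a i).trans (le_of_eq ?_)
      simp only [v]
      field_simp
    have lo : v ≤ x.meanCons t a i + 2 * Real.sqrt (v * y) := by
      have e1 : 2 * Real.sqrt (v * y) = Real.sqrt (2 * v * (2 * L / x.pulls t a)) := by
        rw [← sqrt_double, hy, hNn]; congr 2; ring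
      rw [e1, ← sqrt_div_self hn0, meanCons_eq, hNn, ← add_div, le_div_iff₀ hn0, mul_comm]
      exact h.cons_lower t ht a i
    have h2 := sqrt_two_mul_le hy0 h0
    have sq := sqrt_le_of_le hy0 h0 (show x.meanCons t a i ≤ _ by linarith)
    rw [lcb_castSucc, hrad]
    refine ⟨max_le (sub_le_of_le_add_sqrt hy0 up) h0, ?_⟩
    have := le_max_left (x.meanCons t a i -
      (Real.sqrt (2 * x.meanCons t a i * y) + 4 * y)) 0
    linarith

end IsConcentrated

/-! ### Sums of confidence widths -/

/-- The pull preceded by k others contributes 1 / max(k, 1) ≤ 2 / (k + 1). -/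
lemma sum_inv_pulls_le (a : 𝒜) [DecidableEq 𝒜] (n : ℕ) :
    ∑ t ∈ Finset.Ico 1 (n + 1), (if x.act t = a then 1 / (x.pullsPlus t a : ℝ) else 0) ≤
      2 * (harmonic (x.pulls (n + 1) a) : ℝ) := by
  induction n with
  | zero => simp [pulls]
  | succ n ih =>
    rw [Finset.sum_Ico_succ_top (by omega)]
    have hp : x.pulls (n + 1 + 1) a = x.pulls (n + 1) a + if x.act (n + 1) = a then 1 else 0 := by
      classical
      have := Finset.sum_Ico_succ_top (show 1 ≤ n + 1 by omega)
        (fun s => if x.act s = a then 1 else 0)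
      rw [pulls, pulls, Finset.card_filter, Finset.card_filter]
      convert this
    split_ifs with ha
    · rw [hp, if_pos ha, harmonic_succ, pullsPlus_eq]
      push_cast
      have : 1 / max (x.pulls (n + 1) a : ℝ) 1 ≤ 2 * ((x.pulls (n + 1) a : ℝ) + 1)⁻¹ := by
        rw [← div_eq_mul_inv, div_le_div_iff₀ (by positivity) (by positivity)]
        have h1 := le_max_left (x.pulls (n + 1) a : ℝ) 1
        have h2 := le_max_right (x.pulls (n + 1) a : ℝ) 1
        linarith
      linarith
    · rw [hp, if_neg ha]
      simpa using ih

lemma sum_inv_pullsPlus_le [Fintype 𝒜] {n T : ℕ} (hT : 1 ≤ T) (hn : n ≤ T) :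
    ∑ t ∈ Finset.Ico 1 (n + 1), 1 / (x.pullsPlus t (x.act t) : ℝ) ≤
      2 * Fintype.card 𝒜 * (1 + Real.log T) := by
  classical
  have hT' : (1 : ℝ) ≤ T := by exact_mod_cast hT
  calc _ = ∑ a, ∑ t ∈ Finset.Ico 1 (n + 1),
        (if x.act t = a then 1 / (x.pullsPlus t a : ℝ) else 0) := by
        rw [Finset.sum_comm]
        exact Finset.sum_congr rfl fun t _ => by simp
    _ ≤ ∑ _a : 𝒜, 2 * (1 + Real.log T) := by
        refine Finset.sum_le_sum fun a _ => (x.sum_inv_pulls_le a n).trans ?_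
        gcongr
        have hc : x.pulls (n + 1) a ≤ T := by
          refine (Finset.card_filter_le _ _).trans ?_
          simpa using hn
        refine (harmonic_le_one_add_log _).trans ?_
        rcases Nat.eq_zero_or_pos (x.pulls (n + 1) a) with h0 | h0
        · rw [h0]; simp [Real.log_nonneg hT']
        · gcongr
    _ = _ := by rw [Finset.sum_const, Finset.card_univ, nsmul_eq_mul]; ring

/-- Cauchy-Schwarz splits the square-root widths into the total mean outcome Y and a sum of inverse
pull counts. Keeping Y instead of bounding it by the total demand is what brings OPT and B into the
regret bound. -/
lemma sum_width_le [Fintype 𝒜] {n T : ℕ} {qbar L Y : ℝ} {v : 𝒜 → ℝ} (hT : 1 ≤ T) (hn : n ≤ T)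
    (hq : ∀ t ∈ Finset.Icc 1 T, x.q t ∈ Set.Ioc 0 qbar) (hL : 0 ≤ L) (hv : ∀ a, 0 ≤ v a)
    (hqb : 0 ≤ qbar)
    (hY : ∑ t ∈ Finset.Ico 1 (n + 1), x.q t * v (x.act t) ≤ Y) :
    ∑ t ∈ Finset.Ico 1 (n + 1), x.q t * (4 * Real.sqrt (v (x.act t) *
      (L / x.pullsPlus t (x.act t))) + 12 * (L / x.pullsPlus t (x.act t))) ≤
      4 * Real.sqrt (Y * (2 * qbar * Fintype.card 𝒜 * L * (1 + Real.log T))) +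
        12 * (2 * qbar * Fintype.card 𝒜 * L * (1 + Real.log T)) := by
  have hq' : ∀ t ∈ Finset.Ico 1 (n + 1), x.q t ∈ Set.Ioc 0 qbar := fun t ht => by
    rw [Finset.mem_Ico] at ht; exact hq t (Finset.mem_Icc.2 ⟨ht.1, by omega⟩)
  set E := 2 * qbar * Fintype.card 𝒜 * L * (1 + Real.log T)
  -- The truncation at 0 is inactive in the range of summation; Cauchy-Schwarz is applied in a form
  -- that asks for nonnegativity at every index.
  set f : ℕ → ℝ := fun t => max (x.q t) 0 * v (x.act t)
  set g : ℕ → ℝ := fun t => max (x.q t) 0 * (L / x.pullsPlus t (x.act t))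
  have hf0 : ∀ t, 0 ≤ f t := fun t => mul_nonneg (le_max_right _ _) (hv _)
  have hg0 : ∀ t, 0 ≤ g t := fun t => mul_nonneg (le_max_right _ _) (by positivity)
  have hg : ∑ t ∈ Finset.Ico 1 (n + 1), g t ≤ E := by
    calc _ ≤ ∑ t ∈ Finset.Ico 1 (n + 1), qbar * L * (1 / (x.pullsPlus t (x.act t) : ℝ)) := by
          refine Finset.sum_le_sum fun t ht => ?_
          simp only [g]
          rw [max_eq_left (hq' t ht).1.le, mul_assoc, mul_one_div]
          gcongr
          exact (hq' t ht).2
      _ ≤ qbar * L * (2 * Fintype.card 𝒜 * (1 + Real.log T)) := by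
          rw [← Finset.mul_sum]
          exact mul_le_mul_of_nonneg_left (x.sum_inv_pullsPlus_le hT hn) (by positivity)
      _ = E := by simp only [E]; ring
  have hfY : ∑ t ∈ Finset.Ico 1 (n + 1), f t ≤ Y := by
    refine le_trans (le_of_eq (Finset.sum_congr rfl fun t ht => ?_)) hY
    simp only [f]
    rw [max_eq_left (hq' t ht).1.le]
  have hcs := Real.sum_sqrt_mul_sqrt_le (Finset.Ico 1 (n + 1)) hf0 hg0
  have key : ∑ t ∈ Finset.Ico 1 (n + 1), x.q t * (4 * Real.sqrt (v (x.act t) *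
      (L / x.pullsPlus t (x.act t))) + 12 * (L / x.pullsPlus t (x.act t))) =
      4 * ∑ t ∈ Finset.Ico 1 (n + 1), Real.sqrt (f t) * Real.sqrt (g t) +
        12 * ∑ t ∈ Finset.Ico 1 (n + 1), g t := by
    rw [Finset.mul_sum, Finset.mul_sum, ← Finset.sum_add_distrib]
    refine Finset.sum_congr rfl fun t ht => ?_
    have hqt := (hq' t ht).1
    rw [← Real.sqrt_mul (hf0 t)]
    simp only [f, g]
    rw [max_eq_left hqt.le, show x.q t * v (x.act t) * (x.q t * (L / x.pullsPlus t (x.act t))) =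
      x.q t ^ 2 * (v (x.act t) * (L / x.pullsPlus t (x.act t))) by ring,
      Real.sqrt_mul (sq_nonneg (x.q t)), Real.sqrt_sq hqt.le]
    ring
  rw [key]
  have h1 : Real.sqrt (∑ t ∈ Finset.Ico 1 (n + 1), f t) *
      Real.sqrt (∑ t ∈ Finset.Ico 1 (n + 1), g t) ≤ Real.sqrt (Y * E) := by
    rw [← Real.sqrt_mul (Finset.sum_nonneg fun t _ => hf0 t)]
    refine Real.sqrt_le_sqrt ?_
    exact mul_le_mul hfY hg (Finset.sum_nonneg fun t _ => hg0 t)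
      ((Finset.sum_nonneg fun t _ => hf0 t).trans hfY)
  linarith

/-! ### The AdaHedge part -/

lemma isHedgeRun (B δ : ℝ) : IsHedgeRun (x.hedge B δ) (x.grad B δ) where
  one := by simp [hedge]
  succ t ht := by rw [hedge, if_neg (by omega)]

lemma lcb_one {δ : ℝ} (hδ : 0 ≤ Real.log (1 / δ)) (a : 𝒜) (j : Fin (d + 1)) :
    x.lcb δ 1 a j = 0 := by
  refine Fin.lastCases (x.lcb_last δ 1 a) (fun i => ?_) j
  rw [lcb_castSucc]
  refine max_eq_right ?_
  have : x.meanCons 1 a i = 0 := by simp [meanCons]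
  rw [this, rad, zero_sub, neg_nonpos]
  positivity

/-- In round 1 all lower bounds are 0, so the gradient is q₁ (1, …, 1, 0); its uniform average
exceeds its minimum strictly. -/
lemma hedgeRho_one_pos {B δ : ℝ} (hd : 1 ≤ d) (hδ : 0 ≤ Real.log (1 / δ)) (hq : 0 < x.q 1) :
    0 < hedgeRho 1 (x.hedge B δ 1) (x.grad B δ 1) := by
  have hg : ∀ j, x.grad B δ 1 j = x.q 1 * betaVec d j := fun j => by
    rw [grad, x.lcb_one hδ]; ring
  rw [hedgeRho, if_pos rfl, sub_pos, (x.isHedgeRun B δ).one]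
  have h1 : Finset.univ.inf' Finset.univ_nonempty (x.grad B δ 1) ≤ 0 := by
    refine (Finset.inf'_le _ (Finset.mem_univ (Fin.last d))).trans ?_
    rw [hg, betaVec_last, mul_zero]
  refine h1.trans_lt ?_
  have hd0 : (0 : ℝ) < (d : ℝ) + 1 := by positivity
  rw [Fin.sum_univ_castSucc]
  simp only [hg, sum_betaVec_castSucc, betaVec_last, mul_one, mul_zero, zero_mul, add_zero,
    Finset.sum_const, Finset.card_univ, Fintype.card_fin, nsmul_eq_mul]
  have : (0 : ℝ) < d := by exact_mod_cast hd
  positivity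

lemma hedge_regret_le {T : ℕ} {B δ qbar Z : ℝ} (hd : 1 ≤ d) (hδ : 0 ≤ Real.log (1 / δ))
    (hB : 0 < B) (hT : 1 ≤ T) (hqb : 0 ≤ qbar)
    (hq : ∀ t ∈ Finset.Icc 1 T, x.q t ∈ Set.Ioc 0 qbar)
    (hlcb1 : ∀ t ∈ Finset.Icc 1 T, ∀ a j, x.lcb δ t a j ≤ 1) (hZ : 0 ≤ Z)
    (hpred : ∀ t ∈ Finset.Icc 1 T, 1 + 2 * (|x.pred t| / B) ≤ Z) {n : ℕ} (hn : n ≤ T)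
    (j : Fin (d + 1)) :
    ∑ t ∈ Finset.Ico 1 (n + 1), ∑ i, x.grad B δ t i * (x.hedge B δ t).mu i ≤
      ∑ t ∈ Finset.Ico 1 (n + 1), x.grad B δ t j +
        6 * Real.log ((d : ℝ) + 1) * (Z * (qbar * Real.sqrt n)) := by
  have hrun := x.isHedgeRun B δ
  have hpos : 0 < hedgeRho 1 (x.hedge B δ 1) (x.grad B δ 1) :=
    x.hedgeRho_one_pos hd hδ (hq 1 (Finset.mem_Icc.2 ⟨le_rfl, hT⟩)).1
  have hD : 0 ≤ Real.log ((d : ℝ) + 1) := Real.log_nonneg (by simp)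
  have hrange : ∀ t ∈ Finset.Ico 1 (n + 1), ∀ i j, x.grad B δ t i - x.grad B δ t j ≤ qbar * Z := by
    intro t ht i j
    have ht' : t ∈ Finset.Icc 1 T := by
      rw [Finset.mem_Ico] at ht; exact Finset.mem_Icc.2 ⟨ht.1, by omega⟩
    have hb : ∀ j, 0 ≤ betaVec d j ∧ betaVec d j ≤ 1 := fun j => by
      refine Fin.lastCases ?_ (fun i => ?_) j
      · simp [betaVec_last]
      · simp [sum_betaVec_castSucc]
    have hl : ∀ j, |x.pred t / B * x.lcb δ t (x.act t) j| ≤ |x.pred t| / B := fun j => by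
      rw [abs_mul, abs_div, abs_of_pos hB, abs_of_nonneg (x.lcb_nonneg δ t _ j)]
      exact mul_le_of_le_one_right (by positivity) (hlcb1 t ht' _ j)
    have h1 := (abs_le.1 (hl i)).1
    have h2 := (abs_le.1 (hl j)).2
    have h3 := (hb i).2
    have h4 := (hb j).1
    calc x.grad B δ t i - x.grad B δ t j = x.q t * ((betaVec d i -
          x.pred t / B * x.lcb δ t (x.act t) i) - (betaVec d j -
          x.pred t / B * x.lcb δ t (x.act t) j)) := by rw [grad, grad]; ring
      _ ≤ x.q t * Z := by
          refine mul_le_mul_of_nonneg_left ?_ (hq t ht').1.le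
          have := hpred t ht'
          linarith
      _ ≤ qbar * Z := mul_le_mul_of_nonneg_right (hq t ht').2 hZ
  have hη := hrun.eta_sq_le hd hpos n hrange
  -- The factor 3 dominates √8.
  have hη' : (x.hedge B δ (n + 1)).eta ≤ 3 * (Z * (qbar * Real.sqrt n)) := by
    refine le_of_sq_le_sq ?_ (by positivity)
    refine hη.trans ?_
    have e : (3 * (Z * (qbar * Real.sqrt n))) ^ 2 = 9 * ((n : ℝ) * (qbar * Z) ^ 2) := by
      rw [mul_pow, mul_pow, mul_pow, Real.sq_sqrt (by positivity)]; ring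
    rw [e]
    simp only [Finset.sum_const, Nat.card_Ico, nsmul_eq_mul, Nat.add_sub_cancel]
    have : (0 : ℝ) ≤ n * (qbar * Z) ^ 2 := by positivity
    linarith
  refine (hrun.regret_le_eta hd hpos n j).trans ?_
  have := mul_le_mul_of_nonneg_left hη' (by positivity : 0 ≤ 2 * Real.log ((d : ℝ) + 1))
  linarith

end Trajectory

/-! ### Orders of magnitude in the linear demand model -/

/-- The parameters of the demand model and of the budget. -/
structure IsDemandModel (κ c₁ α β M b qbar B : ℝ) (T : ℕ) : Prop where
  one_le : 1 ≤ T
  M_pos : 0 < M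
  lt_alpha : M < α
  beta_pos : 0 < β
  alpha_le : α ≤ κ * β
  qbar_eq : qbar = α + β * (T : ℝ) + M
  c_pos : 0 < c₁
  le_b : c₁ * qbar ≤ b
  B_eq : B = b * (T : ℝ)

/-- The demand sequence stays within the noise level of its linear trend. -/
def NearTrend (α β M : ℝ) (T : ℕ) (q : ℕ → ℝ) : Prop :=
  ∀ t ∈ Finset.Icc 1 T, q t ∈ Set.Icc (α + β * (t : ℝ) - M) (α + β * (t : ℝ) + M)

lemma sum_inv_sqrt_le (n : ℕ) : ∑ t ∈ Finset.Ico 1 (n + 1), 1 / Real.sqrt t ≤ 2 * Real.sqrt n := by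
  induction n with
  | zero => simp
  | succ n ih =>
    rw [Finset.sum_Ico_succ_top (by omega)]
    have h0 : (0 : ℝ) ≤ n := n.cast_nonneg
    have hs : 0 < Real.sqrt ((n : ℝ) + 1) := Real.sqrt_pos.2 (by linarith)
    have h2 : Real.sqrt ((n : ℝ) + 1) ^ 2 = n + 1 := Real.sq_sqrt (by linarith)
    have h3 : Real.sqrt (n : ℝ) ^ 2 = n := Real.sq_sqrt h0
    have h4 := Real.sqrt_nonneg (n : ℝ)
    push_cast
    have : 1 / Real.sqrt ((n : ℝ) + 1) ≤
        2 * Real.sqrt ((n : ℝ) + 1) - 2 * Real.sqrt (n : ℝ) := by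
      rw [div_le_iff₀ hs]
      nlinarith [sq_nonneg (Real.sqrt ((n : ℝ) + 1) - Real.sqrt n)]
    linarith

/-- Since t ≤ 2 max(t - 1, 1), the constant is at most 2^(3/2) ≤ 3. -/
lemma mul_rpow_le_inv_sqrt {t : ℕ} (ht : 1 ≤ t) :
    (t : ℝ) * (max ((t : ℝ) - 1) 1) ^ (-(3 / 2) : ℝ) ≤ 3 * (1 / Real.sqrt t) := by
  set m := max ((t : ℝ) - 1) 1
  have hm1 : 1 ≤ m := le_max_right _ _
  have hm0 : 0 < m := by linarith
  have ht0 : (0 : ℝ) < t := by exact_mod_cast ht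
  have htm : (t : ℝ) ≤ 2 * m := by
    have : (t : ℝ) - 1 ≤ m := le_max_left _ _
    linarith
  have e : m ^ (-(3 / 2) : ℝ) = (m * Real.sqrt m)⁻¹ := by
    rw [Real.rpow_neg hm0.le, Real.sqrt_eq_rpow, ← Real.rpow_one_add' hm0.le (by norm_num)]
    norm_num
  have hs : 0 < Real.sqrt t := Real.sqrt_pos.2 ht0
  have hsm : 0 < Real.sqrt m := Real.sqrt_pos.2 hm0
  rw [e, mul_one_div, ← div_eq_mul_inv, div_le_div_iff₀ (by positivity) hs]
  refine le_of_sq_le_sq ?_ (by positivity)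
  rw [mul_pow, mul_pow, mul_pow, Real.sq_sqrt ht0.le, Real.sq_sqrt hm0.le]
  have : (t : ℝ) ^ 3 ≤ (2 * m) ^ 3 := by gcongr
  nlinarith [pow_pos hm0 3]

namespace IsDemandModel

variable {κ c₁ α β M b qbar B : ℝ} {T : ℕ}

lemma T_pos (h : IsDemandModel κ c₁ α β M b qbar B T) : (1 : ℝ) ≤ T := by exact_mod_cast h.one_le

lemma kappa_pos (h : IsDemandModel κ c₁ α β M b qbar B T) : 0 < κ := by
  have h1 : 0 < κ * β := (h.M_pos.trans h.lt_alpha).trans_le h.alpha_le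
  exact (mul_pos_iff_of_pos_right h.beta_pos).1 h1

lemma beta_mul_le_qbar (h : IsDemandModel κ c₁ α β M b qbar B T) : β * T ≤ qbar := by
  rw [h.qbar_eq]; linarith [h.M_pos, h.lt_alpha]

lemma qbar_pos (h : IsDemandModel κ c₁ α β M b qbar B T) : 0 < qbar :=
  (mul_pos h.beta_pos (by linarith [h.T_pos])).trans_le h.beta_mul_le_qbar

lemma qbar_le (h : IsDemandModel κ c₁ α β M b qbar B T) : qbar ≤ (2 * κ + 1) * (β * T) := by
  rw [h.qbar_eq]
  have := mul_le_mul_of_nonneg_left h.T_pos (mul_pos h.kappa_pos h.beta_pos).le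
  linarith [h.lt_alpha, h.alpha_le]

lemma le_B (h : IsDemandModel κ c₁ α β M b qbar B T) : c₁ * (qbar * T) ≤ B := by
  rw [h.B_eq, ← mul_assoc]
  exact mul_le_mul_of_nonneg_right h.le_b (by linarith [h.T_pos])

lemma B_pos (h : IsDemandModel κ c₁ α β M b qbar B T) : 0 < B :=
  (mul_pos h.c_pos (mul_pos h.qbar_pos (by linarith [h.T_pos]))).trans_le h.le_B

lemma b_pos (h : IsDemandModel κ c₁ α β M b qbar B T) : 0 < b :=
  (mul_pos h.c_pos h.qbar_pos).trans_le h.le_b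

variable {q : ℕ → ℝ}

/-- Here α ≤ κβ makes q_t comparable to βt even in the early rounds, where ε_t is largest. -/
lemma demand_bounds (h : IsDemandModel κ c₁ α β M b qbar B T) (hq : NearTrend α β M T q) {t : ℕ}
    (ht : t ∈ Finset.Icc 1 T) : β * t ≤ q t ∧ q t ≤ (2 * κ + 1) * (β * t) ∧ q t ≤ qbar := by
  have hqt := hq t ht
  rw [Finset.mem_Icc] at ht
  have h1 : (1 : ℝ) ≤ t := by exact_mod_cast ht.1
  have h2 : (t : ℝ) ≤ T := by exact_mod_cast ht.2
  have h3 := mul_le_mul_of_nonneg_left h1 (mul_pos h.kappa_pos h.beta_pos).le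
  have h4 := mul_le_mul_of_nonneg_left h2 h.beta_pos.le
  refine ⟨by linarith [hqt.1, h.lt_alpha], by linarith [hqt.2, h.lt_alpha, h.alpha_le], ?_⟩
  rw [h.qbar_eq]
  linarith [hqt.2]

lemma demand_mem (h : IsDemandModel κ c₁ α β M b qbar B T) (hq : NearTrend α β M T q) {t : ℕ}
    (ht : t ∈ Finset.Icc 1 T) : q t ∈ Set.Ioc 0 qbar := by
  have := h.demand_bounds hq ht
  have h1 : (1 : ℝ) ≤ t := by exact_mod_cast (Finset.mem_Icc.1 ht).1
  exact ⟨(mul_pos h.beta_pos (by linarith)).trans_le this.1, this.2.2⟩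

lemma le_totalDemand (h : IsDemandModel κ c₁ α β M b qbar B T) (hq : NearTrend α β M T q) :
    β * T ^ 2 / 2 ≤ totalDemand T q := by
  have h1 : ∑ t ∈ Finset.Icc 1 T, β * (t : ℝ) ≤ totalDemand T q :=
    Finset.sum_le_sum fun t ht => (h.demand_bounds hq ht).1
  rw [← Finset.mul_sum, sum_Icc_cast (by omega)] at h1
  refine le_trans ?_ h1
  have := mul_pos h.beta_pos (by linarith [h.T_pos] : (0 : ℝ) < T)
  push_cast
  linarith

lemma totalDemand_le (h : IsDemandModel κ c₁ α β M b qbar B T) (hq : NearTrend α β M T q) :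
    totalDemand T q ≤ qbar * T := by
  refine (Finset.sum_le_card_nsmul _ _ _ fun t ht => (h.demand_mem hq ht).2).trans (le_of_eq ?_)
  simp [mul_comm]

lemma totalDemand_pos (h : IsDemandModel κ c₁ α β M b qbar B T) (hq : NearTrend α β M T q) :
    0 < totalDemand T q := by
  have := h.T_pos
  have := h.beta_pos
  exact lt_of_lt_of_le (by positivity) (h.le_totalDemand hq)

lemma inv_add_inv_le (h : IsDemandModel κ c₁ α β M b qbar B T) (hq : NearTrend α β M T q) :
    1 / totalDemand T q + 1 / B ≤ (2 + 1 / c₁) * (1 / (β * T ^ 2)) := by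
  have hT := h.T_pos
  have hβ := h.beta_pos
  have hc := h.c_pos
  have h1 : 1 / totalDemand T q ≤ 1 / (β * T ^ 2 / 2) :=
    one_div_le_one_div_of_le (by positivity) (h.le_totalDemand hq)
  have h2 : 1 / B ≤ 1 / (c₁ * (β * T ^ 2)) := by
    refine one_div_le_one_div_of_le (by positivity) (le_trans ?_ h.le_B)
    have := mul_le_mul_of_nonneg_right h.beta_mul_le_qbar (by linarith : (0 : ℝ) ≤ T)
    refine mul_le_mul_of_nonneg_left ?_ hc.le
    linarith
  have e : (2 + 1 / c₁) * (1 / (β * T ^ 2)) = 1 / (β * T ^ 2 / 2) + 1 / (c₁ * (β * T ^ 2)) := by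
    field_simp
  linarith

/-- Each q_t ε_t is of order βT² M t^(-1/2), and 1/Q + 1/B of order 1/(βT²). The constant 60 is 10
from the accuracy, 3 from the shifted power and 2 from the sum. -/
lemma accuracy_sum_le (h : IsDemandModel κ c₁ α β M b qbar B T) (hq : NearTrend α β M T q) {δ : ℝ}
    {n : ℕ} (hn : n ≤ T) :
    (1 / totalDemand T q + 1 / B) * ∑ t ∈ Finset.Ico 1 (n + 1), q t * accuracy 10 M δ T t ≤
      (2 + 1 / c₁) * (2 * κ + 1) * 60 * (M * Real.sqrt (Real.log (1 / δ)) * Real.sqrt n) := by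
  have hT := h.T_pos
  have hβ := h.beta_pos
  have hc := h.c_pos
  have hκ := h.kappa_pos
  have hM := h.M_pos
  set s := Real.sqrt (Real.log (1 / δ))
  have hs : 0 ≤ s := Real.sqrt_nonneg _
  have h1 : ∑ t ∈ Finset.Ico 1 (n + 1), q t * accuracy 10 M δ T t ≤
      ∑ t ∈ Finset.Ico 1 (n + 1), (2 * κ + 1) * 30 * (β * T ^ 2) * (M * s) *
        (1 / Real.sqrt t) := by
    refine Finset.sum_le_sum fun t ht => ?_
    rw [Finset.mem_Ico] at ht
    have ht' : t ∈ Finset.Icc 1 T := Finset.mem_Icc.2 ⟨ht.1, by omega⟩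
    have hp : 0 ≤ (max ((t : ℝ) - 1) 1) ^ (-(3 / 2) : ℝ) := by positivity
    calc q t * accuracy 10 M δ T t ≤ (2 * κ + 1) * (β * t) * accuracy 10 M δ T t := by
          refine mul_le_mul_of_nonneg_right (h.demand_bounds hq ht').2.1 ?_
          rw [accuracy]; positivity
      _ = (2 * κ + 1) * 10 * (β * T ^ 2) * (M * s) *
          (t * (max ((t : ℝ) - 1) 1) ^ (-(3 / 2) : ℝ)) := by rw [accuracy]; ring
      _ ≤ (2 * κ + 1) * 10 * (β * T ^ 2) * (M * s) * (3 * (1 / Real.sqrt t)) :=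
          mul_le_mul_of_nonneg_left (mul_rpow_le_inv_sqrt ht.1) (by positivity)
      _ = _ := by ring
  rw [← Finset.mul_sum] at h1
  have h2 := sum_inv_sqrt_le n
  calc _ ≤ (2 + 1 / c₁) * (1 / (β * T ^ 2)) *
        ((2 * κ + 1) * 30 * (β * T ^ 2) * (M * s) * (2 * Real.sqrt n)) := by
        refine mul_le_mul (h.inv_add_inv_le hq) (h1.trans (by gcongr)) ?_ (by positivity)
        refine Finset.sum_nonneg fun t ht => mul_nonneg ?_ (by rw [accuracy]; positivity)
        rw [Finset.mem_Ico] at ht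
        exact (h.demand_mem hq (Finset.mem_Icc.2 ⟨ht.1, by omega⟩)).1.le
    _ = _ := by field_simp; ring

/-- A bound for the prediction errors in all rounds. -/
def errorBound (M δ qbar : ℝ) (T t : ℕ) : ℝ :=
  accuracy 10 M δ T t + if t ≤ 2 then qbar * (T : ℝ) else 0

lemma pred_error_le (h : IsDemandModel κ c₁ α β M b qbar B T) (hq : NearTrend α β M T q) {δ : ℝ}
    {pred : ℕ → ℝ} (h3 : ∀ t ∈ Finset.Icc 3 T, |totalDemand T q - pred t| ≤ accuracy 10 M δ T t)
    (h12 : ∀ t ≤ 2, pred t ∈ Set.Icc 0 (qbar * (T : ℝ))) {t : ℕ} (ht : t ∈ Finset.Icc 1 T) :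
    |totalDemand T q - pred t| ≤ errorBound M δ qbar T t := by
  have hM := h.M_pos
  rw [errorBound]
  split_ifs with h2
  · have ha : 0 ≤ accuracy 10 M δ T t := by rw [accuracy]; positivity
    have := h12 t h2
    have h4 := h.totalDemand_pos hq
    have h5 := h.totalDemand_le hq
    exact abs_le.2 ⟨by linarith [this.2], by linarith [this.1]⟩
  · rw [add_zero]
    exact h3 t (Finset.mem_Icc.2 ⟨by omega, (Finset.mem_Icc.1 ht).2⟩)

/-- This bounds the range of the AdaHedge losses. Least-squares predictions may be negative, hence
the absolute value; M < α ≤ κβ keeps every ε_t within O(q̄ T √log(1/δ)). -/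
lemma pred_ratio_le (h : IsDemandModel κ c₁ α β M b qbar B T) (hq : NearTrend α β M T q) {δ : ℝ}
    (hL : 1 ≤ Real.log (1 / δ)) {pred : ℕ → ℝ} {t : ℕ}
    (he : |totalDemand T q - pred t| ≤ errorBound M δ qbar T t) :
    1 + 2 * (|pred t| / B) ≤
      (1 + 4 / c₁ + 20 * κ / c₁) * Real.sqrt (Real.log (1 / δ)) := by
  have hT := h.T_pos
  have hβ := h.beta_pos
  have hc := h.c_pos
  have hκ := h.kappa_pos
  have hM := h.M_pos
  have hqb := h.qbar_pos
  have hB := h.B_pos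
  set s := Real.sqrt (Real.log (1 / δ)) with hs
  have hs1 : 1 ≤ s := by rw [hs]; exact Real.one_le_sqrt.2 hL
  have hacc : accuracy 10 M δ T t ≤ 10 * κ * (qbar * T) * s := by
    have hr : (max ((t : ℝ) - 1) 1) ^ (-(3 / 2) : ℝ) ≤ 1 :=
      Real.rpow_le_one_of_one_le_of_nonpos (le_max_right _ _) (by norm_num)
    calc accuracy 10 M δ T t ≤ 10 * M * T ^ 2 * s * 1 := by
          rw [accuracy]; gcongr
      _ ≤ 10 * (κ * β) * T ^ 2 * s * 1 := by
          have : M ≤ κ * β := h.lt_alpha.le.trans h.alpha_le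
          gcongr
      _ = 10 * κ * ((β * T) * T) * s := by ring
      _ ≤ _ := by
          have := h.beta_mul_le_qbar
          gcongr
  have hif : (if t ≤ 2 then qbar * (T : ℝ) else 0) ≤ qbar * T := by
    split_ifs
    · exact le_rfl
    · positivity
  have habs : |pred t| ≤ 2 * (qbar * T) + 10 * κ * (qbar * T) * s := by
    have h1 := h.totalDemand_pos hq
    have h2 := h.totalDemand_le hq
    have h3 : |pred t| ≤ |totalDemand T q| + |totalDemand T q - pred t| := by
      have := abs_sub_abs_le_abs_sub (pred t) (totalDemand T q)
      rw [abs_sub_comm] at this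
      linarith
    rw [abs_of_pos h1] at h3
    rw [errorBound] at he
    linarith
  have hdiv : |pred t| / B ≤ (2 + 10 * κ * s) / c₁ := by
    rw [div_le_div_iff₀ hB hc]
    calc |pred t| * c₁ ≤ (2 * (qbar * T) + 10 * κ * (qbar * T) * s) * c₁ := by gcongr
      _ = (2 + 10 * κ * s) * (c₁ * (qbar * T)) := by ring
      _ ≤ _ := mul_le_mul_of_nonneg_left h.le_B (by positivity)
  calc 1 + 2 * (|pred t| / B) ≤ 1 + 2 * ((2 + 10 * κ * s) / c₁) := by gcongr
    _ = 1 * 1 + 4 / c₁ * 1 + 20 * κ / c₁ * s := by ring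
    _ ≤ 1 * s + 4 / c₁ * s + 20 * κ / c₁ * s := by gcongr
    _ = _ := by ring

/-- Two arbitrary predictions cost at most q̄ · q̄T each, which after division by Q or B is O(q̄):
one more term of the order of the claim. -/
lemma errorBound_sum_le (h : IsDemandModel κ c₁ α β M b qbar B T) (hq : NearTrend α β M T q)
    {δ : ℝ} (hL : 1 ≤ Real.log (1 / δ)) {n : ℕ} (hn : n ≤ T) :
    (1 / totalDemand T q + 1 / B) * ∑ t ∈ Finset.Ico 1 (n + 1), q t * errorBound M δ qbar T t ≤
      62 * ((2 + 1 / c₁) * (2 * κ + 1)) *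
        (Real.sqrt (Real.log (1 / δ)) * ((M + qbar) * Real.sqrt n)) := by
  have hT := h.T_pos
  have hβ := h.beta_pos
  have hc := h.c_pos
  have hκ := h.kappa_pos
  have hM := h.M_pos
  have hqb := h.qbar_pos
  have hB := h.B_pos
  have hacc := h.accuracy_sum_le hq (δ := δ) hn
  set s := Real.sqrt (Real.log (1 / δ)) with hs
  have hs1 : 1 ≤ s := by rw [hs]; exact Real.one_le_sqrt.2 hL
  have hinv := h.inv_add_inv_le hq
  have hcnt : ∑ t ∈ Finset.Ico 1 (n + 1), (if t ≤ 2 then (1 : ℝ) else 0) ≤ 2 * Real.sqrt n := by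
    rcases Nat.eq_zero_or_pos n with rfl | hn0
    · simp
    · have h1 : (1 : ℝ) ≤ Real.sqrt n := Real.one_le_sqrt.2 (by exact_mod_cast hn0)
      rw [← Finset.sum_filter, Finset.sum_const, nsmul_eq_mul, mul_one]
      have h2 : ((Finset.Ico 1 (n + 1)).filter (· ≤ 2)).card ≤ 2 := by
        calc _ ≤ (Finset.Icc 1 2).card := Finset.card_le_card fun t ht => by
              rw [Finset.mem_filter, Finset.mem_Ico] at ht
              exact Finset.mem_Icc.2 ⟨ht.1.1, ht.2⟩
          _ = 2 := by simp
      have h3 : (((Finset.Ico 1 (n + 1)).filter (· ≤ 2)).card : ℝ) ≤ 2 := by exact_mod_cast h2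
      linarith
  have hfirst : ∑ t ∈ Finset.Ico 1 (n + 1), q t * (if t ≤ 2 then qbar * (T : ℝ) else 0) ≤
      qbar * (qbar * T) * (2 * Real.sqrt n) := by
    refine le_trans ?_ (mul_le_mul_of_nonneg_left hcnt (by positivity))
    rw [Finset.mul_sum]
    refine Finset.sum_le_sum fun t ht => ?_
    rw [Finset.mem_Ico] at ht
    have := (h.demand_mem hq (Finset.mem_Icc.2 ⟨ht.1, by omega⟩)).2
    split_ifs
    · rw [mul_one]; gcongr
    · simp
  have hprod : (1 / totalDemand T q + 1 / B) *
      ∑ t ∈ Finset.Ico 1 (n + 1), q t * (if t ≤ 2 then qbar * (T : ℝ) else 0) ≤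
      (2 + 1 / c₁) * (2 * κ + 1) * 2 * (qbar * Real.sqrt n) := by
    have hQ := h.totalDemand_pos hq
    calc _ ≤ (1 / totalDemand T q + 1 / B) * (qbar * (qbar * T) * (2 * Real.sqrt n)) :=
          mul_le_mul_of_nonneg_left hfirst (by positivity)
      _ ≤ (2 + 1 / c₁) * (1 / (β * T ^ 2)) *
          (((2 * κ + 1) * (β * T)) * (qbar * T) * (2 * Real.sqrt n)) := by
          have := h.qbar_le
          gcongr
      _ = _ := by field_simp
  have split : ∑ t ∈ Finset.Ico 1 (n + 1), q t * errorBound M δ qbar T t =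
      ∑ t ∈ Finset.Ico 1 (n + 1), q t * accuracy 10 M δ T t +
        ∑ t ∈ Finset.Ico 1 (n + 1), q t * (if t ≤ 2 then qbar * (T : ℝ) else 0) := by
    rw [← Finset.sum_add_distrib]
    exact Finset.sum_congr rfl fun t _ => by rw [errorBound]; ring
  rw [split, mul_add]
  set k := (2 + 1 / c₁) * (2 * κ + 1)
  have hk : 0 ≤ k := by positivity
  have hsn := Real.sqrt_nonneg (n : ℝ)
  have a1 : M * s * Real.sqrt n ≤ s * ((M + qbar) * Real.sqrt n) := by
    have : 0 ≤ s * (qbar * Real.sqrt n) := by positivity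
    linarith
  have a2 : qbar * Real.sqrt n ≤ s * ((M + qbar) * Real.sqrt n) := by
    calc qbar * Real.sqrt n = 1 * ((0 + qbar) * Real.sqrt n) := by ring
      _ ≤ _ := by gcongr
  have a3 := mul_le_mul_of_nonneg_left a1 hk
  have a4 := mul_le_mul_of_nonneg_left a2 hk
  linarith

end IsDemandModel

/-! ### The regret bound on the concentration event -/

namespace Trajectory

variable {𝒜 : Type*} {d : ℕ} {x : Trajectory 𝒜 d}

lemma sqrt_add_mul_le {Y z E : ℝ} (hY : 0 ≤ Y) (hz : 0 ≤ z) (hE : 0 ≤ E) :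
    Real.sqrt ((Y + z) * E) ≤ Real.sqrt (Y * E) + (z + E) / 2 := by
  have h0 := Real.sqrt_nonneg (Y * E)
  have h1 : Real.sqrt (Y * E) ^ 2 = Y * E := Real.sq_sqrt (by positivity)
  refine Real.sqrt_le_iff.2 ⟨by positivity, ?_⟩
  nlinarith [sq_nonneg (z - E), mul_nonneg h0 (add_nonneg hz hE)]

namespace IsConcentrated

variable {T : ℕ} {qbar δ L : ℝ} {m : Option (Fin d) → 𝒜 → ℝ}

/-- The weighted deviation bound is used twice: once to replace mean outcomes by realized ones under
the square root, once to pass from the means of the played actions to the outcomes. -/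
lemma width_sum_le [Fintype 𝒜] (h : x.IsConcentrated T qbar L m) (hL : 0 ≤ L) (hT : 1 ≤ T)
    (hqb : 0 ≤ qbar) (hm : ∀ k a, m k a ∈ Set.Icc (0 : ℝ) 1) (k : Option (Fin d)) {n : ℕ}
    (hn : n ≤ T) {Y : ℝ} (hY0 : 0 ≤ Y)
    (hY : ∑ t ∈ Finset.Ico 1 (n + 1), x.q t * x.out k t ≤ Y) :
    ∑ t ∈ Finset.Ico 1 (n + 1), x.q t * (4 * Real.sqrt (m k (x.act t) *
      (L / x.pullsPlus t (x.act t))) + 12 * (L / x.pullsPlus t (x.act t))) +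
      |∑ s ∈ Finset.Ico 1 (n + 1), x.q s * (x.out k s - m k (x.act s))| ≤
      3 * (qbar * (2 * Real.sqrt (n * (2 * L)))) +
        4 * Real.sqrt (Y * (2 * qbar * Fintype.card 𝒜 * L * (1 + Real.log T))) +
        14 * (2 * qbar * Fintype.card 𝒜 * L * (1 + Real.log T)) := by
  have hw := h.weighted k n hn
  set z := qbar * (2 * Real.sqrt (n * (2 * L)))
  set E := 2 * qbar * Fintype.card 𝒜 * L * (1 + Real.log T)
  have hT' : (1 : ℝ) ≤ T := by exact_mod_cast hT
  have hz : 0 ≤ z := by positivity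
  have hE : 0 ≤ E := by
    have := Real.log_nonneg hT'
    positivity
  have hmean : ∑ t ∈ Finset.Ico 1 (n + 1), x.q t * m k (x.act t) ≤ Y + z := by
    have e : ∑ s ∈ Finset.Ico 1 (n + 1), x.q s * (x.out k s - m k (x.act s)) =
        ∑ s ∈ Finset.Ico 1 (n + 1), x.q s * x.out k s -
          ∑ s ∈ Finset.Ico 1 (n + 1), x.q s * m k (x.act s) := by
      rw [← Finset.sum_sub_distrib]
      exact Finset.sum_congr rfl fun s _ => by ring
    have := (abs_le.1 hw).1
    linarith
  have h1 := x.sum_width_le hT hn h.demand hL (fun a => (hm k a).1) hqb hmean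
  have h2 := sqrt_add_mul_le hY0 hz hE
  linarith

end IsConcentrated

lemma le_mul_sqrt_mul {y K w : ℝ} (hy : 0 ≤ y) (hK : 1 ≤ K) (hw : 1 ≤ w) (hyw : y ≤ w) :
    y ≤ w * Real.sqrt (y * K) := by
  refine le_of_sq_le_sq ?_ (by positivity)
  rw [mul_pow, Real.sq_sqrt (by positivity)]
  calc y ^ 2 = y * (y * 1) := by ring
    _ ≤ (w * w) * (y * K) := by
      gcongr
      exact hyw.trans (le_mul_of_one_le_left (by linarith) hw)
    _ = w ^ 2 * (y * K) := by ring

lemma sqrt_le_self_of_one_le {y : ℝ} (hy : 1 ≤ y) : Real.sqrt y ≤ y := by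
  refine Real.sqrt_le_iff.2 ⟨by linarith, ?_⟩
  nlinarith

/-- In the regime q̄K ≤ OPT, the lower-order term q̄K is at most √(q̄K·OPT). The ratios OPT/B and
q̄/B are at most 1/c₁, and the lower bounds 1/2 on the logarithms let them be inserted as factors
where missing. -/
lemma regret_arith {reg OPT B c₁ qbar K M L lT D F n CZ k : ℝ} (hc1 : 0 < c₁) (hB : 0 < B)
    (hqb : 0 < qbar) (hK : 1 ≤ K) (hM : 0 < M) (hL : 1 ≤ L) (hlT : 1 / 2 ≤ lT) (hD : 1 / 2 ≤ D)
    (hF0 : 0 ≤ F) (hF : F ≤ 3 * lT) (hn : 0 ≤ n) (hO0 : 0 ≤ OPT) (hQB : OPT / B ≤ 1 / c₁)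
    (hqB : qbar / B ≤ 1 / c₁) (hbig : qbar * K ≤ OPT) (hCZ : 0 ≤ CZ) (hk : 0 ≤ k)
    (hreg : reg ≤ 3 * (qbar * (2 * Real.sqrt (n * (2 * L)))) +
      4 * Real.sqrt (OPT * (2 * qbar * K * L * F)) + 14 * (2 * qbar * K * L * F) +
      6 * D * (CZ * Real.sqrt L * (qbar * Real.sqrt n)) +
      62 * k * (Real.sqrt L * ((M + qbar) * Real.sqrt n)) +
      OPT / B * (3 * (qbar * (2 * Real.sqrt (n * (2 * L)))) +
        4 * Real.sqrt (B * (2 * qbar * K * L * F)) + 14 * (2 * qbar * K * L * F) + qbar)) :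
    reg ≤ (400 * (1 + 1 / c₁) + 12 * CZ + 248 * k) * (L * lT * D) *
      (OPT * Real.sqrt (qbar * K / B) + Real.sqrt (qbar * K * OPT) +
        (M + qbar) * Real.sqrt n) := by
  set R1 := OPT * Real.sqrt (qbar * K / B) with hR1
  set R2 := Real.sqrt (qbar * K * OPT) with hR2
  set R3 := (M + qbar) * Real.sqrt n with hR3
  set E := 2 * qbar * K * L * F with hE
  set z := qbar * (2 * Real.sqrt (n * (2 * L))) with hz
  have hR10 : 0 ≤ R1 := by positivity
  have hR20 : 0 ≤ R2 := by positivity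
  have hR30 : 0 ≤ R3 := by positivity
  have hE0 : 0 ≤ E := by positivity
  have hz0 : 0 ≤ z := by positivity
  set w := 1 + 1 / c₁ with hw
  have hw1 : 1 ≤ w := by rw [hw]; linarith [one_div_pos.2 hc1]
  have hL0 : 0 < L := by linarith
  set G' := L * lT
  have hG' : 1 / 2 ≤ G' := by
    calc (1 : ℝ) / 2 = 1 * (1 / 2) := by ring
      _ ≤ L * lT := by gcongr
  have hLG : L ≤ 2 * G' := by
    have : L * (1 / 2) ≤ L * lT := by gcongr
    simp only [G']; linarith
  have hG'G : G' ≤ 2 * (G' * D) := by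
    have : G' * (1 / 2) ≤ G' * D := by gcongr
    linarith
  set G := G' * D with hG
  have hsL : Real.sqrt L ≤ L := sqrt_le_self_of_one_le hL
  have hzb : z ≤ 6 * G' * R3 := by
    have h1 : Real.sqrt (n * (2 * L)) ≤ Real.sqrt n * (3 / 2 * L) := by
      rw [Real.sqrt_mul (by positivity)]
      gcongr
      refine Real.sqrt_le_iff.2 ⟨by positivity, ?_⟩
      calc 2 * L = 2 * L * 1 := by ring
        _ ≤ 9 / 4 * L * L := by gcongr; norm_num
        _ = _ := by ring
    calc z ≤ qbar * (2 * (Real.sqrt n * (3 / 2 * L))) := by rw [hz]; gcongr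
      _ = 3 * L * ((0 + qbar) * Real.sqrt n) := by ring
      _ ≤ 3 * (2 * G') * R3 := by rw [hR3]; gcongr
      _ = _ := by ring
  have hLF : 2 * L * F ≤ 6 * G' := by
    have : 2 * L * F ≤ 2 * L * (3 * lT) := by gcongr
    simp only [G']; linarith
  have hEeq : E = qbar * K * (2 * L * F) := by rw [hE]; ring
  have hsqrtLF : Real.sqrt (2 * L * F) ≤ 6 * G' :=
    (Real.sqrt_le_sqrt hLF).trans (sqrt_le_self_of_one_le (by linarith))
  have hOE : Real.sqrt (OPT * E) ≤ 6 * G' * R2 := by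
    rw [hEeq, ← mul_assoc, mul_comm OPT, Real.sqrt_mul (by positivity), mul_comm]
    exact mul_le_mul_of_nonneg_right hsqrtLF hR20
  have hqK : qbar * K ≤ R2 := by
    refine Real.le_sqrt_of_sq_le ?_
    rw [sq]; gcongr
  have hEb : E ≤ 6 * G' * R2 := by
    rw [hEeq, mul_comm]
    gcongr
  have hBE : OPT / B * Real.sqrt (B * E) ≤ 6 * G' * R1 := by
    have e : Real.sqrt (B * E) = B * (Real.sqrt (qbar * K / B) *
        Real.sqrt (2 * L * F)) := by
      rw [← Real.sqrt_mul (by positivity)]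
      have : B * E = B ^ 2 * (qbar * K / B * (2 * L * F)) := by
        rw [hEeq]; field_simp
      rw [this, Real.sqrt_mul (by positivity), Real.sqrt_sq hB.le]
    rw [e]
    calc OPT / B * (B * (Real.sqrt (qbar * K / B) * Real.sqrt (2 * L * F))) =
        Real.sqrt (2 * L * F) * R1 := by rw [hR1]; field_simp
      _ ≤ _ := mul_le_mul_of_nonneg_right hsqrtLF hR10
  have hOq : OPT / B * qbar ≤ w * R1 := by
    have h2 : qbar / B ≤ w * Real.sqrt (qbar * K / B) := by
      rw [mul_div_right_comm]
      exact le_mul_sqrt_mul (by positivity) hK hw1 (hqB.trans (by rw [hw]; linarith))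
    calc OPT / B * qbar = OPT * (qbar / B) := by ring
      _ ≤ OPT * (w * Real.sqrt (qbar * K / B)) := by gcongr
      _ = _ := by rw [hR1]; ring
  have hOz : OPT / B * z ≤ w * (6 * G' * R3) := by
    have : OPT / B ≤ w := hQB.trans (by rw [hw]; linarith)
    gcongr
  have hOEb : OPT / B * E ≤ w * (6 * G' * R2) := by
    have : OPT / B ≤ w := hQB.trans (by rw [hw]; linarith)
    gcongr
  have hHb : 6 * D * (CZ * Real.sqrt L * (qbar * Real.sqrt n)) ≤ 12 * CZ * G * R3 := by
    calc _ = 6 * CZ * (Real.sqrt L * D * ((0 + qbar) * Real.sqrt n)) := by ring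
      _ ≤ 6 * CZ * ((2 * G') * D * R3) := by
          rw [hR3]
          have := hsL.trans hLG
          gcongr
      _ = _ := by rw [hG]; ring
  have herrb : 62 * k * (Real.sqrt L * R3) ≤ 124 * k * G' * R3 := by
    calc _ ≤ 62 * k * ((2 * G') * R3) := by
          have := hsL.trans hLG
          gcongr
      _ = _ := by ring
  have t1 : (24 * G' + w) * R1 ≤ 400 * w * G * R1 := by
    gcongr
    have : 1 * G ≤ w * G := by gcongr
    have : w * (1 / 4) ≤ w * G := by gcongr; linarith
    linarith
  have t2 : (108 + 84 * w) * G' * R2 ≤ 400 * w * G * R2 := by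
    gcongr ?_ * R2
    have h1 : (108 + 84 * w) * G' ≤ 192 * w * (2 * G) := by
      gcongr
      linarith
    have h2 : 0 ≤ w * G := by positivity
    linarith
  have t3 : (18 + 18 * w + 124 * k) * G' * R3 ≤ (400 * w + 248 * k) * G * R3 := by
    gcongr ?_ * R3
    have h1 : (18 + 18 * w + 124 * k) * G' ≤ (36 * w + 124 * k) * (2 * G) := by
      gcongr
      linarith
    have h2 : 0 ≤ w * G := by positivity
    linarith
  have s1 : OPT / B * (3 * z + 4 * Real.sqrt (B * E) + 14 * E + qbar) =
      3 * (OPT / B * z) + 4 * (OPT / B * Real.sqrt (B * E)) + 14 * (OPT / B * E) +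
        OPT / B * qbar := by ring
  rw [s1] at hreg
  have s2 : 0 ≤ (12 * CZ + 248 * k) * G * (R1 + R2) := by positivity
  linarith

lemma decomposition [Fintype 𝒜] {κ c₁ α β M b qbar B δ : ℝ} {T : ℕ} {a₀ : 𝒜}
    {r : 𝒜 → ℝ} {c : 𝒜 → Fin d → ℝ}
    (hmod : IsDemandModel κ c₁ α β M b qbar B T) (hd : 1 ≤ d) (hL : 1 ≤ Real.log (1 / δ))
    (hq : NearTrend α β M T x.q)
    (hr : ∀ a, r a ∈ Set.Icc (0 : ℝ) 1) (hc : ∀ a i, c a i ∈ Set.Icc (0 : ℝ) 1)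
    (hc₀ : ∀ i, c a₀ i = 0)
    (hconc : x.IsConcentrated T qbar (Real.log (1 / δ))
      (fun k a => k.elim (r a) (c a)))
    (hfol : x.FollowsOAUCB T B δ a₀)
    (hpred : ∀ t ∈ Finset.Icc 3 T, |totalDemand T x.q - x.pred t| ≤ accuracy 10 M δ T t)
    (hpred' : ∀ t ≤ 2, x.pred t ∈ Set.Icc 0 (qbar * (T : ℝ)))
    {n : ℕ} (hn : x.stopTime T B = n + 1)
    (hrew : x.reward T B ≤ optLP (totalDemand T x.q) B r c) :
    optLP (totalDemand T x.q) B r c - x.reward T B ≤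
      3 * (qbar * (2 * Real.sqrt (n * (2 * Real.log (1 / δ))))) +
      4 * Real.sqrt (optLP (totalDemand T x.q) B r c *
        (2 * qbar * Fintype.card 𝒜 * Real.log (1 / δ) * (1 + Real.log T))) +
      14 * (2 * qbar * Fintype.card 𝒜 * Real.log (1 / δ) * (1 + Real.log T)) +
      6 * Real.log ((d : ℝ) + 1) * ((1 + 4 / c₁ + 20 * κ / c₁) * Real.sqrt (Real.log (1 / δ)) *
        (qbar * Real.sqrt n)) +
      (1 / totalDemand T x.q + 1 / B) * ∑ t ∈ Finset.Ico 1 (n + 1),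
        x.q t * IsDemandModel.errorBound M δ qbar T t +
      optLP (totalDemand T x.q) B r c / B *
        (3 * (qbar * (2 * Real.sqrt (n * (2 * Real.log (1 / δ))))) +
        4 * Real.sqrt (B * (2 * qbar * Fintype.card 𝒜 * Real.log (1 / δ) * (1 + Real.log T))) +
        14 * (2 * qbar * Fintype.card 𝒜 * Real.log (1 / δ) * (1 + Real.log T)) + qbar) := by
  have hT := hmod.T_pos
  have hc1 := hmod.c_pos
  have hκ := hmod.kappa_pos
  have hqb := hmod.qbar_pos
  have hB := hmod.B_pos
  have hQ := hmod.totalDemand_pos hq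
  have hnT : n ≤ T := by have := x.stopTime_le T B; omega
  have hlogT : 0 ≤ Real.log T := Real.log_nonneg hT
  have hO0 : 0 ≤ optLP (totalDemand T x.q) B r c := optLP_nonneg hQ.le fun a => (hr a).1
  set L := Real.log (1 / δ) with hLdef
  have hL0 : 0 < L := by linarith
  set Q := totalDemand T x.q
  set OPT := optLP Q B r c
  set D := Real.log ((d : ℝ) + 1)
  set K : ℝ := (Fintype.card 𝒜 : ℝ)
  set CZ := 1 + 4 / c₁ + 20 * κ / c₁ with hCZ
  have hCZ0 : 0 ≤ CZ := by positivity
  set m : Option (Fin d) → 𝒜 → ℝ := fun k a => k.elim (r a) (c a)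
  have hm : ∀ k a, m k a ∈ Set.Icc (0 : ℝ) 1 := by
    rintro (_ | i) a
    · exact hr a
    · exact hc a i
  set E := 2 * qbar * K * L * (1 + Real.log T) with hE
  set z := qbar * (2 * Real.sqrt (n * (2 * L))) with hz
  have hE0 : 0 ≤ E := by positivity
  have hz0 : 0 ≤ z := by positivity
  have hI : Finset.Ico 1 (x.stopTime T B) = Finset.Ico 1 (n + 1) := by rw [hn]
  have hlcb1 : ∀ t ∈ Finset.Icc 1 T, ∀ a j, x.lcb δ t a j ≤ 1 := by
    intro t ht a j
    refine Fin.lastCases ?_ (fun i => ?_) j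
    · rw [lcb_last]; exact zero_le_one
    · exact (hconc.cons_bounds hLdef hL hm ht a i).1.trans (hm (some i) a).2
  have herr : ∀ t ∈ Finset.Icc 1 T, |Q - x.pred t| ≤ IsDemandModel.errorBound M δ qbar T t :=
    fun t ht => hmod.pred_error_le hq hpred hpred' ht
  rw [← hI]
  exact regret_le (U := 3 * z + 4 * Real.sqrt (OPT * E) + 14 * E)
    (V := 3 * z + 4 * Real.sqrt (B * E) + 14 * E)
    (H := 6 * D * (CZ * Real.sqrt L * (qbar * Real.sqrt n))) (r := r) (c := c)
    (e := IsDemandModel.errorBound M δ qbar T)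
    hfol hB hQ (fun t ht => ⟨(hconc.demand t ht).1.le, (hconc.demand t ht).2⟩)
    (fun t ht i => (hconc.out_mem (some i) t ht).2) hr hc₀
    (fun t ht a => (hconc.reward_bounds hLdef hL hm ht a).1)
    (fun t ht a i => (hconc.cons_bounds hLdef hL hm ht a i).1) herr hlcb1
    (fun t ht => (x.isHedgeRun B δ).mu_mem ht)
    (fun j => by
      rw [hI]
      exact x.hedge_regret_le hd (by linarith) hB hmod.one_le hqb.le hconc.demand hlcb1
        (by positivity) (fun t ht => hmod.pred_ratio_le hq hL (herr t ht)) hnT j)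
    (by
      have h1 := hconc.width_sum_le hL0.le hmod.one_le hqb.le hm none hnT hO0
        (by
          have : x.reward T B = ∑ t ∈ Finset.Ico 1 (n + 1), x.q t * x.out none t := by
            rw [reward, hI]; rfl
          linarith)
      rw [hI]
      refine le_trans ?_ h1
      have h2 := neg_abs_le (∑ s ∈ Finset.Ico 1 (n + 1),
        x.q s * (x.out none s - m none (x.act s)))
      refine le_trans ?_ (sub_le_sub_left h2 _ |>.trans (le_of_eq (sub_neg_eq_add _ _)))
      rw [← Finset.sum_sub_distrib]
      refine Finset.sum_le_sum fun t ht => ?_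
      rw [← hI] at ht
      have ht' := x.mem_Icc_of_lt_stopTime ht
      have h3 := (hconc.reward_bounds hLdef hL hm ht' (x.act t)).2
      rw [← mul_sub]
      refine mul_le_mul_of_nonneg_left ?_ (hconc.demand t ht').1.le
      simp only [out]
      linarith)
    (fun i => by
      have h1 := hconc.width_sum_le hL0.le hmod.one_le hqb.le hm (some i) hnT hB.le
        (by rw [← hI]; exact x.sum_cons_le hB.le i)
      rw [hI]
      refine le_trans ?_ h1
      have h2 := le_abs_self (∑ s ∈ Finset.Ico 1 (n + 1),
        x.q s * (x.out (some i) s - m (some i) (x.act s)))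
      refine le_trans ?_ (add_le_add_right h2 _)
      rw [← Finset.sum_add_distrib]
      refine Finset.sum_le_sum fun t ht => ?_
      rw [← hI] at ht
      have ht' := x.mem_Icc_of_lt_stopTime ht
      have h3 := (hconc.cons_bounds hLdef hL hm ht' (x.act t) i).2
      rw [← mul_add]
      refine mul_le_mul_of_nonneg_left ?_ (hconc.demand t ht').1.le
      simp only [out]
      linarith)
    (by positivity)

theorem regret_le_of_isConcentrated [Fintype 𝒜] {κ c₁ α β M b qbar B δ : ℝ} {T : ℕ} {a₀ : 𝒜}
    {r : 𝒜 → ℝ} {c : 𝒜 → Fin d → ℝ}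
    (hmod : IsDemandModel κ c₁ α β M b qbar B T) (hd : 1 ≤ d) (hL : 1 ≤ Real.log (1 / δ))
    (hq : NearTrend α β M T x.q)
    (hr : ∀ a, r a ∈ Set.Icc (0 : ℝ) 1) (hc : ∀ a i, c a i ∈ Set.Icc (0 : ℝ) 1)
    (hc₀ : ∀ i, c a₀ i = 0)
    (hconc : x.IsConcentrated T qbar (Real.log (1 / δ))
      (fun k a => k.elim (r a) (c a)))
    (hfol : x.FollowsOAUCB T B δ a₀)
    (hpred : ∀ t ∈ Finset.Icc 3 T, |totalDemand T x.q - x.pred t| ≤ accuracy 10 M δ T t)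
    (hpred' : ∀ t ≤ 2, x.pred t ∈ Set.Icc 0 (qbar * (T : ℝ))) :
    optLP (totalDemand T x.q) B r c - x.reward T B ≤
      (400 * (1 + 1 / c₁) + 12 * (1 + 4 / c₁ + 20 * κ / c₁) +
        248 * ((2 + 1 / c₁) * (2 * κ + 1))) *
      (Real.log (1 / δ) * Real.log ((T : ℝ) + 1) * Real.log ((d : ℝ) + 1)) *
        (optLP (totalDemand T x.q) B r c * Real.sqrt (qbar * (Fintype.card 𝒜 : ℝ) / B) +
          Real.sqrt (qbar * (Fintype.card 𝒜 : ℝ) * optLP (totalDemand T x.q) B r c) +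
          (M + qbar) * Real.sqrt ((x.stopTime T B : ℝ) - 1)) := by
  have hT := hmod.T_pos
  have hc1 := hmod.c_pos
  have hκ := hmod.kappa_pos
  have hM := hmod.M_pos
  have hqb := hmod.qbar_pos
  have hB := hmod.B_pos
  have hQ := hmod.totalDemand_pos hq
  obtain ⟨n, hn⟩ : ∃ n, x.stopTime T B = n + 1 :=
    ⟨x.stopTime T B - 1, by have := x.one_le_stopTime T B; omega⟩
  have hnT : n ≤ T := by have := x.stopTime_le T B; omega
  have hτ : ((x.stopTime T B : ℝ) - 1) = n := by rw [hn]; push_cast; ring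
  rw [hτ]
  set L := Real.log (1 / δ) with hLdef
  set lT := Real.log ((T : ℝ) + 1)
  set D := Real.log ((d : ℝ) + 1)
  set Q := totalDemand T x.q
  set OPT := optLP Q B r c
  set K : ℝ := (Fintype.card 𝒜 : ℝ)
  have hK : 1 ≤ K := by
    have : 0 < Fintype.card 𝒜 := Fintype.card_pos_iff.2 ⟨a₀⟩
    exact Nat.one_le_cast.2 this
  have hD : 1 / 2 ≤ D := by
    have h2 : (2 : ℝ) ≤ (d : ℝ) + 1 := by
      have : (1 : ℝ) ≤ d := by exact_mod_cast hd
      linarith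
    have := Real.log_le_log (by norm_num) h2
    linarith [Real.log_two_gt_d9]
  have hlT : 1 / 2 ≤ lT := by
    have := Real.log_le_log (by norm_num) (by linarith : (2 : ℝ) ≤ (T : ℝ) + 1)
    linarith [Real.log_two_gt_d9]
  have hF : 1 + Real.log T ≤ 3 * lT := by
    have := Real.log_le_log (by linarith) (by linarith : (T : ℝ) ≤ (T : ℝ) + 1)
    linarith
  have hlogT : 0 ≤ Real.log T := Real.log_nonneg hT
  have hO0 : 0 ≤ OPT := optLP_nonneg hQ.le fun a => (hr a).1
  have hO1 : OPT ≤ Q := optLP_le_demand hQ.le fun a => (hr a).2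
  have hrew0 : 0 ≤ x.reward T B := by
    refine Finset.sum_nonneg fun t ht => ?_
    have ht' := x.mem_Icc_of_lt_stopTime ht
    exact mul_nonneg (hmod.demand_mem hq ht').1.le (hconc.out_mem none t ht').1
  have hCZ : 0 ≤ 1 + 4 / c₁ + 20 * κ / c₁ := by positivity
  have hk : 0 ≤ (2 + 1 / c₁) * (2 * κ + 1) := by positivity
  set CZ := 1 + 4 / c₁ + 20 * κ / c₁
  set k := (2 + 1 / c₁) * (2 * κ + 1)
  have trivial_case : OPT - x.reward T B ≤ Real.sqrt (qbar * K * OPT) →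
      OPT - x.reward T B ≤ (400 * (1 + 1 / c₁) + 12 * CZ + 248 * k) * (L * lT * D) *
        (OPT * Real.sqrt (qbar * K / B) + Real.sqrt (qbar * K * OPT) +
          (M + qbar) * Real.sqrt n) := by
    intro h
    refine h.trans ?_
    have h1 : (1 : ℝ) ≤ 400 * (1 + 1 / c₁) + 12 * CZ + 248 * k - 399 := by
      have := one_div_pos.2 hc1
      linarith
    have h2 : 1 * (1 / 2) * (1 / 2) ≤ L * lT * D := by gcongr
    have h3 : 0 ≤ OPT * Real.sqrt (qbar * K / B) := by positivity
    have h4 : 0 ≤ (M + qbar) * Real.sqrt n := by positivity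
    have h5 : (400 : ℝ) * (1 / 4) ≤
        (400 * (1 + 1 / c₁) + 12 * CZ + 248 * k) * (L * lT * D) := by
      gcongr <;> linarith
    calc Real.sqrt (qbar * K * OPT) = 1 * (0 + Real.sqrt (qbar * K * OPT) + 0) := by ring
      _ ≤ _ := by
        gcongr
        linarith
  rcases lt_or_ge OPT (qbar * K) with hsmall | hbig
  -- If OPT < q̄K, even collecting nothing costs only OPT ≤ √(q̄K·OPT).
  · refine trivial_case ?_
    have h1 : OPT ≤ Real.sqrt (qbar * K * OPT) := by
      refine Real.le_sqrt_of_sq_le ?_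
      rw [sq]; gcongr
    linarith
  rcases le_or_gt OPT (x.reward T B) with hrew | hrew
  · refine trivial_case ?_
    have := Real.sqrt_nonneg (qbar * K * OPT)
    linarith
  refine regret_arith hc1 hB hqb hK hM hL hlT hD (by linarith : 0 ≤ 1 + Real.log T) hF
    n.cast_nonneg hO0 ?_ ?_ hbig hCZ hk ?_
  · rw [div_le_div_iff₀ hB hc1, one_mul]
    have h1 := hO1.trans (hmod.totalDemand_le hq)
    have h2 := mul_le_mul_of_nonneg_right h1 hc1.le
    linarith [hmod.le_B]
  · rw [div_le_div_iff₀ hB hc1, one_mul]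
    refine le_trans ?_ hmod.le_B
    have : c₁ * (qbar * 1) ≤ c₁ * (qbar * T) := by gcongr
    linarith
  have herrsum := hmod.errorBound_sum_le hq hL hnT
  refine (decomposition hmod hd hL hq hr hc hc₀ hconc hfol hpred hpred' hn hrew.le).trans ?_
  linarith

end Trajectory

/-! ### The model as an adapted play -/

section Model

variable {Ω : Type*}
  {𝒜 : Type*} {d T : ℕ} {ξ : ℕ → Ω → ℝ} {M : ℝ}
  {P : 𝒜 → ℕ → Measure (ℝ × (Fin d → ℝ))} {r : 𝒜 → ℝ} {c : 𝒜 → Fin d → ℝ} {a₀ : 𝒜}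
  {W : ℕ → Ω → 𝒜 → ℝ × (Fin d → ℝ)} {A : ℕ → Ω → 𝒜}

/-- All demands, and the outcomes of the rounds before `t`. -/
abbrev infoAlg (T : ℕ) (ξ : ℕ → Ω → ℝ) (W : ℕ → Ω → 𝒜 → ℝ × (Fin d → ℝ)) (t : ℕ) :
    MeasurableSpace Ω :=
  MeasurableSpace.comap (fun ω (s : Finset.Icc 1 T) => ξ s ω) inferInstance ⊔
    ⨆ s ∈ {s : Finset.Icc 1 T | (s : ℕ) < t}, MeasurableSpace.comap (W s) inferInstance

lemma infoAlg_mono : Monotone (infoAlg T ξ W) := fun _ _ h =>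
  sup_le_sup_left (biSup_mono fun _ hi => lt_of_lt_of_le hi h) _

lemma measurable_noise_infoAlg {s : ℕ} (hs : s ∈ Finset.Icc 1 T) (t : ℕ) :
    Measurable[infoAlg T ξ W t] (ξ s) := by
  have h : Measurable[MeasurableSpace.comap (fun ω (s : Finset.Icc 1 T) => ξ s ω) inferInstance]
      (ξ s) := (measurable_pi_apply (⟨s, hs⟩ : Finset.Icc 1 T)).comp
        (comap_measurable (fun ω (s : Finset.Icc 1 T) => ξ s ω))
  exact h.mono le_sup_left le_rfl

lemma measurable_outcome_infoAlg {s t : ℕ} (hs : s ∈ Finset.Icc 1 T) (hst : s < t) :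
    Measurable[infoAlg T ξ W t] (W s) := by
  refine (comap_measurable (W s)).mono (le_trans ?_ le_sup_right) le_rfl
  exact le_biSup (f := fun s : Finset.Icc 1 T => MeasurableSpace.comap (W s) inferInstance)
    (i := ⟨s, hs⟩) hst

/-- The coordinates of an outcome: the reward and the consumptions. -/
def outcomeCoord : Option (Fin d) → ℝ × (Fin d → ℝ) → ℝ
  | none, y => y.1
  | some i, y => y.2 i

/-- The sample points at which the noise and the outcomes stay in their supports. -/
def regularSet (T : ℕ) (M : ℝ) (ξ : ℕ → Ω → ℝ) (W : ℕ → Ω → 𝒜 → ℝ × (Fin d → ℝ)) : Set Ω :=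
  {ω | ∀ t ∈ Finset.Icc 1 T, ξ t ω ∈ Set.Icc (-M) M ∧
    ∀ k a, outcomeCoord k (W t ω a) ∈ Set.Icc (0 : ℝ) 1}

lemma nearTrend_of_mem {α β : ℝ} {ω : Ω} (hω : ω ∈ regularSet T M ξ W) :
    NearTrend α β M T fun t => α + β * (t : ℝ) + ξ t ω := fun t ht => by
  have := (hω t ht).1
  exact ⟨by linarith [this.1], by linarith [this.2]⟩

variable [mΩ : MeasurableSpace Ω] {μ : Measure Ω}

lemma infoAlg_le (hξ : IsDemandNoise μ T M ξ) (hW : IsOutcomeTable μ T ξ P W) (t : ℕ) :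
    infoAlg T ξ W t ≤ mΩ := by
  refine sup_le (Measurable.comap_le (measurable_pi_lambda _ fun s => hξ.measurable s s.2)) ?_
  exact iSup₂_le fun s _ => (hW.measurable s s.2).comap_le

lemma indep_infoAlg [IsProbabilityMeasure μ] (hξ : IsDemandNoise μ T M ξ) (hW : IsOutcomeTable μ T ξ P W) {t : ℕ}
    (ht : t ∈ Finset.Icc 1 T) :
    Indep (infoAlg T ξ W t) (MeasurableSpace.comap (W t) inferInstance) μ := by
  have hcomap : ∀ s : Finset.Icc 1 T, MeasurableSpace.comap (W s) inferInstance ≤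
      MeasurableSpace.comap (fun ω (t : Finset.Icc 1 T) => W t ω) inferInstance := fun s => by
    rw [← measurable_iff_comap_le]
    exact (measurable_pi_apply s).comp (comap_measurable (fun ω (t : Finset.Icc 1 T) => W t ω))
  refine indep_sup_left
    (Measurable.comap_le (measurable_pi_lambda _ fun s => hξ.measurable s s.2))
    (iSup₂_le fun s _ => (hW.measurable s s.2).comap_le) (hW.measurable t ht).comap_le ?_ ?_
  · refine indep_of_indep_of_le_right (m₁ := MeasurableSpace.comap
      (fun ω (s : Finset.Icc 1 T) => ξ s ω) inferInstance) (m₂ := MeasurableSpace.comap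
      (fun ω (t : Finset.Icc 1 T) => W t ω) inferInstance) hW.indep_noise ?_
    exact sup_le (iSup₂_le fun s _ => hcomap s) (hcomap ⟨t, ht⟩)
  · have h := indep_iSup_of_disjoint (fun s : Finset.Icc 1 T => (hW.measurable s s.2).comap_le)
      hW.indep (S := {s : Finset.Icc 1 T | (s : ℕ) < t}) (T := {⟨t, ht⟩})
      (Set.disjoint_singleton_right.2 (lt_irrefl t))
    simpa using h

/-- Enlarging the information by all demands, future ones included, preserves independence from the
current outcomes and makes q_t a predictable weight. Measurability of the actions follows by strong
induction, since the history consists of earlier actions, demands and outcomes. -/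
theorem isAdaptedPlay [Fintype 𝒜] [IsProbabilityMeasure μ] {α β F₁ B δ : ℝ} {F₂ : ℝ → ℝ}
    (hξ : IsDemandNoise μ T M ξ) (hW : IsOutcomeTable μ T ξ P W)
    (hrun : IsOAUCBRun T B δ a₀ (trajectory T α β F₁ F₂ ξ W A)) :
    IsAdaptedPlay μ T (infoAlg T ξ W) W A where
  le := infoAlg_le hξ hW
  mono := infoAlg_mono
  meas t ht := measurable_outcome_infoAlg ht (Nat.lt_succ_self t)
  indep t ht := indep_infoAlg hξ hW ht
  act := by
    intro t
    induction t using Nat.strong_induction_on with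
    | _ t ih =>
      intro ht a
      refine (?_ : history (trajectory T α β F₁ F₂ ξ W A) t ≤ infoAlg T ξ W t) _
        (hrun.adapted t ht a)
      refine iSup₂_le fun s hs => ?_
      rw [Finset.mem_Ico] at hs
      have hsT : s ∈ Finset.Icc 1 T :=
        Finset.mem_Icc.2 ⟨hs.1, by have := (Finset.mem_Icc.1 ht).2; omega⟩
      have hA : ∀ a, MeasurableSet[infoAlg T ξ W t] {ω | A s ω = a} := fun a =>
        infoAlg_mono hs.2.le _ (ih s hs.2 hsT a)
      refine sup_le ?_ ?_
      · rintro _ ⟨S, -, rfl⟩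
        have : (fun ω => (trajectory T α β F₁ F₂ ξ W A ω).act s) ⁻¹' S =
            ⋃ a ∈ S, {ω | A s ω = a} := by
          ext ω; simp [trajectory]
        rw [this]
        exact MeasurableSet.biUnion S.to_countable fun a _ => hA a
      · rw [← measurable_iff_comap_le]
        have hWm : Measurable[infoAlg T ξ W t] fun ω => W s ω (A s ω) :=
          @measurable_apply_choice Ω 𝒜 _ (infoAlg T ξ W t) (A s) hA _ _ (fun a ω => W s ω a)
            fun a => (measurable_pi_apply a).comp (measurable_outcome_infoAlg hsT hs.2)
        exact ((measurable_noise_infoAlg hsT t).const_add _).prodMk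
          ((measurable_fst.comp hWm).prodMk (measurable_snd.comp hWm))

lemma measurable_outcomeCoord (k : Option (Fin d)) : Measurable (outcomeCoord k) := by
  rcases k with _ | i
  · exact measurable_fst
  · exact (measurable_pi_apply i).comp measurable_snd

lemma outcomeCoord_mem (hP : IsOutcomeModel T P r c a₀) (k : Option (Fin d)) (a : 𝒜) {t : ℕ}
    (ht : t ∈ Finset.Icc 1 T) : ∀ᵐ y ∂(P a t), outcomeCoord k y ∈ Set.Icc (0 : ℝ) 1 := by
  filter_upwards [hP.support a t ht] with y hy
  rcases k with _ | i
  · exact hy.1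
  · exact hy.2 i

lemma integral_outcomeCoord (hP : IsOutcomeModel T P r c a₀) (k : Option (Fin d)) (a : 𝒜) {t : ℕ}
    (ht : t ∈ Finset.Icc 1 T) : ∫ y, outcomeCoord k y ∂(P a t) = k.elim (r a) (c a) := by
  rcases k with _ | i
  · exact hP.mean_rew a t ht
  · exact hP.mean_cons a t ht i

lemma mean_mem (hP : IsOutcomeModel T P r c a₀) (hT : 1 ≤ T) (k : Option (Fin d)) (a : 𝒜) :
    k.elim (r a) (c a) ∈ Set.Icc (0 : ℝ) 1 := by
  have ht : 1 ∈ Finset.Icc 1 T := Finset.mem_Icc.2 ⟨le_rfl, hT⟩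
  have := hP.isProb a 1 ht
  have hm := outcomeCoord_mem hP k a ht
  rw [← integral_outcomeCoord hP k a ht]
  refine ⟨integral_nonneg_of_ae (hm.mono fun y hy => hy.1), ?_⟩
  calc _ ≤ ∫ _y, (1 : ℝ) ∂(P a 1) := integral_mono_ae
        (Integrable.of_mem_Icc 0 1 (measurable_outcomeCoord k).aemeasurable hm)
        (integrable_const 1) (hm.mono fun y hy => hy.2)
    _ = 1 := by simp

lemma null_cons (hP : IsOutcomeModel T P r c a₀) (hT : 1 ≤ T) (i : Fin d) : c a₀ i = 0 := by
  have ht : 1 ∈ Finset.Icc 1 T := Finset.mem_Icc.2 ⟨le_rfl, hT⟩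
  rw [← hP.mean_cons a₀ 1 ht i, hP.null 1 ht]
  rw [integral_dirac']
  · rfl
  · exact ((measurable_pi_apply i).comp measurable_snd).stronglyMeasurable

lemma outcome_mem (hP : IsOutcomeModel T P r c a₀) (hW : IsOutcomeTable μ T ξ P W)
    (k : Option (Fin d)) (a : 𝒜) : ∀ t ∈ Finset.Icc 1 T,
    ∀ᵐ ω ∂μ, outcomeCoord k (W t ω a) ∈ Set.Icc (0 : ℝ) 1 := fun t ht => by
  have hm : Measurable fun ω => W t ω a := (measurable_pi_apply a).comp (hW.measurable t ht)
  have := outcomeCoord_mem hP k a ht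
  rw [← hW.law a t ht] at this
  exact ae_of_ae_map hm.aemeasurable this

lemma integral_outcome (hP : IsOutcomeModel T P r c a₀) (hW : IsOutcomeTable μ T ξ P W)
    (k : Option (Fin d)) (a : 𝒜) : ∀ t ∈ Finset.Icc 1 T,
    ∫ ω, outcomeCoord k (W t ω a) ∂μ = k.elim (r a) (c a) := fun t ht => by
  have hm : Measurable fun ω => W t ω a := (measurable_pi_apply a).comp (hW.measurable t ht)
  rw [← integral_outcomeCoord hP k a ht, ← hW.law a t ht, integral_map hm.aemeasurable
    (measurable_outcomeCoord k).aestronglyMeasurable]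

/-- Only subadditivity is used, so neither set needs to be measurable. -/
lemma one_sub_le_measureReal [IsProbabilityMeasure μ] {S Z : Set Ω} {p : ℝ} (h : Sᶜ ⊆ Z) (hZ : μ.real Z ≤ p) :
    1 - p ≤ μ.real S := by
  have h1 : μ.real (Set.univ : Set Ω) ≤ μ.real S + μ.real Sᶜ := by
    rw [← Set.union_compl_self S]; exact measureReal_union_le _ _
  rw [probReal_univ] at h1
  linarith [measureReal_mono h (μ := μ)]

lemma measureReal_compl_regularSet [Finite 𝒜] (hξ : IsDemandNoise μ T M ξ) (hP : IsOutcomeModel T P r c a₀)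
    (hW : IsOutcomeTable μ T ξ P W) : μ.real (regularSet T M ξ W)ᶜ = 0 := by
  have h : ∀ᵐ ω ∂μ, ω ∈ regularSet T M ξ W := by
    have : ∀ᵐ ω ∂μ, ∀ t : Finset.Icc 1 T, ξ t ω ∈ Set.Icc (-M) M ∧
        ∀ k a, outcomeCoord k (W t ω a) ∈ Set.Icc (0 : ℝ) 1 :=
      ae_all_iff.2 fun t => (hξ.bounded t t.2).and (ae_all_iff.2 fun k => ae_all_iff.2 fun a =>
        outcome_mem hP hW k a t t.2)
    filter_upwards [this] with ω hω t ht using hω ⟨t, ht⟩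
  have h0 : μ (regularSet T M ξ W)ᶜ = 0 := mem_ae_iff.1 h
  rw [measureReal_def, h0, ENNReal.toReal_zero]

/-- The event that some prediction is less accurate than claimed. -/
def inaccurateSet (T : ℕ) (M δ α β F₁ : ℝ) (F₂ : ℝ → ℝ) (ξ : ℕ → Ω → ℝ) : Set Ω :=
  ⋃ t ∈ Finset.Icc 3 T, {ω | accuracy 10 M δ T t <
    |totalDemand T (fun s => α + β * (s : ℝ) + ξ s ω) -
      lsPrediction T F₁ F₂ (fun s => α + β * (s : ℝ) + ξ s ω) t|}

lemma measureReal_inaccurateSet_le [IsProbabilityMeasure μ] (hξ : IsDemandNoise μ T M ξ) (hM : 0 < M) {δ : ℝ} (hδ0 : 0 < δ)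
    (hδ1 : δ < 1) (α β F₁ : ℝ) (F₂ : ℝ → ℝ) :
    μ.real (inaccurateSet T M δ α β F₁ F₂ ξ) ≤ ((T - 2 : ℕ) : ℝ) * (2 * δ ^ 2) := by
  refine (measureReal_biUnion_finset_le _ _).trans ?_
  refine (Finset.sum_le_card_nsmul _ _ _ fun t ht =>
    oracle_tail hξ hM hδ0 hδ1 F₁ F₂ α β ht).trans (le_of_eq ?_)
  rw [Nat.card_Icc, nsmul_eq_mul]
  rfl

end Model

/-! ### Probability of concentration -/

lemma Trajectory.pulls_le {𝒜 : Type*} {d T : ℕ} (x : Trajectory 𝒜 d) {t : ℕ} (ht : t ∈ Finset.Icc 1 T) (a : 𝒜) :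
    x.pulls t a ≤ T := by
  classical
  refine (Finset.card_filter_le _ _).trans ?_
  rw [Nat.card_Ico]
  have := (Finset.mem_Icc.1 ht).2
  omega

lemma measureReal_le_mul_of_exists {Ω : Type*} [MeasurableSpace Ω] {μ : Measure Ω}
    [IsProbabilityMeasure μ] {T : ℕ} {E : ℕ → Set Ω} {F : Set Ω} {p : ℝ}
    (hF : ∀ ω ∈ F, ∃ n ∈ Finset.Icc 1 T, ω ∈ E n) (hE : ∀ n ∈ Finset.Icc 1 T, μ.real (E n) ≤ p) :
    μ.real F ≤ T * p := by
  calc μ.real F ≤ μ.real (⋃ n ∈ Finset.Icc 1 T, E n) :=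
        measureReal_mono (fun ω hω => by
          obtain ⟨n, hn, h⟩ := hF ω hω
          exact Set.mem_biUnion hn h) (measure_ne_top μ _)
    _ ≤ ∑ n ∈ Finset.Icc 1 T, μ.real (E n) := measureReal_biUnion_finset_le _ _
    _ ≤ _ := by
        refine (Finset.sum_le_card_nsmul _ _ _ hE).trans (le_of_eq ?_)
        rw [Nat.card_Icc, nsmul_eq_mul]
        rfl

lemma measureReal_iUnion_le_card_mul {Ω : Type*} [MeasurableSpace Ω] {μ : Measure Ω}
    [IsProbabilityMeasure μ] {ι : Type*} [Fintype ι] {E : ι → Set Ω} {p : ℝ}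
    (h : ∀ i, μ.real (E i) ≤ p) : μ.real (⋃ i, E i) ≤ Fintype.card ι * p := by
  refine (measureReal_iUnion_fintype_le _).trans ?_
  refine (Finset.sum_le_card_nsmul _ _ _ fun i _ => h i).trans (le_of_eq ?_)
  rw [nsmul_eq_mul]
  rfl

namespace IsAdaptedPlay

variable {Ω : Type*} [mΩ : MeasurableSpace Ω] {μ : Measure Ω} [IsProbabilityMeasure μ]
  {𝒜 : Type*} [Fintype 𝒜] {d T : ℕ} {G : ℕ → MeasurableSpace Ω}
  {W : ℕ → Ω → 𝒜 → ℝ × (Fin d → ℝ)} {A : ℕ → Ω → 𝒜} {X : Ω → Trajectory 𝒜 d} {ν : 𝒜 → ℝ}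
  {k : Option (Fin d)}

theorem lower_failure (h : IsAdaptedPlay μ T G W A)
    (hz01 : ∀ a, ∀ t ∈ Finset.Icc 1 T, ∀ᵐ ω ∂μ, outcomeCoord k (W t ω a) ∈ Set.Icc (0 : ℝ) 1)
    (hν : ∀ a, ∀ t ∈ Finset.Icc 1 T, ∫ ω, outcomeCoord k (W t ω a) ∂μ = ν a)
    (hact : ∀ ω s, (X ω).act s = A s ω)
    (hout : ∀ ω s, (X ω).out k s = outcomeCoord k (W s ω (A s ω))) (a : 𝒜) (hνa : 0 ≤ ν a)
    {ℓ : ℝ} (hℓ : 0 < ℓ) :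
    μ.real {ω | ∃ t ∈ Finset.Icc 1 T, 0 ≤ (X ω).outSum k t a ∧
      (X ω).outSum k t a + Real.sqrt (2 * ((X ω).pulls t a * ν a) * ℓ) <
        (X ω).pulls t a * ν a} ≤ T * Real.exp (-ℓ) := by
  obtain rfl : A = fun s ω => (X ω).act s := by funext s ω; exact (hact ω s).symm
  refine measureReal_le_mul_of_exists ?_ fun n _ =>
    h.arm_lower_tail (measurable_outcomeCoord k) hz01 hν a hνa n hℓ
  rintro ω ⟨t, ht, h0, hlt⟩
  refine ⟨(X ω).pulls t a, Finset.mem_Icc.2 ⟨?_, Trajectory.pulls_le _ ht a⟩, t, ht, ?_⟩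
  -- Without pulls both sides vanish and the strict inequality fails, so n = 0 costs nothing in the
  -- union bound.
  · by_contra! hn
    have hn : (X ω).pulls t a = 0 := by omega
    simp [hn, Trajectory.outSum_eq_zero] at hlt
  · simp only [Trajectory.outSum, hout] at h0 hlt ⊢
    exact ⟨rfl, h0, hlt⟩

theorem upper_failure (h : IsAdaptedPlay μ T G W A)
    (hz01 : ∀ a, ∀ t ∈ Finset.Icc 1 T, ∀ᵐ ω ∂μ, outcomeCoord k (W t ω a) ∈ Set.Icc (0 : ℝ) 1)
    (hν : ∀ a, ∀ t ∈ Finset.Icc 1 T, ∫ ω, outcomeCoord k (W t ω a) ∂μ = ν a)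
    (hact : ∀ ω s, (X ω).act s = A s ω)
    (hout : ∀ ω s, (X ω).out k s = outcomeCoord k (W s ω (A s ω))) (a : 𝒜) (hνa : 0 ≤ ν a)
    {ℓ : ℝ} (hℓ : 0 < ℓ) :
    μ.real {ω | ∃ t ∈ Finset.Icc 1 T,
      (X ω).pulls t a * ν a + Real.sqrt (2 * ((X ω).pulls t a * ν a) * ℓ) + 2 * ℓ <
        (X ω).outSum k t a} ≤ T * Real.exp (-ℓ) := by
  obtain rfl : A = fun s ω => (X ω).act s := by funext s ω; exact (hact ω s).symm
  refine measureReal_le_mul_of_exists ?_ fun n _ =>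
    h.arm_upper_tail (measurable_outcomeCoord k) hz01 hν a hνa n hℓ
  rintro ω ⟨t, ht, hlt⟩
  refine ⟨(X ω).pulls t a, Finset.mem_Icc.2 ⟨?_, Trajectory.pulls_le _ ht a⟩, t, ht, ?_⟩
  · by_contra! hn
    have hn : (X ω).pulls t a = 0 := by omega
    simp [hn, Trajectory.outSum_eq_zero] at hlt
    linarith
  · simp only [Trajectory.outSum, hout] at hlt ⊢
    exact ⟨rfl, hlt⟩

/-- Dividing demands by q̄ gives weights in [0,1]; the two signs account for the factor 2. -/
theorem weighted_failure (h : IsAdaptedPlay μ T G W A)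
    (hz01 : ∀ a, ∀ t ∈ Finset.Icc 1 T, ∀ᵐ ω ∂μ, outcomeCoord k (W t ω a) ∈ Set.Icc (0 : ℝ) 1)
    (hν : ∀ a, ∀ t ∈ Finset.Icc 1 T, ∫ ω, outcomeCoord k (W t ω a) ∂μ = ν a)
    (hact : ∀ ω s, (X ω).act s = A s ω)
    (hout : ∀ ω s, (X ω).out k s = outcomeCoord k (W s ω (A s ω)))
    (hν01 : ∀ a, ν a ∈ Set.Icc (0 : ℝ) 1) {qbar : ℝ} (hqbar : 0 < qbar)
    (hq : ∀ t ∈ Finset.Icc 1 T, Measurable[G t] fun ω => (X ω).q t) {ℓ : ℝ} (hℓ : 0 < ℓ) :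
    μ.real {ω | (∀ t ∈ Finset.Icc 1 T, (X ω).q t ∈ Set.Ioc 0 qbar ∧
        (X ω).out k t ∈ Set.Icc (0 : ℝ) 1) ∧
      ∃ n ≤ T, qbar * (2 * Real.sqrt (n * ℓ)) < |∑ s ∈ Finset.Ico 1 (n + 1),
        (X ω).q s * ((X ω).out k s - ν ((X ω).act s))|} ≤ T * (2 * Real.exp (-ℓ)) := by
  let E : ℝ → ℕ → Set Ω := fun σ n => {ω | (∀ s ∈ Finset.Icc 1 T,
      (X ω).q s / qbar ∈ Set.Icc (0 : ℝ) 1 ∧ outcomeCoord k (W s ω (A s ω)) ∈ Set.Icc (0 : ℝ) 1) ∧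
    2 * Real.sqrt (n * ℓ) < σ * ∑ s ∈ Finset.Ico 1 (n + 1),
      (X ω).q s / qbar * (outcomeCoord k (W s ω (A s ω)) - ν (A s ω))}
  have hE : ∀ n ∈ Finset.Icc 1 T, μ.real (E 1 n ∪ E (-1) n) ≤ 2 * Real.exp (-ℓ) := fun n hn => by
    rw [Finset.mem_Icc] at hn
    have htail := fun σ hσ => h.weighted_sum_tail (measurable_outcomeCoord k) hz01 hν hν01
      (y := fun s ω => (X ω).q s / qbar) (fun t ht => (hq t ht).div_const _) (n := n) hn.1 hn.2 hℓ
      (σ := σ) hσ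
    rw [two_mul]
    exact (measureReal_union_le _ _).trans
      (add_le_add (htail 1 (Or.inl rfl)) (htail (-1) (Or.inr rfl)))
  refine measureReal_le_mul_of_exists ?_ hE
  rintro ω ⟨hreg, n, hn, hlt⟩
  refine ⟨n, Finset.mem_Icc.2 ⟨?_, hn⟩, ?_⟩
  · by_contra! hn
    have hn : n = 0 := by omega
    simp [hn] at hlt
  have hreg' : ∀ s ∈ Finset.Icc 1 T, (X ω).q s / qbar ∈ Set.Icc (0 : ℝ) 1 ∧
      outcomeCoord k (W s ω (A s ω)) ∈ Set.Icc (0 : ℝ) 1 := fun s hs => by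
    obtain ⟨h1, h2⟩ := hreg s hs
    rw [hout] at h2
    exact ⟨⟨div_nonneg h1.1.le hqbar.le, (div_le_one hqbar).2 h1.2⟩, h2⟩
  simp only [hact, hout] at hlt
  have hsum : ∑ s ∈ Finset.Ico 1 (n + 1), (X ω).q s *
      (outcomeCoord k (W s ω (A s ω)) - ν (A s ω)) = qbar * ∑ s ∈ Finset.Ico 1 (n + 1),
        (X ω).q s / qbar * (outcomeCoord k (W s ω (A s ω)) - ν (A s ω)) := by
    rw [Finset.mul_sum]
    refine Finset.sum_congr rfl fun s _ => ?_
    field_simp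
  rw [hsum, abs_mul, abs_of_pos hqbar, mul_lt_mul_iff_right₀ hqbar, lt_abs] at hlt
  rcases hlt with hlt | hlt
  · exact Or.inl ⟨hreg', by rwa [one_mul]⟩
  · exact Or.inr ⟨hreg', by rwa [neg_one_mul]⟩

end IsAdaptedPlay

section Model

variable {Ω : Type*} [mΩ : MeasurableSpace Ω] {μ : Measure Ω} [IsProbabilityMeasure μ]
  {𝒜 : Type*} [Fintype 𝒜] {d T : ℕ} {ξ : ℕ → Ω → ℝ} {M : ℝ}
  {P : 𝒜 → ℕ → Measure (ℝ × (Fin d → ℝ))} {r : 𝒜 → ℝ} {c : 𝒜 → Fin d → ℝ} {a₀ : 𝒜}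
  {W : ℕ → Ω → 𝒜 → ℝ × (Fin d → ℝ)} {A : ℕ → Ω → 𝒜}

/-- Only rewards from below and consumptions from above, the two directions behind optimism, are
taken at level L = log(1/δ), matching the radius of the algorithm. The others use 2L and fail with
probability of order δ². -/
theorem exists_concentration_failure {κ c₁ α β b qbar B δ F₁ : ℝ} {F₂ : ℝ → ℝ}
    (hmod : IsDemandModel κ c₁ α β M b qbar B T) (hδ0 : 0 < δ) (hδ1 : δ < 1)
    (hξ : IsDemandNoise μ T M ξ) (hP : IsOutcomeModel T P r c a₀)
    (hW : IsOutcomeTable μ T ξ P W) (hrun : IsOAUCBRun T B δ a₀ (trajectory T α β F₁ F₂ ξ W A)) :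
    ∃ Z : Set Ω, (∀ ω ∈ regularSet T M ξ W, ω ∉ Z →
        (trajectory T α β F₁ F₂ ξ W A ω).IsConcentrated T qbar (Real.log (1 / δ))
          (fun k a => k.elim (r a) (c a))) ∧
      μ.real Z ≤ Fintype.card 𝒜 * (T * δ) + (Fintype.card 𝒜 * (T * δ ^ 2) +
        ((Fintype.card 𝒜 * d) * (T * δ ^ 2) + ((Fintype.card 𝒜 * d) * (T * δ) +
          (d + 1) * (T * (2 * δ ^ 2))))) := by
  set X := trajectory T α β F₁ F₂ ξ W A
  set L := Real.log (1 / δ) with hLdef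
  have hL : 0 < L := Real.log_pos (by rwa [lt_div_iff₀ hδ0, one_mul])
  have he1 : Real.exp (-L) = δ := by
    rw [hLdef, one_div, Real.log_inv, neg_neg, Real.exp_log hδ0]
  have he2 : Real.exp (-(2 * L)) = δ ^ 2 := by
    rw [show -(2 * L) = -L + -L by ring, Real.exp_add, he1, sq]
  have hplay := isAdaptedPlay hξ hW hrun
  have hmean := mean_mem hP hmod.one_le
  have hact : ∀ ω s, (X ω).act s = A s ω := fun _ _ => rfl
  have hout : ∀ k ω s, (X ω).out k s = outcomeCoord k (W s ω (A s ω)) := fun k ω s => by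
    cases k <;> rfl
  have hlow := fun k a {ℓ : ℝ} (hℓ : 0 < ℓ) => hplay.lower_failure (outcome_mem hP hW k)
    (integral_outcome hP hW k) hact (hout k) a (hmean k a).1 hℓ
  have hupp := fun k a {ℓ : ℝ} (hℓ : 0 < ℓ) => hplay.upper_failure (outcome_mem hP hW k)
    (integral_outcome hP hW k) hact (hout k) a (hmean k a).1 hℓ
  have hwei := fun k => hplay.weighted_failure (outcome_mem hP hW k)
    (integral_outcome hP hW k) hact (hout k) (hmean k) hmod.qbar_pos
    (fun t ht => (measurable_noise_infoAlg ht t).const_add _) (mul_pos two_pos hL)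
  have h1 := measureReal_iUnion_le_card_mul fun a => hlow none a hL
  have h2 := measureReal_iUnion_le_card_mul fun a => hupp none a (mul_pos two_pos hL)
  have h3 := measureReal_iUnion_le_card_mul
    fun p : 𝒜 × Fin d => hlow (some p.2) p.1 (mul_pos two_pos hL)
  have h4 := measureReal_iUnion_le_card_mul fun p : 𝒜 × Fin d => hupp (some p.2) p.1 hL
  have h5 := measureReal_iUnion_le_card_mul hwei
  simp only [he1, he2, Fintype.card_prod, Fintype.card_option, Fintype.card_fin, Nat.cast_mul,
    Nat.cast_add, Nat.cast_one] at h1 h2 h3 h4 h5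
  refine ⟨_, ?_, (measureReal_union_le _ _).trans (add_le_add h1 <|
    (measureReal_union_le _ _).trans (add_le_add h2 <|
    (measureReal_union_le _ _).trans (add_le_add h3 <|
    (measureReal_union_le _ _).trans (add_le_add h4 h5))))⟩
  intro ω hω hZ
  simp only [Set.mem_union, not_or, Set.mem_iUnion, not_exists, Set.mem_ofPred_eq, not_and,
    not_lt, Prod.forall] at hZ
  obtain ⟨h1, h2, h3, h4, h5⟩ := hZ
  have hdem : ∀ t ∈ Finset.Icc 1 T, (X ω).q t ∈ Set.Ioc 0 qbar := fun t ht =>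
    hmod.demand_mem (nearTrend_of_mem hω) ht
  have hmem : ∀ k, ∀ t ∈ Finset.Icc 1 T, (X ω).out k t ∈ Set.Icc (0 : ℝ) 1 := fun k t ht => by
    rw [hout]; exact (hω t ht).2 k _
  have hsum : ∀ k, ∀ t ∈ Finset.Icc 1 T, ∀ a, 0 ≤ (X ω).outSum k t a := fun k t ht a => by
    refine Finset.sum_nonneg fun s hs => ?_
    have hs' := Finset.mem_Ico.1 hs
    have ht' := Finset.mem_Icc.1 ht
    split_ifs
    · exact (hmem k s (Finset.mem_Icc.2 ⟨hs'.1, by omega⟩)).1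
    · exact le_rfl
  exact
    { demand := hdem
      out_mem := hmem
      rew_lower := fun t ht a => h1 a t ht (hsum none t ht a)
      rew_upper := fun t ht a => h2 a t ht
      cons_lower := fun t ht a i => h3 a i t ht (hsum (some i) t ht a)
      cons_upper := fun t ht a i => h4 a i t ht
      weighted := fun k n hn => h5 k (fun t ht => ⟨hdem t ht, hmem k t ht⟩) n hn }

/-- The first-order terms use 2KTdδ. With δ ≤ 1/4, all δ² terms fit into the remaining KTdδ + Tδ. -/
lemma failure_budget {K d T δ : ℝ} (hK : 1 ≤ K) (hd : 1 ≤ d) (hT : 1 ≤ T) (hδ0 : 0 < δ)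
    (hδ1 : δ ≤ 1 / 4) :
    T * (2 * δ ^ 2) + (K * (T * δ) + (K * (T * δ ^ 2) + ((K * d) * (T * δ ^ 2) +
      ((K * d) * (T * δ) + (d + 1) * (T * (2 * δ ^ 2)))))) ≤ 3 * K * T * d * δ + T * δ := by
  have hTδ : 0 ≤ T * δ := by positivity
  have h2 : δ ^ 2 ≤ δ / 4 := by nlinarith
  have hT2 : T * δ ^ 2 ≤ T * δ / 4 := by nlinarith
  have hKd : K ≤ K * d := le_mul_of_one_le_right (by linarith) hd
  have hdK : d ≤ K * d := le_mul_of_one_le_left (by linarith) hK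
  calc _ = (T * δ ^ 2) * (4 + K + K * d + 2 * d) + (K + K * d) * (T * δ) := by ring
    _ ≤ (T * δ / 4) * (4 + K + K * d + 2 * d) + (K + K * d) * (T * δ) := by gcongr
    _ = (T * δ) * (1 + (5 / 4) * K + (5 / 4) * (K * d) + d / 2) := by ring
    _ ≤ (T * δ) * (1 + 3 * (K * d)) := mul_le_mul_of_nonneg_left (by linarith) hTδ
    _ = _ := by ring

end Model

end OAUCB

end

/-! ### Assembly of the oracle bound and the regret bound -/

theorem theorem3 :
    ∃ C₀ : ℝ, 0 < C₀ ∧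
    -- constants may depend only on a bound for `α / β` and on the constants in `b = Θ(q̄)`
    ∀ κ c₁ c₂ : ℝ, 0 < κ → 0 < c₁ → 0 < c₂ →
    ∃ C : ℝ, 0 < C ∧
    ∀ (T d : ℕ) (α β M b δ : ℝ) (_hT : 1 ≤ T) (_hd : 1 ≤ d)
      (_hM : 0 < M) (_hα : M < α) (_hβ : 0 < β) (_hκ : α ≤ κ * β)
      (qbar : ℝ) (_hqbar : qbar = α + β * (T : ℝ) + M)
      (_hb₁ : c₁ * qbar ≤ b) (_hb₂ : b ≤ c₂ * qbar) (B : ℝ) (_hB : B = b * (T : ℝ))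
      (_hδ₀ : 0 < δ) (_hδ₁ : δ < 1)
      -- predictions of the first two rounds
      (F₁ : ℝ) (F₂ : ℝ → ℝ) (_hF₁ : F₁ ∈ Set.Icc 0 (qbar * (T : ℝ))) (_hF₂ : Measurable F₂)
      (_hF₂' : ∀ y, F₂ y ∈ Set.Icc 0 (qbar * (T : ℝ)))
      (Ω : Type*) [MeasurableSpace Ω] (μ : Measure Ω) [IsProbabilityMeasure μ]
      (𝒜 : Type*) [Fintype 𝒜] (a₀ : 𝒜)
      (P : 𝒜 → ℕ → Measure (ℝ × (Fin d → ℝ))) (r : 𝒜 → ℝ) (c : 𝒜 → Fin d → ℝ)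
      (_hP : OAUCB.IsOutcomeModel T P r c a₀)
      (ξ : ℕ → Ω → ℝ) (_hξ : OAUCB.IsDemandNoise μ T M ξ)
      (W : ℕ → Ω → 𝒜 → ℝ × (Fin d → ℝ)) (_hW : OAUCB.IsOutcomeTable μ T ξ P W)
      (A : ℕ → Ω → 𝒜) (X : Ω → OAUCB.Trajectory 𝒜 d)
      (_hX : X = OAUCB.trajectory T α β F₁ F₂ ξ W A)
      (_hrun : OAUCB.IsOAUCBRun T B δ a₀ X)
      (τ : Ω → ℕ) (_hτ : τ = fun ω => (X ω).stopTime T B)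
      (Q : Ω → ℝ) (_hQ : Q = fun ω => OAUCB.totalDemand T (X ω).q)
      (OPT : Ω → ℝ) (_hOPT : OPT = fun ω => OAUCB.optLP (Q ω) B r c)
      (ε : ℕ → ℝ) (_hε : ε = OAUCB.accuracy C₀ M δ T)
      (S : Ω → ℝ)
      (_hS : S = fun ω => (1 / Q ω + 1 / B) * ∑ t ∈ Finset.Ico 1 (τ ω), (X ω).q t * ε t),
      -- accuracy of the oracle and the weighted accuracy sum
      (1 - (T : ℝ) * δ ≤ μ.real {ω |
        (∀ t ∈ Finset.Icc 3 T, |Q ω - (X ω).pred t| ≤ ε t) ∧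
        S ω ≤ C * (M * (1 + qbar / b) * Real.sqrt (((τ ω : ℝ) - 1) * Real.log (1 / δ))) ∧
        S ω ≤ C * Real.sqrt (Real.log (1 / δ)) * (M * Real.sqrt ((τ ω : ℝ) - 1))}) ∧
      -- regret
      (1 - 3 * (Fintype.card 𝒜 : ℝ) * (T : ℝ) * (d : ℝ) * δ - (T : ℝ) * δ ≤ μ.real {ω |
        OPT ω - (X ω).reward T B ≤
          C * (Real.log (1 / δ) * Real.log ((T : ℝ) + 1) * Real.log ((d : ℝ) + 1)) *
            (OPT ω * Real.sqrt (qbar * (Fintype.card 𝒜 : ℝ) / B)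
              + Real.sqrt (qbar * (Fintype.card 𝒜 : ℝ) * OPT ω)
              + (M + qbar) * Real.sqrt ((τ ω : ℝ) - 1))}) := by
  refine ⟨10, by norm_num, fun κ c₁ c₂ hκ0 hc₁ _ => ?_⟩
  set C₁ := (2 + 1 / c₁) * (2 * κ + 1) * 60 with hC₁
  set C₂ := 400 * (1 + 1 / c₁) + 12 * (1 + 4 / c₁ + 20 * κ / c₁) +
    248 * ((2 + 1 / c₁) * (2 * κ + 1)) with hC₂
  have hC₁0 : 0 < C₁ := by positivity
  have hC₂0 : 0 < C₂ := by positivity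
  refine ⟨C₁ + C₂, by positivity, ?_⟩
  intro T d α β M b δ hT hd hM hα hβ hκ qbar hqbar hb₁ hb₂ B hB hδ0 hδ1 F₁ F₂ hF₁ hF₂m hF₂
    Ω _ μ _ 𝒜 _ a₀ P r c hP ξ hξ W hW A X hX hrun τ hτ Q hQ OPT hOPT ε hε S hS
  subst hX hτ hQ hOPT hε hS
  have hmod : OAUCB.IsDemandModel κ c₁ α β M b qbar B T := ⟨hT, hM, hα, hβ, hκ, hqbar, hc₁, hb₁, hB⟩
  have hT1 : (1 : ℝ) ≤ T := hmod.T_pos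
  have hd1 : (1 : ℝ) ≤ d := by exact_mod_cast hd
  have hqb := hmod.qbar_pos
  have hb := hmod.b_pos
  have hL0 : 0 < Real.log (1 / δ) := Real.log_pos (by rwa [lt_div_iff₀ hδ0, one_mul])
  have hK : (1 : ℝ) ≤ Fintype.card 𝒜 := by
    exact_mod_cast Fintype.card_pos_iff.2 ⟨a₀⟩
  have hreg0 := OAUCB.measureReal_compl_regularSet hξ hP hW
  have hinacc := OAUCB.measureReal_inaccurateSet_le (T := T) hξ hM hδ0 hδ1 α β F₁ F₂
  have haccurate : ∀ ω ∉ OAUCB.inaccurateSet T M δ α β F₁ F₂ ξ, ∀ t ∈ Finset.Icc 3 T,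
      |OAUCB.totalDemand T (OAUCB.trajectory T α β F₁ F₂ ξ W A ω).q -
        (OAUCB.trajectory T α β F₁ F₂ ξ W A ω).pred t| ≤ OAUCB.accuracy 10 M δ T t :=
    fun ω hω t ht => by
      by_contra! hlt
      exact hω (Set.mem_biUnion ht hlt)
  refine ⟨?_, ?_⟩
  · rcases le_or_gt 1 (T * δ) with h | h
    · exact (sub_nonpos.2 h).trans measureReal_nonneg
    refine OAUCB.one_sub_le_measureReal (Z := (OAUCB.regularSet T M ξ W)ᶜ ∪
      OAUCB.inaccurateSet T M δ α β F₁ F₂ ξ) (Set.compl_subset_comm.1 fun ω hω => ?_) ?_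
    · rw [Set.compl_union, compl_compl] at hω
      obtain ⟨hω1, hω2⟩ := hω
      have hn1 := (OAUCB.trajectory T α β F₁ F₂ ξ W A ω).one_le_stopTime T B
      have hn2 := (OAUCB.trajectory T α β F₁ F₂ ξ W A ω).stopTime_le T B
      have hS := hmod.accuracy_sum_le (OAUCB.nearTrend_of_mem hω1) (δ := δ)
        (n := (OAUCB.trajectory T α β F₁ F₂ ξ W A ω).stopTime T B - 1) (by omega)
      rw [Nat.sub_add_cancel hn1, Nat.cast_sub hn1, Nat.cast_one, ← hC₁] at hS
      refine ⟨haccurate ω hω2, hS.trans ?_, hS.trans ?_⟩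
      · rw [Real.sqrt_mul' _ hL0.le]
        have hq1 : 1 ≤ 1 + qbar / b := le_add_of_nonneg_right (by positivity)
        calc _ = C₁ * (M * 1 * (Real.sqrt ((((OAUCB.trajectory T α β F₁ F₂ ξ W A ω).stopTime T B
                : ℝ) - 1)) * Real.sqrt (Real.log (1 / δ)))) := by ring
          _ ≤ _ := by gcongr; linarith
      · calc _ = C₁ * Real.sqrt (Real.log (1 / δ)) * (M * Real.sqrt
                (((OAUCB.trajectory T α β F₁ F₂ ξ W A ω).stopTime T B : ℝ) - 1)) := by ring
          _ ≤ _ := by gcongr; linarith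
    · refine (measureReal_union_le _ _).trans ?_
      rw [hreg0, zero_add]
      refine hinacc.trans ?_
      -- For T ≤ 2 no least-squares prediction is made; otherwise Tδ < 1 forces δ ≤ 1/3, so 2δ² ≤ δ.
      rcases le_or_gt T 2 with hT2 | hT2
      · rw [Nat.sub_eq_zero_of_le hT2, Nat.cast_zero, zero_mul]
        positivity
      · have hT3 : (3 : ℝ) ≤ T := by exact_mod_cast hT2
        have hδ3 : δ ≤ 1 / 3 := by nlinarith
        have : ((T - 2 : ℕ) : ℝ) ≤ T := by exact_mod_cast Nat.sub_le T 2
        calc _ ≤ (T : ℝ) * δ := mul_le_mul this (by nlinarith) (by positivity) (by positivity)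
          _ = _ := rfl
  · rcases le_or_gt (1 - 3 * (Fintype.card 𝒜 : ℝ) * T * d * δ - T * δ) 0 with h | h
    · exact h.trans measureReal_nonneg
    -- A positive probability bound forces 4δ < 1. As e < 4, this also gives log(1/δ) ≥ 1, required
    -- by the confidence bounds.
    have hδ4 : δ < 1 / 4 := by
      have h1 : δ ≤ T * δ := le_mul_of_one_le_left hδ0.le hT1
      have h2 : T * δ ≤ Fintype.card 𝒜 * d * (T * δ) :=
        le_mul_of_one_le_left (by positivity) (one_le_mul_of_one_le_of_one_le hK hd1)
      linarith
    have hL1 : 1 ≤ Real.log (1 / δ) := by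
      rw [Real.le_log_iff_exp_le (by positivity)]
      have := Real.exp_one_lt_d9
      rw [le_div_iff₀ hδ0]
      nlinarith
    obtain ⟨Z, hZ, hZp⟩ := OAUCB.exists_concentration_failure hmod hδ0 hδ1 hξ hP hW hrun
    rw [sub_sub]
    refine OAUCB.one_sub_le_measureReal (Z := (OAUCB.regularSet T M ξ W)ᶜ ∪
      (OAUCB.inaccurateSet T M δ α β F₁ F₂ ξ ∪ Z)) (Set.compl_subset_comm.1 fun ω hω => ?_) ?_
    · rw [Set.compl_union, Set.compl_union, compl_compl] at hω
      obtain ⟨hω1, hω2, hω3⟩ := hω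
      have hreg := OAUCB.Trajectory.regret_le_of_isConcentrated (r := r) (c := c) hmod hd hL1
        (OAUCB.nearTrend_of_mem hω1) (OAUCB.mean_mem hP hT none)
        (fun a i => OAUCB.mean_mem hP hT (some i) a) (OAUCB.null_cons hP hT) (hZ ω hω1 hω3)
        (hrun.follows ω) (haccurate ω hω2) fun t ht => by
          change OAUCB.lsPrediction _ _ _ _ _ ∈ _
          unfold OAUCB.lsPrediction
          split_ifs
          · exact hF₁
          · exact hF₂ _
          · omega
      have hopt : 0 ≤ OAUCB.optLP (OAUCB.totalDemand T
          (OAUCB.trajectory T α β F₁ F₂ ξ W A ω).q) B r c :=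
        OAUCB.optLP_nonneg (hmod.totalDemand_pos (OAUCB.nearTrend_of_mem hω1)).le
          fun a => (OAUCB.mean_mem hP hT none a).1
      have hlT := Real.log_nonneg (show (1 : ℝ) ≤ T + 1 by linarith)
      have hld := Real.log_nonneg (show (1 : ℝ) ≤ d + 1 by linarith)
      refine hreg.trans (mul_le_mul_of_nonneg_right (mul_le_mul_of_nonneg_right
        (le_add_of_nonneg_left hC₁0.le) (by positivity)) (by positivity))
    · refine (measureReal_union_le _ _).trans ?_
      rw [hreg0, zero_add]
      refine (measureReal_union_le _ _).trans ((add_le_add (hinacc.trans ?_) hZp).trans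
        (OAUCB.failure_budget hK hd1 hT1 hδ0 hδ4.le))
      gcongr
      exact_mod_cast Nat.sub_le T 2
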